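/- \textbf{Model.} Fix integers $n,T\ge 1$, vectors $\gamma,\mu\in(0,\infty)^n$ and constants $A_{\max},S_{\max}$. There are $n$ queues with lengths $Q(t)\in\mathbb N^n$. In slot $t$, $A(t)\in\mathbb N$ jobs arrive and all join one queue $I^*(t)$; then server $l$ serves up to $S_l(t)\in\mathbb N$ jobs, so $Q_l(t+1)=[Q_l(t)+A(t)\mathbf 1_{\{I^*(t)=l\}}-S_l(t)]^+$. The $A(t)$ are i.i.d. with mean $\sum_l\mu_l-\epsilon$, variance $n\sigma_\lambda^2$, and $A(t)\le nA_{\max}$ a.s.; the vectors $S(t)$ are i.i.d. in $t$, independent of the arrivals, with $E[S_l]=\mu_l$, $\mathrm{Var}(S_l)=\sigma_l^2$, $S_l\le S_{\max}$ a.s. \textbf{Policy.} At each time $kT$ the policy forms a permutation $\eta_k=L\big((Q_l(kT)/\gamma_l)_l,V_k\big)$ that orders the servers by decreasing scaled queue length $Q_l(kT)/\gamma_l$, and then takes the destinations of the jobs in the slots $kT,\dots,(k+1)T-1$ to be the entries of $Y(\eta_k,\mu,W_k)\in\{1,\dots,n\}^T$; here $L,Y$ are measurable in the randomization variables and $(V_k),(W_k)$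 are i.i.d. uniform on $[0,1]$, independent of each other and of arrivals and services. Let $f_{l,\eta}$ and $\tau^2_{l,\eta}$ be the mean and the variance of the fraction of the $T$ slots whose jobs are sent to server $\eta(l)$ when the permutation is $\eta$, and let $\mathcal F$ be the collection of all these numbers. The triple formed by $Q(t)$, the destinations of the current cycle and the position of $t$ within its cycle is a Markov chain; a steady state is a stationary distribution of it. Put $$\|O_\perp\|_2^2=\sum_{l=1}^n\Big(\frac{Q_l}{\sqrt{\gamma_l}}-\frac{\|Q\|_1}{\|\gamma\|_1}\sqrt{\gamma_l}\Big)^2,\qquad \gamma_{\min}=\min_l\gamma_l .$$ \textbf{Theorem.} There are a function $N_\perp$ and a function $\epsilon_0$, both of $(n,T,\gamma,\mathcal F,\mu,A_{\max},S_{\max})$ only, such that $N_\perp\in\Theta(Tn^4)$, uniformly over parameters for which, for a common $M>0$, $1/M\le\gamma_l\le M$ for all $l$, $A_{\max},S_{\max}\le M$, and $\sum_{l\le m}\mu_{\eta(l)}-\big(\sum_{l}\mu_l\big)\sum_{l\le m}f_{l,\eta}\ge 1/M$ for all permutations $\eta$ and $1\le m<n$; and such that the following holds. Suppose that $$\sum_{l=1}^m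 f_{l,\eta}<\frac{\sum_{l=1}^m\mu_{\eta(l)}}{\sum_{l=1}^n\mu_{\eta(l)}}\qquad\text{for all } 1\le m<n \text{ and all permutations }\eta .$$ Then $\epsilon_0>0$ and, for every $0<\epsilon<\epsilon_0$ and all arrival and service laws as above, a steady state exists, and every steady state satisfies: at the sampling times, $E[\|O_\perp\|_2^2]\le N_\perp^2$; and $$\epsilon E\Big[\frac1n\sum_{l=1}^nQ_l\Big]\le\frac{n\sigma_\lambda^2+\sum_{l=1}^n\sigma_l^2}{2}+\epsilon^2\frac T2+\epsilon\,\frac{TnS_{\max}\gamma_{\min}+2Tn\|\gamma\|_1A_{\max}}{2\gamma_{\min}}+\sqrt\epsilon\,\frac{\|\gamma\|_1N_\perp\sqrt{nS_{\max}}}{\sqrt{\gamma_{\min}}} ,$$ where the expectation is finite. If moreover the services of different servers are uncorrelated, the same right-hand side bounds $\epsilon E[\sum_{l=1}^nQ_l]$. Both bounds hold under the stationary distribution of the chain and under its restriction to the sampling times. -/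

import Mathlib

open MeasureTheory ProbabilityTheory

noncomputable section

namespace LoadBalancing

/-- Data entering the constants: number of servers `n`, dispatching cycle `T`, scaling vector `γ`,
service rates `μ`, means `f` and variances `τsq` of the fractions of slots routed to each rank,
and the bounds on arrivals (per server) and on services. -/
structure Params where
  n : ℕ
  T : ℕ
  γ : Fin n → ℝ
  μ : Fin n → ℝ
  f : Equiv.Perm (Fin n) → Fin n → ℝ
  τsq : Equiv.Perm (Fin n) → Fin n → ℝ
  Amax : ℝ
  Smax : ℝ

/-- A dispatching policy with cycle length `T` and scaling vector `γ`. -/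
structure Policy (n T : ℕ) (γ : Fin n → ℝ) where
  /-- sorting function: scaled queue lengths and a uniform randomization variable are mapped to a
  permutation, `sort o v i` being the server of rank `i` -/
  sort : (Fin n → ℝ) → unitInterval → Equiv.Perm (Fin n)
  /-- the permutation lists the servers by decreasing scaled queue length -/
  sort_antitone : ∀ o : Fin n → ℝ, (∀ l, 0 ≤ o l) → ∀ v, Antitone fun i => o (sort o v i)
  measurableSet_sort : ∀ o η, MeasurableSet {v | sort o v = η}
  /-- decision function: permutation, service rates and a uniform randomization variable are
  mapped to the destinations of the jobs in the `T` slots of the cycle -/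
  decide : Equiv.Perm (Fin n) → (Fin n → ℝ) → unitInterval → Fin T → Fin n
  measurableSet_decide : ∀ η μ d, MeasurableSet {w | decide η μ w = d}

/-- State: queue lengths, destinations of the current cycle, position within the cycle. -/
abbrev State (n T : ℕ) : Type := (Fin n → ℕ) × (Fin T → Fin n) × Fin T

variable {n T : ℕ} {γ : Fin n → ℝ}

/-- Fraction of the slots of a cycle routed to the server of rank `l` when the permutation is `η`
and the randomization variable of the decision is `w`. -/
def Policy.routed (P : Policy n T γ) (μ : Fin n → ℝ) (η : Equiv.Perm (Fin n)) (l : Fin n)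
    (w : unitInterval) : ℝ :=
  ((Finset.univ.filter fun j : Fin T => P.decide η μ w j = η l).card : ℝ) / T

/-- `f_{l,η}`: mean fraction of the slots routed to rank `l` under the permutation `η`. -/
def Policy.frac (P : Policy n T γ) (μ : Fin n → ℝ) (η : Equiv.Perm (Fin n)) (l : Fin n) : ℝ :=
  ∫ w, P.routed μ η l w

/-- `τ²_{l,η}`: variance of the fraction of the slots routed to rank `l` under `η`. -/
def Policy.fracVar (P : Policy n T γ) (μ : Fin n → ℝ) (η : Equiv.Perm (Fin n)) (l : Fin n) : ℝ :=
  variance (P.routed μ η l) volume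

/-- Queue lengths after one slot: `a` jobs join queue `d`, then server `l` serves up to `s l` jobs
(the subtraction of natural numbers is the positive part). -/
def nextQueue (q : Fin n → ℕ) (d : Fin n) (a : ℕ) (s : Fin n → ℕ) : Fin n → ℕ :=
  fun l => q l + (if l = d then a else 0) - s l

/-- One slot of the chain, driven by the arrivals `a`, the potential services `s` and the uniform
variables `v`, `w`; the latter are used only when a new cycle begins. -/
def Policy.step (P : Policy n T γ) (μ : Fin n → ℝ) (x : State n T)
    (ξ : ℕ × (Fin n → ℕ) × unitInterval × unitInterval) : State n T :=
  let q := nextQueue x.1 (x.2.1 x.2.2) ξ.1 ξ.2.1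
  if h : (x.2.2 : ℕ) + 1 < T then (q, x.2.1, ⟨(x.2.2 : ℕ) + 1, h⟩)
  else (q, P.decide (P.sort (fun l => (q l : ℝ) / γ l) ξ.2.2.1) μ ξ.2.2.2,
    ⟨0, Nat.zero_lt_of_lt x.2.2.isLt⟩)

/-- Transition kernel: arrivals, services and the two uniform variables of a slot are
independent of each other and of the past. -/
def Policy.kernel (P : Policy n T γ) (μ : Fin n → ℝ) (a : Measure ℕ) (s : Measure (Fin n → ℕ)) :
    Kernel (State n T) (State n T) :=
  Kernel.ofFunOfCountable fun x =>
    (a.prod (s.prod ((volume : Measure unitInterval).prod (volume : Measure unitInterval)))).map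
      (P.step μ x)

/-- `π` is a steady-state (stationary) distribution of the chain. -/
def Policy.IsSteadyState (P : Policy n T γ) (μ : Fin n → ℝ) (a : Measure ℕ)
    (s : Measure (Fin n → ℕ)) (π : Measure (State n T)) : Prop :=
  IsProbabilityMeasure π ∧ (P.kernel μ a s).Invariant π

/-- Steady-state law at the sampling times, the beginnings of the cycles. -/
def sampled (π : Measure (State n T)) : Measure (State n T) :=
  ProbabilityTheory.cond π {x | (x.2.2 : ℕ) = 0}

/-- Law of the number of arrivals in a slot: mean `rate`, variance `n σ²`, bounded by `n Amax`. -/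
structure IsArrivalLaw (n : ℕ) (rate σ Amax : ℝ) (a : Measure ℕ) : Prop where
  isProbabilityMeasure : IsProbabilityMeasure a
  le_max : ∀ᵐ k : ℕ ∂a, (k : ℝ) ≤ n * Amax
  mean : ∫ k : ℕ, (k : ℝ) ∂a = rate
  var : variance (fun k : ℕ => (k : ℝ)) a = n * σ ^ 2

/-- Joint law of the potential services in a slot: `S_l` has mean `μ l` and variance `σ l ^ 2` and
is bounded by `Smax`. -/
structure IsServiceLaw (μ σ : Fin n → ℝ) (Smax : ℝ) (s : Measure (Fin n → ℕ)) : Prop where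
  isProbabilityMeasure : IsProbabilityMeasure s
  le_max : ∀ l, ∀ᵐ k ∂s, (k l : ℝ) ≤ Smax
  mean : ∀ l, ∫ k, (k l : ℝ) ∂s = μ l
  var : ∀ l, variance (fun k : Fin n → ℕ => (k l : ℝ)) s = σ l ^ 2

/-- The potential services of different servers are uncorrelated. -/
def UncorrelatedServices (s : Measure (Fin n → ℕ)) : Prop :=
  ∀ l l', l ≠ l' →
    covariance (fun k : Fin n → ℕ => (k l : ℝ)) (fun k : Fin n → ℕ => (k l' : ℝ)) s = 0

/-- `∑_{l=1}^m x_l`. -/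
def partialSum (x : Fin n → ℝ) (m : ℕ) : ℝ :=
  ∑ l ∈ Finset.univ.filter (fun l : Fin n => (l : ℕ) < m), x l

/-- The strict majorization condition. -/
def StrictMajorization (μ : Fin n → ℝ) (f : Equiv.Perm (Fin n) → Fin n → ℝ) : Prop :=
  ∀ η : Equiv.Perm (Fin n), ∀ m : ℕ, 1 ≤ m → m < n →
    partialSum (f η) m < partialSum (fun l => μ (η l)) m / ∑ l, μ (η l)

/-- `‖O_⊥‖₂²`, where `O_l = q_l / √γ_l` and `O_⊥` is its component orthogonal to `(√γ_l)_l`. -/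
def perpSq (γ : Fin n → ℝ) (q : Fin n → ℕ) : ℝ :=
  ∑ l, ((q l : ℝ) / √(γ l) - (∑ i, (q i : ℝ)) / (∑ i, γ i) * √(γ l)) ^ 2

/-- The explicit upper bound, with `N` the state space collapse constant. -/
def delayBound (T : ℕ) (γ : Fin n → ℝ) (Amax Smax σlam : ℝ) (σ : Fin n → ℝ) (N ε : ℝ) : ℝ :=
  (n * σlam ^ 2 + ∑ l, σ l ^ 2) / 2 + ε ^ 2 * (T / 2)
    + ε * ((T * n * Smax * (⨅ l, γ l) + 2 * T * n * (∑ l, γ l) * Amax) / (2 * ⨅ l, γ l))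
    + √ε * ((∑ l, γ l) * N * √(n * Smax) / √(⨅ l, γ l))

/-- The parameters are controlled by `M` uniformly in `n` and `T`: `1/M ≤ γ_l ≤ M`,
`Amax, Smax ≤ M`, and the gap in the majorization condition, multiplied by the total service rate,
is at least `1/M`. -/
def Params.ControlledBy (p : Params) (M : ℝ) : Prop :=
  (∀ l, 1 / M ≤ p.γ l ∧ p.γ l ≤ M) ∧ p.Amax ≤ M ∧ p.Smax ≤ M ∧
    ∀ η : Equiv.Perm (Fin p.n), ∀ m : ℕ, 1 ≤ m → m < p.n →
      1 / M ≤ partialSum (fun l => p.μ (η l)) m - (∑ l, p.μ l) * partialSum (p.f η) m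

/-- `N ∈ Θ(T n⁴)`, uniformly over parameters controlled by a common constant. -/
def IsThetaTn4 (N : Params → ℝ) : Prop :=
  ∀ M : ℝ, 0 < M → ∃ c C : ℝ, 0 < c ∧ ∀ p : Params, 1 ≤ p.n → 1 ≤ p.T → p.ControlledBy M →
    c * (p.T * p.n ^ 4) ≤ N p ∧ N p ≤ C * (p.T * p.n ^ 4)

end LoadBalancing

end

/-! The proof is a Foster–Lyapunov argument. `integral_le_of_drift` turns a one-step drift
inequality into an inequality of stationary means with no moment of the stationary law known
beforehand, so it also yields integrability.

The policy decides once per cycle, and inside a cycle the queues may drift the wrong way. The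
quadratic Lyapunov functions are therefore evaluated at `pred`, the queue vector expected at the end
of the cycle if no service were wasted. Inside a cycle `pred` moves only by centred noise and unused
services. At the end of a cycle it also receives the shift chosen by the new decision; summation by
parts over the sorted servers (`sum_mul_le_of_partialSum_le`) and the majorization gap control the
mean of this shift. Unused services do little harm, because they occur only where the queue is
already short (`bil_unused_le`).

Two quadratic forms are treated together. The form with `θ = 0`, the weighted norm, decreases at
cycle ends at a rate proportional to `ε`. This gives a stationary law and a finite mean queue length
(`total_drift`, `exists_steadyState`, `integrable_total`). The form `H` with `θ = 1`, which is
`‖O_⊥‖²`, decreases at a rate of order `T/n` times `√H`, uniformly in `ε`. The drift of `H` would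
control only the mean of `√H`, so the drift of `H ^ 2` is used, and it controls the mean of `H`:
this is state space collapse (`integral_weight_quad`). The bound obtained is of order `T ^ 2 * n ^
6` for fixed `M`; the constant `N` of order `T * n ^ 4` leaves room.

The delay bound comes from the drift of the squared total queue length. Stationarity of the total
makes the mean unused service equal to `ε`. The cross term between the total after the slot and the
unused service is the delicate one: a server that wastes service ends the slot with an empty queue,
so its coordinate of `O_⊥` is proportional to the total. The cross term is thus bounded by the
unused service and `‖O_⊥‖²` (`unused_mul_total_le`), and an optimized weight in the
arithmetic–geometric inequality makes it of order `√ε`. The sampling times cost at most `(T - 1) *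
ε` more in the mean total.

All constants are expressed through one number `M` controlling the parameters. `Params.bound`
chooses it from the parameters alone, almost optimally, which makes `N` uniformly of order `T * n ^
4`. -/

namespace LoadBalancing

open scoped ENNReal Topology
open Filter

/-! ### Drift inequalities under an invariant law -/

section Markov

variable {S : Type*} [MeasurableSpace S]

/-- Drift comparison: a nonnegative finite function with drift at most `g - f` forces
`∫ f ≤ ∫ g` under every invariant law, without integrability assumptions. -/
theorem lintegral_le_of_drift {κ : Kernel S S} [IsMarkovKernel κ] {π : Measure S}
    [IsFiniteMeasure π] (hπ : κ.Invariant π) {V f g : S → ℝ≥0∞} (hV : Measurable V)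
    (hf : Measurable f) (hg : Measurable g) (hVtop : ∀ x, V x ≠ ∞)
    (h : ∀ x, ∫⁻ y, V y ∂κ x + f x ≤ V x + g x) : ∫⁻ x, f x ∂π ≤ ∫⁻ x, g x ∂π := by
  -- The truncation `min V m` inherits the drift inequality with `f` restricted to `{V ≤ m}`. Its
  -- integral is finite and invariant, so it cancels from both sides; monotone convergence in `m`
  -- then restores `f`.
  have key : ∀ m : ℕ, ∫⁻ x, {x | V x ≤ m}.indicator f x ∂π ≤ ∫⁻ x, g x ∂π := by
    intro m
    have hmeas : MeasurableSet {x | V x ≤ m} := hV measurableSet_Iic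
    have hW : Measurable fun x => min (V x) (m : ℝ≥0∞) := hV.min measurable_const
    have hpt : ∀ x, ∫⁻ y, min (V y) m ∂κ x + {x | V x ≤ m}.indicator f x
        ≤ min (V x) m + g x := by
      intro x
      by_cases hx : V x ≤ m
      · rw [Set.indicator_of_mem (show x ∈ {x | V x ≤ m} from hx), min_eq_left hx]
        exact (add_le_add_left (lintegral_mono fun y => min_le_left _ _) _).trans (h x)
      · rw [Set.indicator_of_notMem (show x ∉ {x | V x ≤ m} from hx), add_zero,
          min_eq_right (not_le.mp hx).le]
        calc ∫⁻ y, min (V y) m ∂κ x ≤ ∫⁻ _, (m : ℝ≥0∞) ∂κ x :=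
              lintegral_mono fun y => min_le_right _ _
          _ = m := by simp
          _ ≤ m + g x := le_self_add
    have hint := lintegral_mono (μ := π) hpt
    rw [lintegral_add_right _ (hf.indicator hmeas), lintegral_add_right _ hg,
      ← Measure.lintegral_bind κ.measurable.aemeasurable hW.aemeasurable, hπ.def] at hint
    have hfin : ∫⁻ x, min (V x) m ∂π ≠ ∞ := by
      refine ne_top_of_le_ne_top ?_ (lintegral_mono fun x => min_le_right (V x) (m : ℝ≥0∞))
      simpa using ENNReal.mul_ne_top (ENNReal.natCast_ne_top m) (measure_ne_top π _)
    exact (ENNReal.add_le_add_iff_left hfin).mp hint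
  have hsup : ∀ x, f x = ⨆ m : ℕ, {x | V x ≤ m}.indicator f x := by
    intro x
    apply le_antisymm
    · obtain ⟨m, hm⟩ := ENNReal.exists_nat_gt (hVtop x)
      refine le_trans ?_ (le_iSup _ m)
      rw [Set.indicator_of_mem (show x ∈ {x | V x ≤ m} from hm.le)]
    · exact iSup_le fun m => Set.indicator_le_self _ _ _
  rw [lintegral_congr hsup, lintegral_iSup]
  · exact iSup_le key
  · exact fun m => hf.indicator (hV measurableSet_Iic)
  · intro m m' hm x
    refine Set.indicator_le_indicator_of_subset ?_ (fun _ => zero_le) x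
    intro y hy
    exact le_trans (show V y ≤ m from hy) (by exact_mod_cast hm)

/-- Real-valued form of the drift comparison on a discrete space. -/
theorem integral_le_of_drift [DiscreteMeasurableSpace S] {κ : Kernel S S} [IsMarkovKernel κ]
    {π : Measure S} [IsFiniteMeasure π] (hπ : κ.Invariant π) {V f g : S → ℝ} (hV : ∀ x, 0 ≤ V x)
    (hf : ∀ x, 0 ≤ f x) (hg : ∀ x, 0 ≤ g x) (hVi : ∀ x, Integrable V (κ x))
    (hgi : Integrable g π) (h : ∀ x, ∫ y, V y ∂κ x + f x ≤ V x + g x) :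
    Integrable f π ∧ ∫ x, f x ∂π ≤ ∫ x, g x ∂π := by
  have hm : ∀ u : S → ℝ, Measurable u := fun u => Measurable.of_discrete
  have key : ∫⁻ x, ENNReal.ofReal (f x) ∂π ≤ ∫⁻ x, ENNReal.ofReal (g x) ∂π := by
    refine lintegral_le_of_drift hπ (V := fun x => ENNReal.ofReal (V x)) (by fun_prop)
      (by fun_prop) (by fun_prop) (fun x => ENNReal.ofReal_ne_top) fun x => ?_
    rw [← ofReal_integral_eq_lintegral_ofReal (hVi x) (ae_of_all _ hV),
      ← ENNReal.ofReal_add (integral_nonneg hV) (hf x), ← ENNReal.ofReal_add (hV x) (hg x)]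
    exact ENNReal.ofReal_le_ofReal (h x)
  rw [← ofReal_integral_eq_lintegral_ofReal hgi (ae_of_all _ hg)] at key
  have hfi : Integrable f π :=
    ⟨(hm f).aestronglyMeasurable, (hasFiniteIntegral_iff_ofReal (ae_of_all _ hf)).mpr
      (key.trans_lt ENNReal.ofReal_lt_top)⟩
  refine ⟨hfi, ?_⟩
  rw [← ofReal_integral_eq_lintegral_ofReal hfi (ae_of_all _ hf)] at key
  exact (ENNReal.ofReal_le_ofReal_iff (integral_nonneg hg)).mp key

theorem integral_invariant [DiscreteMeasurableSpace S] {κ : Kernel S S}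
    {π : Measure S} [IsFiniteMeasure π] [IsMarkovKernel κ] (hπ : κ.Invariant π) {F : S → ℝ}
    (hF : Integrable F π) :
    Integrable (fun x => ∫ y, F y ∂κ x) π ∧ ∫ x, ∫ y, F y ∂κ x ∂π = ∫ x, F x ∂π := by
  have e : κ ∘ₖ Kernel.const Unit π = Kernel.const Unit π := by
    rw [Kernel.comp_const, hπ.def]
  have hF' : Integrable F ((κ ∘ₖ Kernel.const Unit π) ()) := by
    rw [e]; simpa using hF
  have h1 := hF'.integral_comp
  have h2 := Kernel.integral_comp hF'
  rw [e] at h2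
  simp only [Kernel.const_apply] at h1 h2
  exact ⟨h1, h2.symm⟩

end Markov

/-! ### Existence of an invariant law -/

section Existence

variable {S : Type*} [MeasurableSpace S] [DiscreteMeasurableSpace S]

/-- Law of a Markov chain at time `k`. -/
noncomputable def chainLaw (κ : Kernel S S) (x : S) : ℕ → Measure S
  | 0 => Measure.dirac x
  | k + 1 => (chainLaw κ x k).bind κ

instance chainLaw_isProbabilityMeasure (κ : Kernel S S) [IsMarkovKernel κ] (x : S) (k : ℕ) :
    IsProbabilityMeasure (chainLaw κ x k) := by
  induction k with
  | zero => exact Measure.dirac.isProbabilityMeasure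
  | succ k ih =>
    have := ih
    show IsProbabilityMeasure ((chainLaw κ x k).bind κ)
    infer_instance

/-- The drift inequality telescopes along the trajectory. -/
theorem chainLaw_drift (κ : Kernel S S) [IsMarkovKernel κ] (x : S) {V f : S → ℝ≥0∞} {c : ℝ≥0∞}
    (h : ∀ x, ∫⁻ y, V y ∂κ x + f x ≤ V x + c) (N : ℕ) :
    ∫⁻ y, V y ∂chainLaw κ x N + ∑ k ∈ Finset.range N, ∫⁻ y, f y ∂chainLaw κ x k
      ≤ V x + N * c := by
  have hm : ∀ u : S → ℝ≥0∞, Measurable u := fun u => Measurable.of_discrete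
  induction N with
  | zero => simp [chainLaw]
  | succ N ih =>
    have h1 : ∫⁻ y, V y ∂chainLaw κ x (N + 1) + ∫⁻ y, f y ∂chainLaw κ x N
        ≤ ∫⁻ y, V y ∂chainLaw κ x N + c := by
      rw [chainLaw, Measure.lintegral_bind κ.measurable.aemeasurable (hm V).aemeasurable,
        ← lintegral_add_right _ (hm f)]
      calc _ ≤ ∫⁻ y, (V y + c) ∂chainLaw κ x N := lintegral_mono h
        _ = _ := by rw [lintegral_add_right _ measurable_const]; simp
    rw [Finset.sum_range_succ]
    calc _ = ∑ k ∈ Finset.range N, ∫⁻ y, f y ∂chainLaw κ x k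
          + (∫⁻ y, V y ∂chainLaw κ x (N + 1) + ∫⁻ y, f y ∂chainLaw κ x N) := by ring
      _ ≤ ∑ k ∈ Finset.range N, ∫⁻ y, f y ∂chainLaw κ x k
          + (∫⁻ y, V y ∂chainLaw κ x N + c) := by gcongr
      _ = (∫⁻ y, V y ∂chainLaw κ x N + ∑ k ∈ Finset.range N, ∫⁻ y, f y ∂chainLaw κ x k) + c := by
          ring
      _ ≤ V x + N * c + c := by gcongr
      _ = _ := by push_cast; ring

/-- Average of the laws of a Markov chain over the first `N + 1` times. -/
noncomputable def cesaro (κ : Kernel S S) (x : S) (N : ℕ) : Measure S :=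
  ((N + 1 : ℕ) : ℝ≥0∞)⁻¹ • ∑ k ∈ Finset.range (N + 1), chainLaw κ x k

instance cesaro_isProbabilityMeasure (κ : Kernel S S) [IsMarkovKernel κ] (x : S) (N : ℕ) :
    IsProbabilityMeasure (cesaro κ x N) := by
  constructor
  simp only [cesaro, Measure.smul_apply, Measure.finsetSum_apply, measure_univ, smul_eq_mul,
    Finset.sum_const, Finset.card_range, nsmul_eq_mul, mul_one]
  exact ENNReal.inv_mul_cancel (by simp) (ENNReal.natCast_ne_top _)

/-- One step of the chain shifts the averaging window by one, which adds at most one law of mass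
`1`. The averages are therefore asymptotically invariant. -/
theorem cesaro_bind_le (κ : Kernel S S) [IsMarkovKernel κ] (x : S) (N : ℕ) (A : Set S) :
    (cesaro κ x N).bind κ A ≤ cesaro κ x N A + ((N + 1 : ℕ) : ℝ≥0∞)⁻¹ := by
  have hA : MeasurableSet A := .of_discrete
  have e : (cesaro κ x N).bind κ A
      = ((N + 1 : ℕ) : ℝ≥0∞)⁻¹ * ∑ k ∈ Finset.range (N + 1), chainLaw κ x (k + 1) A := by
    rw [Measure.bind_apply hA κ.measurable.aemeasurable, cesaro, lintegral_smul_measure,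
      lintegral_finsetSum_measure, smul_eq_mul]
    congr 1
    refine Finset.sum_congr rfl fun k _ => ?_
    rw [chainLaw, Measure.bind_apply hA κ.measurable.aemeasurable]
  rw [e, cesaro]
  simp only [Measure.smul_apply, Measure.finsetSum_apply, smul_eq_mul]
  have hs : ∑ k ∈ Finset.range (N + 1), chainLaw κ x (k + 1) A
      ≤ ∑ k ∈ Finset.range (N + 1), chainLaw κ x k A + 1 := by
    calc ∑ k ∈ Finset.range (N + 1), chainLaw κ x (k + 1) A
        ≤ ∑ k ∈ Finset.range (N + 1), chainLaw κ x (k + 1) A + chainLaw κ x 0 A := le_self_add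
      _ = ∑ k ∈ Finset.range (N + 1), chainLaw κ x k A + chainLaw κ x (N + 1) A := by
          rw [← Finset.sum_range_succ' (fun k => chainLaw κ x k A), Finset.sum_range_succ]
      _ ≤ _ := by gcongr; exact prob_le_one
  calc _ ≤ ((N + 1 : ℕ) : ℝ≥0∞)⁻¹ * (∑ k ∈ Finset.range (N + 1), chainLaw κ x k A + 1) := by
        gcongr
    _ = _ := by rw [mul_add, mul_one]

theorem lintegral_cesaro_le (κ : Kernel S S) [IsMarkovKernel κ] (x : S) {V f : S → ℝ≥0∞}
    {c : ℝ≥0∞} (h : ∀ x, ∫⁻ y, V y ∂κ x + f x ≤ V x + c) (N : ℕ) :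
    ∫⁻ y, f y ∂cesaro κ x N ≤ V x + c := by
  rw [cesaro, lintegral_smul_measure, lintegral_finsetSum_measure, smul_eq_mul]
  have h1 := le_trans le_add_self (chainLaw_drift κ x h (N + 1))
  have hN : ((N + 1 : ℕ) : ℝ≥0∞) ≠ 0 := by simp
  have hN' : ((N + 1 : ℕ) : ℝ≥0∞) ≠ ∞ := ENNReal.natCast_ne_top _
  calc _ ≤ ((N + 1 : ℕ) : ℝ≥0∞)⁻¹ * (V x + (N + 1 : ℕ) * c) := by gcongr
    _ ≤ ((N + 1 : ℕ) : ℝ≥0∞)⁻¹ * ((N + 1 : ℕ) * V x + (N + 1 : ℕ) * c) := by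
        gcongr
        exact le_mul_of_one_le_left (zero_le) (by exact_mod_cast Nat.succ_pos N)
    _ = V x + c := by
        rw [← mul_add, ← mul_assoc, ENNReal.inv_mul_cancel hN hN', one_mul]

/-- Existence of an invariant law under a drift condition with finite sublevel sets. -/
theorem exists_invariant_of_drift [Countable S] [Nonempty S] (κ : Kernel S S) [IsMarkovKernel κ]
    {V f : S → ℝ≥0∞} {c : ℝ≥0∞} (hc : c ≠ ∞) (hVtop : ∀ x, V x ≠ ∞)
    (h : ∀ x, ∫⁻ y, V y ∂κ x + f x ≤ V x + c)
    (hfin : ∀ r : ℕ, {x | f x < r}.Finite) :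
    ∃ π : Measure S, IsProbabilityMeasure π ∧ κ.Invariant π := by
  obtain ⟨x₀⟩ := ‹Nonempty S›
  set ν := cesaro κ x₀ with hν
  let 𝒰 : Ultrafilter ℕ := hyperfilter ℕ
  have h𝒰 : (𝒰 : Filter ℕ) ≤ atTop := Nat.hyperfilter_le_atTop
  -- Limits along an ultrafilter exist at every point at once, by compactness of `[0, ∞]`, so no
  -- diagonal extraction is needed.
  have hlim : ∀ y, ∃ p : ℝ≥0∞, Tendsto (fun N => ν N {y}) 𝒰 (𝓝 p) := fun y =>
    ⟨(𝒰.map fun N => ν N {y}).lim, Ultrafilter.le_nhds_lim _⟩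
  choose p hp using hlim
  let π : Measure S := Measure.sum fun y => p y • Measure.dirac y
  have hπs : ∀ y, π {y} = p y := by
    intro y
    simp only [π, Measure.sum_apply _ (MeasurableSet.singleton y), Measure.smul_apply,
      smul_eq_mul, Measure.dirac_apply' _ (MeasurableSet.singleton y)]
    rw [tsum_eq_single y (fun z hz => by simp [hz])]
    simp
  have hfinset : ∀ F : Finset S, Tendsto (fun N => ν N F) 𝒰 (𝓝 (π F)) := by
    intro F
    have e : ∀ m : Measure S, m F = ∑ y ∈ F, m {y} := fun m => (sum_measure_singleton).symm
    simp_rw [e, hπs]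
    exact tendsto_finsetSum _ fun y _ => hp y
  have hle : π Set.univ ≤ 1 := by
    rw [← lintegral_one, lintegral_countable', ENNReal.tsum_eq_iSup_sum]
    refine iSup_le fun F => ?_
    simp only [one_mul]
    rw [sum_measure_singleton]
    exact le_of_tendsto' (hfinset F) fun N => prob_le_one
  -- No mass escapes: by Markov's inequality the averages put mass at most `(V x₀ + c) / r` outside
  -- the finite set `{f < r}`, uniformly in `N`.
  have hge : 1 ≤ π Set.univ := by
    have hC : V x₀ + c ≠ ∞ := ENNReal.add_ne_top.mpr ⟨hVtop x₀, hc⟩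
    have key : ∀ r : ℕ, 0 < r → 1 ≤ π Set.univ + (V x₀ + c) / r := by
      intro r hr
      have hr0 : (r : ℝ≥0∞) ≠ 0 := by exact_mod_cast hr.ne'
      let F := (hfin r).toFinset
      have hF : ∀ N, 1 ≤ ν N F + (V x₀ + c) / r := by
        intro N
        have hm : ν N {y | (r : ℝ≥0∞) ≤ f y} ≤ (V x₀ + c) / r :=
          (meas_ge_le_lintegral_div Measurable.of_discrete.aemeasurable hr0
            (ENNReal.natCast_ne_top r)).trans
            (ENNReal.div_le_div_right (lintegral_cesaro_le κ x₀ h N) _)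
        calc (1 : ℝ≥0∞) = ν N Set.univ := measure_univ.symm
          _ ≤ ν N (F ∪ {y | (r : ℝ≥0∞) ≤ f y}) := by
              refine measure_mono fun y _ => ?_
              by_cases hy : f y < r
              · left; simpa [F] using hy
              · right; exact not_lt.mp hy
          _ ≤ _ := (measure_union_le _ _).trans (by gcongr)
      have := ge_of_tendsto' ((hfinset F).add (tendsto_const_nhds (x := (V x₀ + c) / r))) hF
      exact this.trans (by gcongr; exact Set.subset_univ _)
    have ht : Tendsto (fun r : ℕ => π Set.univ + (V x₀ + c) / r) atTop
        (𝓝 (π Set.univ + 0)) :=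
      tendsto_const_nhds.add (ENNReal.Tendsto.const_div
        ENNReal.tendsto_nat_nhds_top (Or.inr hC) |>.trans (by simp))
    rw [add_zero] at ht
    exact ge_of_tendsto ht (eventually_atTop.mpr ⟨1, fun r hr => key r hr⟩)
  have hprob : IsProbabilityMeasure π := ⟨le_antisymm hle hge⟩
  refine ⟨π, hprob, ?_⟩
  -- Both sides are probability measures, so sub-invariance suffices. It survives the limit because
  -- only finite partial sums of the transition probabilities have to converge.
  refine Measure.eq_of_le_of_isProbabilityMeasure ?_
  have hs : ∀ y, π.bind κ {y} ≤ π {y} := by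
    intro y
    rw [Measure.bind_apply (.singleton y) κ.measurable.aemeasurable, lintegral_countable',
      ENNReal.tsum_eq_iSup_sum]
    refine iSup_le fun F => ?_
    have h1 : Tendsto (fun N => ∑ x ∈ F, κ x {y} * ν N {x}) 𝒰
        (𝓝 (∑ x ∈ F, κ x {y} * π {x})) := by
      refine tendsto_finsetSum _ fun x _ => ?_
      rw [hπs]
      exact ENNReal.Tendsto.const_mul (hp x) (Or.inr (measure_ne_top _ _))
    have h2 : Tendsto (fun N : ℕ => ν N {y} + ((N + 1 : ℕ) : ℝ≥0∞)⁻¹) 𝒰 (𝓝 (π {y} + 0)) := by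
      rw [hπs]
      refine (hp y).add (Tendsto.mono_left ?_ h𝒰)
      exact (ENNReal.tendsto_inv_nat_nhds_zero).comp (tendsto_add_atTop_nat 1)
    rw [add_zero] at h2
    refine le_of_tendsto_of_tendsto' h1 h2 fun N => ?_
    refine le_trans ?_ (cesaro_bind_le κ x₀ N {y})
    rw [Measure.bind_apply (.singleton y) κ.measurable.aemeasurable, lintegral_countable']
    exact ENNReal.sum_le_tsum F
  rw [Measure.le_iff]
  intro A hA
  rw [← lintegral_indicator_one hA, ← lintegral_indicator_one hA, lintegral_countable',
    lintegral_countable']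
  exact ENNReal.tsum_le_tsum fun y => mul_le_mul_right (hs y) _

end Existence

/-! ### Quadratic forms in the scaled queue lengths, and summation by parts -/

section Quadratic

variable {n : ℕ}

/-- Scaled queue lengths, recentred by the fraction `θ` of their weighted average. -/
noncomputable def tilt (θ : ℝ) (γ y : Fin n → ℝ) (l : Fin n) : ℝ :=
  y l / γ l - θ * ((∑ i, y i) / ∑ i, γ i)

/-- Interpolation between the weighted inner product (`θ = 0`) and its restriction to the
component orthogonal to the balanced direction (`θ = 1`). -/
noncomputable def bil (θ : ℝ) (γ y v : Fin n → ℝ) : ℝ := ∑ l, tilt θ γ y l * v l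

noncomputable def quad (θ : ℝ) (γ y : Fin n → ℝ) : ℝ := bil θ γ y y

/-- Total absolute recentred scaled queue length. -/
noncomputable def dev (θ : ℝ) (γ y : Fin n → ℝ) : ℝ := ∑ l, |tilt θ γ y l|

noncomputable def l1 (v : Fin n → ℝ) : ℝ := ∑ l, |v l|

variable {θ M : ℝ} {γ : Fin n → ℝ}

theorem tilt_add (y v : Fin n → ℝ) (l : Fin n) :
    tilt θ γ (y + v) l = tilt θ γ y l + tilt θ γ v l := by
  simp only [tilt, Pi.add_apply, Finset.sum_add_distrib]; ring

theorem bil_add_left (y v w : Fin n → ℝ) : bil θ γ (y + v) w = bil θ γ y w + bil θ γ v w := by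
  simp only [bil, tilt_add, add_mul, Finset.sum_add_distrib]

theorem bil_add_right (y v w : Fin n → ℝ) : bil θ γ y (v + w) = bil θ γ y v + bil θ γ y w := by
  simp only [bil, Pi.add_apply, mul_add, Finset.sum_add_distrib]

theorem bil_eq (y v : Fin n → ℝ) :
    bil θ γ y v = ∑ l, y l * v l / γ l - θ * ((∑ i, y i) * (∑ i, v i) / ∑ i, γ i) := by
  simp only [bil, tilt, sub_mul, Finset.sum_sub_distrib]
  rw [← Finset.mul_sum]
  congr 1
  · exact Finset.sum_congr rfl fun l _ => by ring
  · ring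

theorem bil_comm (y v : Fin n → ℝ) : bil θ γ y v = bil θ γ v y := by
  rw [bil_eq, bil_eq]
  congr 1
  · exact Finset.sum_congr rfl fun l _ => by ring
  · ring

theorem quad_add (y v : Fin n → ℝ) :
    quad θ γ (y + v) = quad θ γ y + 2 * bil θ γ y v + quad θ γ v := by
  simp only [quad, bil_add_left, bil_add_right]
  rw [bil_comm v y]; ring

theorem l1_nonneg (v : Fin n → ℝ) : 0 ≤ l1 v := Finset.sum_nonneg fun _ _ => abs_nonneg _

theorem l1_add_le (v w : Fin n → ℝ) : l1 (v + w) ≤ l1 v + l1 w := by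
  rw [l1, l1, l1, ← Finset.sum_add_distrib]
  exact Finset.sum_le_sum fun l _ => abs_add_le _ _

theorem abs_le_l1 (v : Fin n → ℝ) (l : Fin n) : |v l| ≤ l1 v :=
  Finset.single_le_sum (f := fun l => |v l|) (fun _ _ => abs_nonneg _) (Finset.mem_univ l)

theorem sum_sq_le_l1_sq (v : Fin n → ℝ) : ∑ l, v l ^ 2 ≤ l1 v ^ 2 := by
  have := Finset.sum_sq_le_sq_sum_of_nonneg (s := Finset.univ) (f := fun l => |v l|)
    (fun i _ => abs_nonneg _)
  simpa [l1] using this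

theorem dev_nonneg (y : Fin n → ℝ) : 0 ≤ dev θ γ y := Finset.sum_nonneg fun _ _ => abs_nonneg _

theorem dev_add_le (y v : Fin n → ℝ) : dev θ γ (y + v) ≤ dev θ γ y + dev θ γ v := by
  rw [dev, dev, dev, ← Finset.sum_add_distrib]
  exact Finset.sum_le_sum fun l _ => by rw [tilt_add]; exact abs_add_le _ _

/-- The weights lie in `[1/M, M]`. -/
structure WeightBounds (γ : Fin n → ℝ) (M : ℝ) : Prop where
  pos : 0 < n
  one_le : 1 ≤ M
  lower : ∀ l, 1 / M ≤ γ l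
  upper : ∀ l, γ l ≤ M

namespace WeightBounds

variable (h : WeightBounds γ M)
include h

theorem M_pos : 0 < M := by linarith [h.one_le]

theorem γ_pos (l : Fin n) : 0 < γ l := lt_of_lt_of_le (by have := h.M_pos; positivity) (h.lower l)

theorem inv_γ_le (l : Fin n) : (γ l)⁻¹ ≤ M := by
  have := h.lower l
  rw [inv_le_comm₀ (h.γ_pos l) h.M_pos]; simpa using this

theorem γ_le_sum (l : Fin n) : γ l ≤ ∑ i, γ i :=
  Finset.single_le_sum (f := γ) (fun i _ => (h.γ_pos i).le) (Finset.mem_univ l)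

theorem sum_γ_pos : 0 < ∑ i, γ i := (h.γ_pos ⟨0, h.pos⟩).trans_le (h.γ_le_sum _)

theorem inv_sum_γ_le : (∑ i, γ i)⁻¹ ≤ M :=
  (inv_anti₀ (h.γ_pos ⟨0, h.pos⟩) (h.γ_le_sum _)).trans (h.inv_γ_le _)

theorem one_le_n : (1 : ℝ) ≤ n := by exact_mod_cast h.pos

theorem abs_tilt_le (hθ0 : 0 ≤ θ) (hθ1 : θ ≤ 1) (y : Fin n → ℝ) (l : Fin n) :
    |tilt θ γ y l| ≤ 2 * M * l1 y := by
  have h1 : |y l / γ l| ≤ M * l1 y := by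
    rw [abs_div, abs_of_pos (h.γ_pos l), div_eq_mul_inv, mul_comm]
    exact mul_le_mul (h.inv_γ_le l) (abs_le_l1 y l) (abs_nonneg _) h.M_pos.le
  have h2 : |θ * ((∑ i, y i) / ∑ i, γ i)| ≤ M * l1 y := by
    rw [abs_mul, abs_div, abs_of_pos h.sum_γ_pos, abs_of_nonneg hθ0, div_eq_mul_inv,
      mul_comm |_|]
    have h3 : (∑ i, γ i)⁻¹ * |∑ i, y i| ≤ M * l1 y :=
      mul_le_mul h.inv_sum_γ_le (Finset.abs_sum_le_sum_abs _ _) (abs_nonneg _) h.M_pos.le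
    refine (mul_le_of_le_one_left ?_ hθ1).trans h3
    exact mul_nonneg (inv_nonneg.mpr h.sum_γ_pos.le) (abs_nonneg _)
  calc |tilt θ γ y l| ≤ |y l / γ l| + |θ * ((∑ i, y i) / ∑ i, γ i)| := abs_sub _ _
    _ ≤ _ := by linarith

theorem sum_sq_div_le (v : Fin n → ℝ) : ∑ l, v l ^ 2 / γ l ≤ M * l1 v ^ 2 := by
  calc ∑ l, v l ^ 2 / γ l ≤ ∑ l, M * v l ^ 2 := Finset.sum_le_sum fun l _ => by
        rw [div_eq_mul_inv, mul_comm]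
        exact mul_le_mul_of_nonneg_right (h.inv_γ_le l) (sq_nonneg _)
    _ ≤ _ := by
        rw [← Finset.mul_sum]
        exact mul_le_mul_of_nonneg_left (sum_sq_le_l1_sq v) h.M_pos.le

theorem quad_le (hθ0 : 0 ≤ θ) (v : Fin n → ℝ) : quad θ γ v ≤ M * l1 v ^ 2 := by
  have h2 : 0 ≤ θ * ((∑ i, v i) * (∑ i, v i) / ∑ i, γ i) :=
    mul_nonneg hθ0 (div_nonneg (mul_self_nonneg _) h.sum_γ_pos.le)
  have h1 := h.sum_sq_div_le v
  rw [quad, bil_eq]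
  simp only [← sq] at *
  linarith

theorem dev_le (hθ0 : 0 ≤ θ) (hθ1 : θ ≤ 1) (y : Fin n → ℝ) :
    dev θ γ y ≤ 2 * M * n * l1 y := by
  calc dev θ γ y ≤ ∑ _l : Fin n, 2 * M * l1 y :=
        Finset.sum_le_sum fun l _ => h.abs_tilt_le hθ0 hθ1 y l
    _ = _ := by simp; ring

/-- For `θ = 1` the recentred lengths have `γ`-weighted mean zero, so the second factor `y l` may be
replaced by `γ l * tilt 1 γ y l`. The form is thereby a sum of squares. -/
theorem quad_one_eq (y : Fin n → ℝ) : quad 1 γ y = ∑ l, γ l * tilt 1 γ y l ^ 2 := by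
  have hs : (∑ i, γ i) ≠ 0 := h.sum_γ_pos.ne'
  set m := (∑ i, y i) / ∑ i, γ i with hm
  have hz : ∑ l, γ l * (y l / γ l - m) = 0 := by
    simp only [mul_sub, Finset.sum_sub_distrib, ← Finset.sum_mul]
    rw [Finset.sum_congr rfl fun l _ => mul_div_cancel₀ (y l) (h.γ_pos l).ne', hm]
    field_simp
    ring
  have e : ∀ l, tilt 1 γ y l = y l / γ l - m := fun l => by simp [tilt, hm]
  simp only [quad, bil, e]
  have : ∑ l, (y l / γ l - m) * y l - ∑ l, γ l * (y l / γ l - m) ^ 2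
      = m * ∑ l, γ l * (y l / γ l - m) := by
    rw [Finset.mul_sum, ← Finset.sum_sub_distrib]
    refine Finset.sum_congr rfl fun l _ => ?_
    have := (h.γ_pos l).ne'
    field_simp
    ring
  rw [hz, mul_zero] at this
  linarith

theorem quad_one_nonneg (y : Fin n → ℝ) : 0 ≤ quad 1 γ y := by
  rw [h.quad_one_eq]
  exact Finset.sum_nonneg fun l _ => mul_nonneg (h.γ_pos l).le (sq_nonneg _)

/-- Passing from `θ = 1` to `θ` adds `1 - θ` times the square of the total divided by the total
weight. -/
theorem quad_nonneg (hθ1 : θ ≤ 1) (y : Fin n → ℝ) : 0 ≤ quad θ γ y := by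
  have h1 := h.quad_one_nonneg y
  have h2 : 0 ≤ (1 - θ) * ((∑ i, y i) * (∑ i, y i) / ∑ i, γ i) :=
    mul_nonneg (by linarith) (div_nonneg (mul_self_nonneg _) h.sum_γ_pos.le)
  rw [quad, bil_eq] at *
  linarith

theorem quad_one_le_dev (y : Fin n → ℝ) : quad 1 γ y ≤ M * dev 1 γ y ^ 2 := by
  rw [h.quad_one_eq]
  calc ∑ l, γ l * tilt 1 γ y l ^ 2 ≤ ∑ l, M * tilt 1 γ y l ^ 2 :=
        Finset.sum_le_sum fun l _ => mul_le_mul_of_nonneg_right (h.upper l) (sq_nonneg _)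
    _ = M * ∑ l, tilt 1 γ y l ^ 2 := by rw [Finset.mul_sum]
    _ ≤ _ := mul_le_mul_of_nonneg_left (sum_sq_le_l1_sq (tilt 1 γ y)) h.M_pos.le

/-- Cauchy–Schwarz, after distributing a factor `√(γ l)` between the two vectors. -/
theorem bil_one_sq_le (y v : Fin n → ℝ) :
    bil 1 γ y v ^ 2 ≤ M * quad 1 γ y * l1 v ^ 2 := by
  have e : bil 1 γ y v = ∑ l, (√(γ l) * tilt 1 γ y l) * (v l / √(γ l)) := by
    refine Finset.sum_congr rfl fun l _ => ?_
    have := (Real.sqrt_pos.mpr (h.γ_pos l)).ne'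
    field_simp
  rw [e]
  refine (Finset.sum_mul_sq_le_sq_mul_sq _ _ _).trans ?_
  simp only [mul_pow, div_pow, Real.sq_sqrt (h.γ_pos _).le]
  rw [← h.quad_one_eq]
  calc quad 1 γ y * ∑ l, v l ^ 2 / γ l ≤ quad 1 γ y * (M * l1 v ^ 2) :=
        mul_le_mul_of_nonneg_left (h.sum_sq_div_le v) (h.quad_one_nonneg y)
    _ = _ := by ring

/-- Parallelogram law: the form is nonnegative at `y - v`. -/
theorem quad_one_add_le (y v : Fin n → ℝ) :
    quad 1 γ (y + v) ≤ 2 * quad 1 γ y + 2 * quad 1 γ v := by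
  have h1 := h.quad_one_nonneg (y + (-1 : ℝ) • v)
  have e : bil 1 γ y ((-1 : ℝ) • v) = - bil 1 γ y v := by
    simp [bil, Finset.sum_neg_distrib]
  have e2 : quad 1 γ ((-1 : ℝ) • v) = quad 1 γ v := by
    simp only [quad]
    rw [bil_eq, bil_eq]; simp
  rw [quad_add, e, e2] at h1
  rw [quad_add]; linarith

theorem perpSq_eq (q : Fin n → ℕ) : perpSq γ q = quad 1 γ fun l => (q l : ℝ) := by
  rw [h.quad_one_eq, perpSq]
  refine Finset.sum_congr rfl fun l _ => ?_
  have h0 := h.γ_pos l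
  have h1 := (Real.sqrt_pos.mpr h0).ne'
  have e : γ l = √(γ l) ^ 2 := (Real.sq_sqrt h0.le).symm
  rw [tilt]
  have : (q l : ℝ) / √(γ l) - (∑ i, (q i : ℝ)) / (∑ i, γ i) * √(γ l)
      = √(γ l) * ((q l : ℝ) / γ l - 1 * ((∑ i, (q i : ℝ)) / ∑ i, γ i)) := by
    rw [mul_sub]
    congr 1
    · rw [← mul_div_assoc, div_eq_div_iff h1 h0.ne']
      linear_combination -(q l : ℝ) * Real.mul_self_sqrt h0.le
    · ring
  rw [this, mul_pow, ← e]

end WeightBounds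

theorem partialSum_eq_range (c : ℕ → ℝ) (m : ℕ) (hm : m ≤ n) :
    partialSum (fun l : Fin n => c l) m = ∑ i ∈ Finset.range m, c i := by
  rw [partialSum, Finset.sum_filter, Fin.sum_univ_eq_sum_range (fun i => if i < m then c i else 0),
    ← Finset.sum_filter]
  congr 1
  ext i
  simp only [Finset.mem_filter, Finset.mem_range]
  omega

/-- Summation by parts against an antitone sequence. -/
theorem sum_mul_le_of_partialSum_le {x c : Fin n → ℝ} (hn : 0 < n) (hx : Antitone x) {g e : ℝ}
    (hc : ∀ m, 1 ≤ m → m < n → partialSum c m ≤ -g) (he : ∑ l, c l = -e) :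
    ∑ l, x l * c l ≤ -g * (x ⟨0, hn⟩ - x ⟨n - 1, by omega⟩) - e * x ⟨n - 1, by omega⟩ := by
  let x' : ℕ → ℝ := fun i => if h : i < n then x ⟨i, h⟩ else 0
  let c' : ℕ → ℝ := fun i => if h : i < n then c ⟨i, h⟩ else 0
  have hx' : ∀ l : Fin n, x l = x' l := fun l => by simp [x']
  have hc' : c = fun l : Fin n => c' l := by ext l; simp [c']
  have e1 : ∑ l, x l * c l = ∑ i ∈ Finset.range n, x' i * c' i := by
    rw [← Fin.sum_univ_eq_sum_range (fun i => x' i * c' i)]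
    exact Finset.sum_congr rfl fun l _ => by rw [hx' l, hc']
  have e2 : ∑ i ∈ Finset.range n, c' i = -e := by
    rw [← he, hc', ← Fin.sum_univ_eq_sum_range]
  have e3 := Finset.sum_range_by_parts x' c' n
  simp only [smul_eq_mul] at e3
  rw [e1, e3, e2, hx' ⟨0, hn⟩, hx' ⟨n - 1, _⟩]
  -- Each decrement of the antitone sequence multiplies a partial sum at most `-g`. Adding these
  -- bounds telescopes to the spread between first and last entries; the boundary term carries the
  -- full sum `-e`.
  have h1 : ∀ i ∈ Finset.range (n - 1), g * (x' i - x' (i + 1))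
      ≤ (x' (i + 1) - x' i) * ∑ j ∈ Finset.range (i + 1), c' j := by
    intro i hi
    rw [Finset.mem_range] at hi
    have ha : x' (i + 1) ≤ x' i := by
      have e1 : x' (i + 1) = x ⟨i + 1, by omega⟩ := by simp only [x']; rw [dif_pos]
      have e2 : x' i = x ⟨i, by omega⟩ := by simp only [x']; rw [dif_pos]
      rw [e1, e2]
      exact hx (by simp [Fin.le_def])
    have hb : ∑ j ∈ Finset.range (i + 1), c' j ≤ -g := by
      rw [← partialSum_eq_range c' (i + 1) (by omega : i + 1 ≤ n), ← hc']
      exact hc _ (by omega) (by omega)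
    nlinarith
  have h2 := Finset.sum_le_sum h1
  rw [← Finset.mul_sum, Finset.sum_range_sub'] at h2
  simp only at h2 ⊢
  linarith

end Quadratic

/-! ### Randomness of a slot, and the mean effect of a routing decision -/

section Noise

variable {n T : ℕ} {γ : Fin n → ℝ}

/-- The randomness of a slot: arrivals, services and the two randomization variables. -/
abbrev Noise (n : ℕ) : Type := ℕ × (Fin n → ℕ) × unitInterval × unitInterval

/-- Law of the randomness of a slot. -/
noncomputable def noise (a : Measure ℕ) (s : Measure (Fin n → ℕ)) : Measure (Noise n) :=
  a.prod (s.prod ((volume : Measure unitInterval).prod (volume : Measure unitInterval)))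

instance noise_isProbabilityMeasure (a : Measure ℕ) (s : Measure (Fin n → ℕ))
    [IsProbabilityMeasure a] [IsProbabilityMeasure s] : IsProbabilityMeasure (noise a s) := by
  unfold noise; infer_instance

theorem Policy.measurable_decide (P : Policy n T γ) (μ : Fin n → ℝ) (η : Equiv.Perm (Fin n)) :
    Measurable (P.decide η μ) :=
  measurable_to_countable' fun d => P.measurableSet_decide η μ d

theorem Policy.measurable_decide_sort (P : Policy n T γ) (μ : Fin n → ℝ) (o : Fin n → ℝ) :
    Measurable fun vw : unitInterval × unitInterval => P.decide (P.sort o vw.1) μ vw.2 := by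
  refine measurable_to_countable' fun d => ?_
  have e : (fun vw : unitInterval × unitInterval => P.decide (P.sort o vw.1) μ vw.2) ⁻¹' {d}
      = ⋃ η : Equiv.Perm (Fin n), {v | P.sort o v = η} ×ˢ {w | P.decide η μ w = d} := by
    ext vw
    simp
  rw [e]
  exact MeasurableSet.iUnion fun η =>
    (P.measurableSet_sort o η).prod (P.measurableSet_decide η μ d)

theorem Policy.measurable_step (P : Policy n T γ) (μ : Fin n → ℝ) (x : State n T) :
    Measurable (P.step μ x) := by
  refine measurable_from_prod_countable_right fun k => ?_
  refine measurable_from_prod_countable_right fun m => ?_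
  by_cases h : (x.2.2 : ℕ) + 1 < T
  · have e : (fun vw => P.step μ x (k, m, vw))
        = fun _ => (nextQueue x.1 (x.2.1 x.2.2) k m, x.2.1, ⟨(x.2.2 : ℕ) + 1, h⟩) := by
      ext1 vw; simp [Policy.step, h]
    rw [e]; exact measurable_const
  · have e : (fun vw => P.step μ x (k, m, vw))
        = fun vw => (nextQueue x.1 (x.2.1 x.2.2) k m,
          P.decide (P.sort (fun l => (nextQueue x.1 (x.2.1 x.2.2) k m l : ℝ) / γ l) vw.1) μ vw.2,
          ⟨0, Nat.zero_lt_of_lt x.2.2.isLt⟩) := by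
      ext1 vw; simp [Policy.step, h]
    rw [e]
    exact measurable_const.prodMk ((P.measurable_decide_sort μ _).prodMk measurable_const)

theorem Policy.kernel_apply (P : Policy n T γ) (μ : Fin n → ℝ) (a : Measure ℕ)
    (s : Measure (Fin n → ℕ)) (x : State n T) :
    P.kernel μ a s x = (noise a s).map (P.step μ x) := rfl

instance Policy.kernel_isMarkovKernel (P : Policy n T γ) (μ : Fin n → ℝ) (a : Measure ℕ)
    (s : Measure (Fin n → ℕ)) [IsProbabilityMeasure a] [IsProbabilityMeasure s] :
    IsMarkovKernel (P.kernel μ a s) :=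
  ⟨fun x => by
    rw [P.kernel_apply]
    exact Measure.isProbabilityMeasure_map (P.measurable_step μ x).aemeasurable⟩

theorem Policy.integral_kernel (P : Policy n T γ) (μ : Fin n → ℝ) (a : Measure ℕ)
    (s : Measure (Fin n → ℕ)) (x : State n T) (F : State n T → ℝ) :
    ∫ z, F z ∂P.kernel μ a s x = ∫ ξ, F (P.step μ x ξ) ∂noise a s := by
  rw [P.kernel_apply, integral_map (P.measurable_step μ x).aemeasurable
    (Measurable.of_discrete).aestronglyMeasurable]

/-- Arrivals and services of a slot are bounded by `α` and `β`. -/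
structure BoundedLaws (a : Measure ℕ) (s : Measure (Fin n → ℕ)) (α β : ℝ) : Prop where
  arrival : ∀ᵐ k : ℕ ∂a, (k : ℝ) ≤ α
  service : ∀ l, ∀ᵐ k ∂s, (k l : ℝ) ≤ β

theorem measurePreserving_arrival {a : Measure ℕ} {s : Measure (Fin n → ℕ)} [SFinite a]
    [IsProbabilityMeasure s] : MeasurePreserving (fun ξ : Noise n => ξ.1) (noise a s) a :=
  measurePreserving_fst

theorem measurePreserving_service {a : Measure ℕ} {s : Measure (Fin n → ℕ)}
    [IsProbabilityMeasure a] [SFinite s] :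
    MeasurePreserving (fun ξ : Noise n => ξ.2.1) (noise a s) s :=
  measurePreserving_fst.comp measurePreserving_snd

theorem integral_arrival {a : Measure ℕ} {s : Measure (Fin n → ℕ)} [SFinite a]
    [IsProbabilityMeasure s] (g : ℕ → ℝ) : ∫ ξ, g ξ.1 ∂noise (n := n) a s = ∫ k, g k ∂a :=
  measurePreserving_arrival.hasLaw.integral_comp (Measurable.of_discrete).aestronglyMeasurable

theorem integral_service {a : Measure ℕ} {s : Measure (Fin n → ℕ)} [IsProbabilityMeasure a]
    [SFinite s] (g : (Fin n → ℕ) → ℝ) : ∫ ξ, g ξ.2.1 ∂noise a s = ∫ k, g k ∂s :=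
  measurePreserving_service.hasLaw.integral_comp (Measurable.of_discrete).aestronglyMeasurable

section

variable {a : Measure ℕ} {s : Measure (Fin n → ℕ)} [IsProbabilityMeasure a]
  [IsProbabilityMeasure s] {α β : ℝ}

theorem BoundedLaws.ae_noise (h : BoundedLaws a s α β) :
    ∀ᵐ ξ ∂noise a s, (ξ.1 : ℝ) ≤ α ∧ ∀ l, (ξ.2.1 l : ℝ) ≤ β := by
  have h1 := (measurePreserving_arrival (a := a) (s := s)).quasiMeasurePreserving.ae h.arrival
  have h2 : ∀ᵐ ξ ∂noise a s, ∀ l, (ξ.2.1 l : ℝ) ≤ β := ae_all_iff.mpr fun l =>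
    (measurePreserving_service (a := a) (s := s)).quasiMeasurePreserving.ae (h.service l)
  filter_upwards [h1, h2] with ξ hξ hξ' using ⟨hξ, hξ'⟩

/-- Every function of arrivals, services and next state is integrable, as these take finitely many
values. -/
theorem BoundedLaws.integrable (h : BoundedLaws a s α β) (P : Policy n T γ) (μ : Fin n → ℝ)
    (x : State n T) (F : ℕ → (Fin n → ℕ) → State n T → ℝ) :
    Integrable (fun ξ => F ξ.1 ξ.2.1 (P.step μ x ξ)) (noise a s) := by
  have hm : Measurable fun ξ : Noise n => (ξ.1, ξ.2.1, P.step μ x ξ) :=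
    measurable_fst.prodMk ((measurable_fst.comp measurable_snd).prodMk (P.measurable_step μ x))
  have hF : Measurable fun z : ℕ × (Fin n → ℕ) × State n T => F z.1 z.2.1 z.2.2 :=
    Measurable.of_discrete
  let B : Set (ℕ × (Fin n → ℕ) × State n T) :=
    Set.Iic ⌈α⌉₊ ×ˢ Set.Iic (fun _ => ⌈β⌉₊) ×ˢ
      (Set.Iic (fun l => x.1 l + ⌈α⌉₊) ×ˢ (Set.univ : Set ((Fin T → Fin n) × Fin T)))
  have hB : B.Finite := (Set.finite_Iic _).prod ((Set.finite_Iic _).prod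
    ((Set.finite_Iic _).prod Set.finite_univ))
  obtain ⟨C, hC⟩ := (hB.image fun z => ‖F z.1 z.2.1 z.2.2‖).bddAbove
  refine Integrable.of_bound (hF.comp hm).aestronglyMeasurable C ?_
  filter_upwards [h.ae_noise] with ξ hξ
  refine hC ⟨(ξ.1, ξ.2.1, P.step μ x ξ), ?_, rfl⟩
  have h1 : ξ.1 ≤ ⌈α⌉₊ := by exact_mod_cast hξ.1.trans (Nat.le_ceil α)
  refine ⟨h1, fun l => by exact_mod_cast (hξ.2 l).trans (Nat.le_ceil β), ?_, trivial⟩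
  have e : (P.step μ x ξ).1 = nextQueue x.1 (x.2.1 x.2.2) ξ.1 ξ.2.1 := by
    unfold Policy.step; split_ifs <;> rfl
  intro l
  rw [e]
  simp only [nextQueue]
  split_ifs <;> omega

theorem BoundedLaws.integrable_kernel (h : BoundedLaws a s α β) (P : Policy n T γ)
    (μ : Fin n → ℝ) (x : State n T) (F : State n T → ℝ) : Integrable F (P.kernel μ a s x) := by
  rw [P.kernel_apply, integrable_map_measure (Measurable.of_discrete).aestronglyMeasurable
    (P.measurable_step μ x).aemeasurable]
  exact h.integrable P μ x fun _ _ z => F z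

/-- Integrability is not required, since a non-integrable function has integral `0` by convention.
This lets the bound be applied through three nested products without side conditions. -/
theorem integral_prod_nonpos {X Y : Type*} [MeasurableSpace X] [MeasurableSpace Y]
    {ρ : Measure X} {τ : Measure Y} [SFinite ρ] [SFinite τ] {F : X × Y → ℝ}
    (h : ∀ x, ∫ y, F (x, y) ∂τ ≤ 0) : ∫ z, F z ∂ρ.prod τ ≤ 0 := by
  by_cases hF : Integrable F (ρ.prod τ)
  · rw [integral_prod _ hF]; exact integral_nonpos h
  · rw [integral_undef hF]

/-- At the end of a cycle, expectations over the new destinations may be bounded conditionally on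
the new queue lengths and on any permutation sorting them. -/
theorem BoundedLaws.integral_decide_le (h : BoundedLaws a s α β) (P : Policy n T γ)
    (hγ : ∀ l, 0 < γ l) (μ : Fin n → ℝ) (x : State n T) (hx : ¬ (x.2.2 : ℕ) + 1 < T)
    (F : (Fin n → ℕ) → (Fin T → Fin n) → ℝ) (B : (Fin n → ℕ) → ℝ)
    (hF : ∀ q η, Antitone (fun i => (q (η i) : ℝ) / γ (η i)) →
      ∫ w, F q (P.decide η μ w) ≤ B q) :
    ∫ ξ, F (P.step μ x ξ).1 (P.step μ x ξ).2.1 ∂noise a s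
      ≤ ∫ ξ, B (P.step μ x ξ).1 ∂noise a s := by
  have i1 := h.integrable P μ x fun _ _ z => F z.1 z.2.1
  have i2 := h.integrable P μ x fun _ _ z => B z.1
  rw [← sub_nonpos, ← integral_sub i1 i2]
  -- Fixing arrivals, services and the sorting variable fixes the new queue and the permutation;
  -- only the independent variable of the decision remains to be integrated.
  refine integral_prod_nonpos fun k => integral_prod_nonpos fun m => integral_prod_nonpos fun v => ?_
  simp only [Policy.step, hx, dite_false]
  set q := nextQueue x.1 (x.2.1 x.2.2) k m
  have hi : Integrable (fun w => F q (P.decide (P.sort (fun l => (q l : ℝ) / γ l) v) μ w))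
      (volume : Measure unitInterval) := by
    obtain ⟨C, hC⟩ := (Set.finite_range fun d => ‖F q d‖).bddAbove
    exact Integrable.of_bound ((Measurable.of_discrete (f := F q)).comp
      (P.measurable_decide μ _)).aestronglyMeasurable C (ae_of_all _ fun w => hC ⟨_, rfl⟩)
  rw [integral_sub hi (integrable_const _), integral_const, probReal_univ, one_smul, sub_nonpos]
  exact hF q _ (P.sort_antitone (fun l => (q l : ℝ) / γ l)
    (fun l => div_nonneg (Nat.cast_nonneg _) (hγ l).le) v)

end

/-- Expected change of the queue lengths over a cycle with destinations `d`, ignoring unused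
services, when `lam` jobs arrive per slot on average. -/
noncomputable def cycleShift (lam : ℝ) (μ : Fin n → ℝ) (d : Fin T → Fin n) (l : Fin n) : ℝ :=
  ∑ k, ((if d k = l then lam else 0) - μ l)

theorem cycleShift_eq (lam : ℝ) (μ : Fin n → ℝ) (d : Fin T → Fin n) (l : Fin n) :
    cycleShift lam μ d l = lam * ((Finset.univ.filter fun j : Fin T => d j = l).card : ℝ)
      - T * μ l := by
  rw [cycleShift, Finset.sum_sub_distrib, ← Finset.sum_filter]
  simp [mul_comm]

theorem Policy.routed_nonneg (P : Policy n T γ) (μ : Fin n → ℝ) (η : Equiv.Perm (Fin n))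
    (l : Fin n) (w : unitInterval) : 0 ≤ P.routed μ η l w := by
  unfold Policy.routed; positivity

theorem Policy.integrable_routed (P : Policy n T γ) (μ : Fin n → ℝ) (η : Equiv.Perm (Fin n))
    (l : Fin n) : Integrable (P.routed μ η l) := by
  let g : (Fin T → Fin n) → ℝ := fun d =>
    ((Finset.univ.filter fun j : Fin T => d j = η l).card : ℝ) / T
  obtain ⟨C, hC⟩ := (Set.finite_range fun d => ‖g d‖).bddAbove
  exact Integrable.of_bound ((Measurable.of_discrete (f := g)).comp
    (P.measurable_decide μ _)).aestronglyMeasurable C (ae_of_all _ fun w => hC ⟨_, rfl⟩)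

theorem Policy.frac_nonneg (P : Policy n T γ) (μ : Fin n → ℝ) (η : Equiv.Perm (Fin n))
    (l : Fin n) : 0 ≤ P.frac μ η l :=
  integral_nonneg fun w => P.routed_nonneg μ η l w

theorem Policy.sum_frac (P : Policy n T γ) (hT : 1 ≤ T) (μ : Fin n → ℝ)
    (η : Equiv.Perm (Fin n)) : ∑ l, P.frac μ η l = 1 := by
  unfold Policy.frac
  rw [← integral_finsetSum _ fun l _ => P.integrable_routed μ η l]
  have : ∀ w, ∑ l, P.routed μ η l w = 1 := by
    intro w
    have hT' : (T : ℝ) ≠ 0 := by positivity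
    simp only [Policy.routed]
    rw [← Finset.sum_div, div_eq_one_iff_eq hT', ← Nat.cast_sum]
    have h1 : ∑ l, (Finset.univ.filter fun j : Fin T => P.decide η μ w j = η l).card
        = ∑ l, (Finset.univ.filter fun j : Fin T => P.decide η μ w j = l).card :=
      Equiv.sum_comp η fun l => (Finset.univ.filter fun j : Fin T => P.decide η μ w j = l).card
    rw [h1, ← Finset.card_eq_sum_card_fiberwise fun _ _ => Finset.mem_coe.mpr (Finset.mem_univ _)]
    simp
  simp [this]

/-- Summing over ranks instead of servers turns the counts of routed slots into the fractions whose
means are `P.frac`. -/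
theorem Policy.integral_bil_cycleShift (P : Policy n T γ) (hT : 1 ≤ T) (μ : Fin n → ℝ)
    (lam θ : ℝ) (y : Fin n → ℝ) (η : Equiv.Perm (Fin n)) :
    ∫ w, bil θ γ y (cycleShift lam μ (P.decide η μ w))
      = T * ∑ i, tilt θ γ y (η i) * (lam * P.frac μ η i - μ (η i)) := by
  have hT' : (T : ℝ) ≠ 0 := by positivity
  have e : ∀ w, bil θ γ y (cycleShift lam μ (P.decide η μ w))
      = ∑ i, (T * tilt θ γ y (η i)) * (lam * P.routed μ η i w - μ (η i)) := by
    intro w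
    rw [bil, ← Equiv.sum_comp η]
    refine Finset.sum_congr rfl fun i _ => ?_
    rw [cycleShift_eq, Policy.routed]
    field_simp
  simp_rw [e]
  have hi : ∀ i, Integrable (fun w => lam * P.routed μ η i w) :=
    fun i => (P.integrable_routed μ η i).const_mul lam
  have hi' : ∀ i ∈ Finset.univ, Integrable (fun w =>
      (T * tilt θ γ y (η i)) * (lam * P.routed μ η i w - μ (η i))) := fun i _ =>
    ((hi i).sub (integrable_const _)).const_mul _
  rw [integral_finsetSum _ hi', Finset.mul_sum]
  refine Finset.sum_congr rfl fun i _ => ?_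
  rw [integral_const_mul, integral_sub (hi i) (integrable_const _), integral_const_mul]
  simp [Policy.frac, mul_assoc]

/-- Total service rate minus total routed rate over the longest scaled queues is at least `g`. -/
def MajorizationGap (μ : Fin n → ℝ) (f : Equiv.Perm (Fin n) → Fin n → ℝ) (g : ℝ) : Prop :=
  ∀ η : Equiv.Perm (Fin n), ∀ m : ℕ, 1 ≤ m → m < n →
    g ≤ partialSum (fun l => μ (η l)) m - (∑ l, μ l) * partialSum (f η) m

/-- Recentring subtracts a constant and so keeps the order of the scaled lengths. The net rates have
total `-ε` since the fractions sum to `1`, and lowering the arrival rate by `ε` only lowers their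
partial sums, so the gap `g` is retained. -/
theorem Policy.sum_tilt_mul_le (P : Policy n T γ) (hT : 1 ≤ T) (hn : 0 < n) {μ : Fin n → ℝ}
    {g ε : ℝ} (hε : 0 ≤ ε) (hg : MajorizationGap μ (P.frac μ) g) (θ : ℝ) (y : Fin n → ℝ)
    (η : Equiv.Perm (Fin n)) (hη : Antitone fun i => y (η i) / γ (η i)) :
    ∑ i, tilt θ γ y (η i) * (((∑ l, μ l) - ε) * P.frac μ η i - μ (η i))
      ≤ -g * (tilt θ γ y (η ⟨0, hn⟩) - tilt θ γ y (η ⟨n - 1, by omega⟩))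
        - ε * tilt θ γ y (η ⟨n - 1, by omega⟩) := by
  have hx : Antitone fun i => tilt θ γ y (η i) := fun i j hij => by
    have := hη hij
    simp only [tilt] at *
    linarith
  refine sum_mul_le_of_partialSum_le hn hx (g := g) (e := ε) ?_ ?_
  · intro m hm hmn
    have h1 := hg η m hm hmn
    have h2 : 0 ≤ partialSum (P.frac μ η) m := Finset.sum_nonneg fun i _ => P.frac_nonneg μ η i
    have e : partialSum (fun i => ((∑ l, μ l) - ε) * P.frac μ η i - μ (η i)) m
        = ((∑ l, μ l) - ε) * partialSum (P.frac μ η) m - partialSum (fun l => μ (η l)) m := by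
      simp only [partialSum, Finset.sum_sub_distrib, Finset.mul_sum]
    rw [e]
    nlinarith
  · rw [Finset.sum_sub_distrib, ← Finset.mul_sum, P.sum_frac hT, Equiv.sum_comp η μ]
    ring

theorem dev_le_of_antitone {θ b : ℝ} (y : Fin n → ℝ) (η : Equiv.Perm (Fin n))
    (h : ∀ i, |tilt θ γ y (η i)| ≤ b) : dev θ γ y ≤ n * b := by
  rw [dev, ← Equiv.sum_comp η]
  calc _ ≤ ∑ _i : Fin n, b := Finset.sum_le_sum fun i _ => h i
    _ = n * b := by simp

/-- The `γ`-weighted mean of the recentred lengths is zero, so the largest is nonnegative and the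
smallest nonpositive, and their spread bounds every absolute value. The term in `ε` costs at most
`ε` times the spread, leaving a drift at rate `g - ε`. -/
theorem Policy.integral_bil_one_le (P : Policy n T γ) {M : ℝ} (hw : WeightBounds γ M)
    (hT : 1 ≤ T) {μ : Fin n → ℝ} {g ε : ℝ} (hε : 0 ≤ ε) (hεg : ε ≤ g)
    (hg : MajorizationGap μ (P.frac μ) g) (y : Fin n → ℝ) (η : Equiv.Perm (Fin n))
    (hη : Antitone fun i => y (η i) / γ (η i)) :
    ∫ w, bil 1 γ y (cycleShift ((∑ l, μ l) - ε) μ (P.decide η μ w))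
      ≤ -(T * (g - ε) / n) * dev 1 γ y := by
  have hn := hw.pos
  rw [P.integral_bil_cycleShift hT]
  have h1 := P.sum_tilt_mul_le hT hn hε hg 1 y η hη
  set x0 := tilt 1 γ y (η ⟨0, hn⟩) with hx0
  set x1 := tilt 1 γ y (η ⟨n - 1, by omega⟩) with hx1
  have hx : Antitone fun i => tilt 1 γ y (η i) := fun i j hij => by
    have := hη hij
    simp only [tilt] at *
    linarith
  have hle0 : ∀ i, tilt 1 γ y (η i) ≤ x0 := fun i => hx (by simp [Fin.le_def])
  have hle1 : ∀ i, x1 ≤ tilt 1 γ y (η i) := fun i => hx (by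
    rw [Fin.le_def]; exact Nat.le_sub_one_of_lt i.isLt)
  have hz : ∑ i, γ (η i) * tilt 1 γ y (η i) = 0 := by
    rw [Equiv.sum_comp η fun l => γ l * tilt 1 γ y l]
    have hs := hw.sum_γ_pos.ne'
    simp only [tilt, mul_sub, Finset.sum_sub_distrib, ← Finset.sum_mul]
    rw [Finset.sum_congr rfl fun l _ => mul_div_cancel₀ (y l) (hw.γ_pos l).ne']
    field_simp
    ring
  have hγs : 0 < ∑ i, γ (η i) := by rw [Equiv.sum_comp η γ]; exact hw.sum_γ_pos
  have h2 : 0 ≤ x0 := by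
    by_contra hneg
    have : ∑ i, γ (η i) * tilt 1 γ y (η i) ≤ ∑ i, γ (η i) * x0 :=
      Finset.sum_le_sum fun i _ => mul_le_mul_of_nonneg_left (hle0 i) (hw.γ_pos _).le
    rw [hz, ← Finset.sum_mul] at this
    nlinarith
  have h3 : x1 ≤ 0 := by
    by_contra hneg
    have : ∑ i, γ (η i) * x1 ≤ ∑ i, γ (η i) * tilt 1 γ y (η i) :=
      Finset.sum_le_sum fun i _ => mul_le_mul_of_nonneg_left (hle1 i) (hw.γ_pos _).le
    rw [hz, ← Finset.sum_mul] at this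
    nlinarith
  have h4 : dev 1 γ y ≤ n * (x0 - x1) := dev_le_of_antitone y η fun i => by
    rw [abs_le]; constructor <;> linarith [hle0 i, hle1 i]
  have hn' : (0 : ℝ) < n := by exact_mod_cast hn
  have h5 : dev 1 γ y / n ≤ x0 - x1 := by rwa [div_le_iff₀' hn']
  have h6 : (g - ε) * (dev 1 γ y / n) ≤ (g - ε) * (x0 - x1) :=
    mul_le_mul_of_nonneg_left h5 (by linarith)
  have h7 : ε * (-x1) ≤ ε * (x0 - x1) := mul_le_mul_of_nonneg_left (by linarith) hε
  calc _ ≤ (T : ℝ) * (-((g - ε) * (dev 1 γ y / n))) :=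
        mul_le_mul_of_nonneg_left (by linarith) (Nat.cast_nonneg T)
    _ = _ := by ring

/-- Since `ε ≤ g`, the spread may be charged only at rate `ε`; together with the boundary term this
gives exactly `-ε` times the largest scaled length, which is at least `dev / n`. -/
theorem Policy.integral_bil_zero_le (P : Policy n T γ) {M : ℝ} (hw : WeightBounds γ M)
    (hT : 1 ≤ T) {μ : Fin n → ℝ} {g ε : ℝ} (hε : 0 ≤ ε) (hεg : ε ≤ g)
    (hg : MajorizationGap μ (P.frac μ) g) (y : Fin n → ℝ) (hy : ∀ l, 0 ≤ y l)
    (η : Equiv.Perm (Fin n)) (hη : Antitone fun i => y (η i) / γ (η i)) :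
    ∫ w, bil 0 γ y (cycleShift ((∑ l, μ l) - ε) μ (P.decide η μ w))
      ≤ -(T * ε / n) * dev 0 γ y := by
  have hn := hw.pos
  rw [P.integral_bil_cycleShift hT]
  have h1 := P.sum_tilt_mul_le hT hn hε hg 0 y η hη
  set x0 := tilt 0 γ y (η ⟨0, hn⟩) with hx0
  set x1 := tilt 0 γ y (η ⟨n - 1, by omega⟩) with hx1
  have hx : Antitone fun i => tilt 0 γ y (η i) := fun i j hij => by
    have := hη hij
    simp only [tilt] at *
    linarith
  have hle0 : ∀ i, tilt 0 γ y (η i) ≤ x0 := fun i => hx (by simp [Fin.le_def])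
  have hnn : ∀ l, 0 ≤ tilt 0 γ y l := fun l => by
    simpa [tilt] using div_nonneg (hy l) (hw.γ_pos l).le
  have h4 : dev 0 γ y ≤ n * x0 := dev_le_of_antitone y η fun i => by
    rw [abs_of_nonneg (hnn _)]; exact hle0 i
  have hn' : (0 : ℝ) < n := by exact_mod_cast hn
  have h5 : dev 0 γ y / n ≤ x0 := by rwa [div_le_iff₀' hn']
  have h6 : ε * (dev 0 γ y / n) ≤ ε * x0 := mul_le_mul_of_nonneg_left h5 hε
  have h7 : ε * (x0 - x1) ≤ g * (x0 - x1) :=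
    mul_le_mul_of_nonneg_right hεg (sub_nonneg.mpr (hle0 _))
  calc _ ≤ (T : ℝ) * (-(ε * (dev 0 γ y / n))) :=
        mul_le_mul_of_nonneg_left (by linarith) (Nat.cast_nonneg T)
    _ = _ := by ring

end Noise

/-! ### The predicted queue at the end of a cycle, and its increments -/

section Drift

variable {n T : ℕ} {γ : Fin n → ℝ}

/-- Expected queue lengths at the end of the current cycle, ignoring unused services. -/
noncomputable def pred (lam : ℝ) (μ : Fin n → ℝ) (x : State n T) (l : Fin n) : ℝ :=
  x.1 l + ∑ k : Fin T, if x.2.2 ≤ k then ((if x.2.1 k = l then lam else 0) - μ l) else 0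

/-- Unused services of a slot with `k` arrivals and potential services `m`. -/
noncomputable def unused (x : State n T) (k : ℕ) (m : Fin n → ℕ) (l : Fin n) : ℝ :=
  nextQueue x.1 (x.2.1 x.2.2) k m l - (x.1 l + (if l = x.2.1 x.2.2 then (k : ℝ) else 0) - m l)

/-- Centred arrivals minus centred services of a slot. -/
noncomputable def centred (lam : ℝ) (μ : Fin n → ℝ) (x : State n T) (k : ℕ) (m : Fin n → ℕ)
    (l : Fin n) : ℝ :=
  (if l = x.2.1 x.2.2 then (k : ℝ) - lam else 0) - (m l - μ l)

theorem Policy.step_queue (P : Policy n T γ) (μ : Fin n → ℝ) (x : State n T) (ξ : Noise n) :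
    (P.step μ x ξ).1 = nextQueue x.1 (x.2.1 x.2.2) ξ.1 ξ.2.1 := by
  unfold Policy.step; split_ifs <;> rfl

theorem Policy.step_queue_eq (P : Policy n T γ) (μ : Fin n → ℝ) (x : State n T) (ξ : Noise n)
    (l : Fin n) : ((P.step μ x ξ).1 l : ℝ)
      = x.1 l + (if l = x.2.1 x.2.2 then (ξ.1 : ℝ) else 0) - ξ.2.1 l + unused x ξ.1 ξ.2.1 l := by
  rw [P.step_queue, unused]; ring

theorem pred_of_lt (lam : ℝ) (μ : Fin n → ℝ) (x : State n T) (l : Fin n)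
    (h : (x.2.2 : ℕ) + 1 < T) :
    pred lam μ x l = x.1 l + ((if x.2.1 x.2.2 = l then lam else 0) - μ l)
      + ∑ k : Fin T, if (⟨x.2.2 + 1, h⟩ : Fin T) ≤ k
        then ((if x.2.1 k = l then lam else 0) - μ l) else 0 := by
  have e : ∀ k : Fin T, (if x.2.2 ≤ k then ((if x.2.1 k = l then lam else 0) - μ l) else 0)
      = (if k = x.2.2 then ((if x.2.1 k = l then lam else 0) - μ l) else 0)
        + (if (⟨x.2.2 + 1, h⟩ : Fin T) ≤ k
          then ((if x.2.1 k = l then lam else 0) - μ l) else 0) := by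
    intro k
    generalize (if x.2.1 k = l then lam else 0) - μ l = t
    simp only [Fin.le_def, Fin.ext_iff]
    by_cases h1 : (x.2.2 : ℕ) ≤ k
    · by_cases h2 : (k : ℕ) = x.2.2
      · rw [if_pos h1, if_pos h2, if_neg (by omega)]; ring
      · rw [if_pos h1, if_neg h2, if_pos (by omega)]; ring
    · rw [if_neg h1, if_neg (by omega), if_neg (by omega)]; ring
  rw [pred, Finset.sum_congr rfl fun k _ => e k, Finset.sum_add_distrib, Finset.sum_ite_eq']
  simp [add_assoc]

theorem pred_of_not_lt (lam : ℝ) (μ : Fin n → ℝ) (x : State n T) (l : Fin n)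
    (h : ¬ (x.2.2 : ℕ) + 1 < T) :
    pred lam μ x l = x.1 l + ((if x.2.1 x.2.2 = l then lam else 0) - μ l) := by
  have e : ∀ k : Fin T, (if x.2.2 ≤ k then ((if x.2.1 k = l then lam else 0) - μ l) else 0)
      = (if k = x.2.2 then ((if x.2.1 k = l then lam else 0) - μ l) else 0) := by
    intro k
    have hk := k.isLt
    have : x.2.2 ≤ k ↔ k = x.2.2 := by
      rw [Fin.le_def, Fin.ext_iff]; omega
    simp only [this]
  rw [pred, Finset.sum_congr rfl fun k _ => e k, Finset.sum_ite_eq']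
  simp

/-- The destinations of the whole cycle are part of the state, so the mean change of the slot is
already counted in `pred`. Up to unused services, `pred` is a martingale inside a cycle. -/
theorem Policy.pred_step_of_lt (P : Policy n T γ) (lam : ℝ) (μ : Fin n → ℝ) (x : State n T)
    (ξ : Noise n) (h : (x.2.2 : ℕ) + 1 < T) :
    pred lam μ (P.step μ x ξ)
      = pred lam μ x + (centred lam μ x ξ.1 ξ.2.1 + unused x ξ.1 ξ.2.1) := by
  ext l
  have e2 : (P.step μ x ξ).2 = (x.2.1, ⟨(x.2.2 : ℕ) + 1, h⟩) := by simp [Policy.step, h]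
  rw [Pi.add_apply, Pi.add_apply, pred_of_lt lam μ x l h, pred, P.step_queue_eq, e2, centred]
  simp only [eq_comm (a := l)]
  split_ifs <;> ring

theorem Policy.queue_step_of_not_lt (P : Policy n T γ) (lam : ℝ) (μ : Fin n → ℝ) (x : State n T)
    (ξ : Noise n) (h : ¬ (x.2.2 : ℕ) + 1 < T) :
    (fun l => ((P.step μ x ξ).1 l : ℝ))
      = pred lam μ x + (centred lam μ x ξ.1 ξ.2.1 + unused x ξ.1 ξ.2.1) := by
  ext l
  rw [Pi.add_apply, Pi.add_apply, pred_of_not_lt lam μ x l h, P.step_queue_eq, centred]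
  simp only [eq_comm (a := l)]
  split_ifs <;> ring

theorem Policy.pred_step_of_not_lt (P : Policy n T γ) (lam : ℝ) (μ : Fin n → ℝ) (x : State n T)
    (ξ : Noise n) (h : ¬ (x.2.2 : ℕ) + 1 < T) :
    pred lam μ (P.step μ x ξ)
      = (fun l => ((P.step μ x ξ).1 l : ℝ)) + cycleShift lam μ (P.step μ x ξ).2.1 := by
  ext l
  have e2 : ((P.step μ x ξ).2.2 : ℕ) = 0 := by simp [Policy.step, h]
  rw [Pi.add_apply, pred, cycleShift]
  congr 1
  refine Finset.sum_congr rfl fun k _ => if_pos ?_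
  rw [Fin.le_def, e2]; exact Nat.zero_le _

theorem unused_nonneg (x : State n T) (k : ℕ) (m : Fin n → ℕ) (l : Fin n) :
    0 ≤ unused x k m l := by
  have h : x.1 l + (if l = x.2.1 x.2.2 then k else 0)
      ≤ nextQueue x.1 (x.2.1 x.2.2) k m l + m l := by
    simp only [nextQueue]; omega
  have h' : (x.1 l : ℝ) + (if l = x.2.1 x.2.2 then (k : ℝ) else 0)
      ≤ nextQueue x.1 (x.2.1 x.2.2) k m l + m l := by exact_mod_cast h
  rw [unused]; linarith

theorem unused_le (x : State n T) (k : ℕ) (m : Fin n → ℕ) (l : Fin n) :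
    unused x k m l ≤ m l := by
  have h : nextQueue x.1 (x.2.1 x.2.2) k m l
      ≤ x.1 l + (if l = x.2.1 x.2.2 then k else 0) := by
    simp only [nextQueue]; omega
  have h' : (nextQueue x.1 (x.2.1 x.2.2) k m l : ℝ)
      ≤ (x.1 l : ℝ) + (if l = x.2.1 x.2.2 then (k : ℝ) else 0) := by exact_mod_cast h
  rw [unused]; linarith

/-- Both consequences of wasted service are used: the queue before the slot is short (for the drift
of the quadratic forms), and the queue after the slot is empty (for the cross term in the delay
bound). -/
theorem unused_eq_zero_or (x : State n T) (k : ℕ) (m : Fin n → ℕ) (l : Fin n) :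
    unused x k m l = 0 ∨ (nextQueue x.1 (x.2.1 x.2.2) k m l = 0 ∧ x.1 l ≤ m l) := by
  by_cases h : m l ≤ x.1 l + (if l = x.2.1 x.2.2 then k else 0)
  · left
    have e : nextQueue x.1 (x.2.1 x.2.2) k m l + m l
        = x.1 l + (if l = x.2.1 x.2.2 then k else 0) := by
      simp only [nextQueue]; omega
    have e' : (nextQueue x.1 (x.2.1 x.2.2) k m l : ℝ) + m l
        = x.1 l + (if l = x.2.1 x.2.2 then (k : ℝ) else 0) := by exact_mod_cast e
    rw [unused]; linarith
  · right
    simp only [nextQueue]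
    omega

/-- Standing assumptions on the model, with a single constant `M` controlling the parameters. -/
structure Controlled (P : Policy n T γ) (μ : Fin n → ℝ) (a : Measure ℕ)
    (s : Measure (Fin n → ℕ)) (M ε : ℝ) : Prop where
  weights : WeightBounds γ M
  one_le_T : 1 ≤ T
  eps_pos : 0 < ε
  eps_le : ε ≤ 1 / (2 * M)
  gap : MajorizationGap μ (P.frac μ) (1 / M)
  laws : BoundedLaws a s (n * M) M
  probArrival : IsProbabilityMeasure a
  probService : IsProbabilityMeasure s
  mean_arrival : ∫ k, (k : ℝ) ∂a = (∑ l, μ l) - ε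
  mean_service : ∀ l, ∫ k, (k l : ℝ) ∂s = μ l

namespace Controlled

variable {P : Policy n T γ} {μ : Fin n → ℝ} {a : Measure ℕ} {s : Measure (Fin n → ℕ)} {M ε : ℝ}
  (h : Controlled P μ a s M ε)
include h

theorem one_le_T' : (1 : ℝ) ≤ T := by exact_mod_cast h.one_le_T

theorem eps_le_one : ε ≤ 1 := by
  have := h.weights.one_le
  refine h.eps_le.trans ?_
  rw [div_le_one (by linarith)]; linarith

theorem integrable (x : State n T) (F : ℕ → (Fin n → ℕ) → State n T → ℝ) :
    Integrable (fun ξ => F ξ.1 ξ.2.1 (P.step μ x ξ)) (noise a s) := by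
  have := h.probArrival
  have := h.probService
  exact h.laws.integrable P μ x F

theorem integrable_kernel (x : State n T) (F : State n T → ℝ) :
    Integrable F (P.kernel μ a s x) := by
  have := h.probArrival
  have := h.probService
  exact h.laws.integrable_kernel P μ x F

theorem markov : IsMarkovKernel (P.kernel μ a s) := by
  have := h.probArrival
  have := h.probService
  infer_instance

theorem probNoise : IsProbabilityMeasure (noise a s) := by
  have := h.probArrival
  have := h.probService
  infer_instance

theorem state_nonempty : Nonempty (State n T) :=
  ⟨(fun _ => 0, fun _ => ⟨0, h.weights.pos⟩, ⟨0, h.one_le_T⟩)⟩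

theorem ae_noise : ∀ᵐ ξ ∂noise a s, (ξ.1 : ℝ) ≤ n * M ∧ ∀ l, (ξ.2.1 l : ℝ) ≤ M := by
  have := h.probArrival
  have := h.probService
  exact h.laws.ae_noise

theorem integral_arrival' :
    ∫ ξ : Noise n, (ξ.1 : ℝ) ∂noise a s = (∑ l, μ l) - ε := by
  have := h.probArrival
  have := h.probService
  rw [← h.mean_arrival]
  exact integral_arrival fun k => (k : ℝ)

theorem integral_service' (l : Fin n) : ∫ ξ : Noise n, (ξ.2.1 l : ℝ) ∂noise a s = μ l := by
  have := h.probArrival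
  have := h.probService
  rw [← h.mean_service l]
  exact integral_service fun m => (m l : ℝ)

theorem mu_nonneg (l : Fin n) : 0 ≤ μ l := by
  rw [← h.mean_service l]; exact integral_nonneg fun k => Nat.cast_nonneg _

theorem mu_le (l : Fin n) : μ l ≤ M := by
  have := h.probNoise
  obtain ⟨x⟩ := h.state_nonempty
  rw [← h.integral_service' l]
  calc _ ≤ ∫ _ξ : Noise n, M ∂noise a s :=
        integral_mono_ae (h.integrable x fun _ m _ => (m l : ℝ)) (integrable_const _)
          (by filter_upwards [h.ae_noise] with ξ hξ using hξ.2 l)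
    _ = M := by simp

theorem lam_nonneg : 0 ≤ (∑ l, μ l) - ε := by
  rw [← h.mean_arrival]; exact integral_nonneg fun k => Nat.cast_nonneg _

theorem sum_mu_le : ∑ l, μ l ≤ n * M := by
  calc ∑ l, μ l ≤ ∑ _l : Fin n, M := Finset.sum_le_sum fun l _ => h.mu_le l
    _ = n * M := by simp

theorem lam_le : (∑ l, μ l) - ε ≤ n * M := by linarith [h.sum_mu_le, h.eps_pos]

theorem integral_centred (x : State n T) (l : Fin n) :
    ∫ ξ : Noise n, centred ((∑ l, μ l) - ε) μ x ξ.1 ξ.2.1 l ∂noise a s = 0 := by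
  have := h.probNoise
  have i1 := h.integrable x fun k _ _ => (if l = x.2.1 x.2.2 then (k : ℝ) - ((∑ l, μ l) - ε) else 0)
  have i2 := h.integrable x fun _ m _ => ((m l : ℝ) - μ l)
  have i3 := h.integrable x fun k _ _ => (k : ℝ)
  have i4 := h.integrable x fun _ m _ => (m l : ℝ)
  simp only [centred]
  rw [integral_sub i1 i2, integral_sub i4 (integrable_const _), h.integral_service' l]
  split_ifs
  · rw [integral_sub i3 (integrable_const _), h.integral_arrival']; simp
  · simp

theorem integral_bil_centred (θ : ℝ) (x : State n T) (y : Fin n → ℝ) :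
    ∫ ξ : Noise n, bil θ γ y (centred ((∑ l, μ l) - ε) μ x ξ.1 ξ.2.1) ∂noise a s = 0 := by
  simp only [bil]
  rw [integral_finsetSum]
  · simp only [integral_const_mul, h.integral_centred, mul_zero, Finset.sum_const_zero]
  · intro l _
    exact h.integrable x fun k m _ => tilt θ γ y l * centred ((∑ l, μ l) - ε) μ x k m l

theorem l1_centred_add_unused_le (x : State n T) {k : ℕ} {m : Fin n → ℕ} (hk : (k : ℝ) ≤ n * M)
    (hm : ∀ l, (m l : ℝ) ≤ M) :
    l1 (centred ((∑ l, μ l) - ε) μ x k m + unused x k m) ≤ 3 * n * M := by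
  have hpt : ∀ l, |(centred ((∑ l, μ l) - ε) μ x k m + unused x k m) l|
      ≤ (if l = x.2.1 x.2.2 then n * M else 0) + 2 * M := by
    intro l
    have h1 := unused_nonneg x k m l
    have h2 := (unused_le x k m l).trans (hm l)
    have h3 : |(m l : ℝ) - μ l| ≤ M := by
      rw [abs_le]
      constructor <;> linarith [h.mu_nonneg l, h.mu_le l, hm l, (Nat.cast_nonneg (m l) : (0:ℝ) ≤ m l)]
    have h4 : |if l = x.2.1 x.2.2 then (k : ℝ) - ((∑ l, μ l) - ε) else 0|
        ≤ if l = x.2.1 x.2.2 then n * M else 0 := by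
      split_ifs
      · rw [abs_le]
        constructor <;> linarith [h.lam_nonneg, h.lam_le, (Nat.cast_nonneg k : (0:ℝ) ≤ k)]
      · simp
    rw [Pi.add_apply, centred]
    calc _ ≤ |(if l = x.2.1 x.2.2 then (k : ℝ) - ((∑ l, μ l) - ε) else 0)|
          + |(m l : ℝ) - μ l| + |unused x k m l| := (abs_add_le _ _).trans (by
            gcongr; exact abs_sub _ _)
      _ ≤ _ := by rw [abs_of_nonneg h1]; linarith
  calc _ ≤ ∑ l, ((if l = x.2.1 x.2.2 then n * M else 0) + 2 * M) :=
        Finset.sum_le_sum fun l _ => hpt l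
    _ = _ := by
        rw [Finset.sum_add_distrib, Finset.sum_ite_eq']
        simp; ring

theorem l1_cycleShift_le (d : Fin T → Fin n) :
    l1 (cycleShift ((∑ l, μ l) - ε) μ d) ≤ 2 * T * n * M := by
  have hpt : ∀ l, |cycleShift ((∑ l, μ l) - ε) μ d l|
      ≤ ((∑ l, μ l) - ε) * ((Finset.univ.filter fun j : Fin T => d j = l).card : ℝ) + T * μ l := by
    intro l
    rw [cycleShift_eq]
    refine (abs_sub _ _).trans (le_of_eq ?_)
    rw [abs_of_nonneg (mul_nonneg h.lam_nonneg (Nat.cast_nonneg _)),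
      abs_of_nonneg (mul_nonneg (Nat.cast_nonneg _) (h.mu_nonneg l))]
  calc _ ≤ _ := Finset.sum_le_sum fun l _ => hpt l
    _ = ((∑ l, μ l) - ε) * T + T * ∑ l, μ l := by
        rw [Finset.sum_add_distrib, ← Finset.mul_sum, ← Finset.mul_sum, ← Nat.cast_sum,
          ← Finset.card_eq_sum_card_fiberwise fun _ _ => Finset.mem_coe.mpr (Finset.mem_univ _)]
        simp
    _ ≤ n * M * T + T * (n * M) := by
        gcongr
        · exact h.lam_le
        · exact h.sum_mu_le
    _ = _ := by ring

theorem pred_le (x : State n T) (l : Fin n) :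
    pred ((∑ l, μ l) - ε) μ x l ≤ x.1 l + T * (n * M) := by
  rw [pred]
  gcongr
  calc _ ≤ ∑ _k : Fin T, n * M := Finset.sum_le_sum fun k _ => by
        have h1 := h.lam_le
        have h2 := h.lam_nonneg
        have h3 := h.mu_nonneg l
        split_ifs <;> linarith
    _ = _ := by simp

/-- Each remaining slot sends its mean arrivals to exactly one server, so it changes the predicted
total by `-ε`. -/
theorem sum_pred_ge (x : State n T) :
    (∑ l, (x.1 l : ℝ)) - T * ε ≤ ∑ l, pred ((∑ l, μ l) - ε) μ x l := by
  simp only [pred]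
  rw [Finset.sum_add_distrib, Finset.sum_comm]
  have : ∀ k : Fin T, -ε ≤ ∑ l, if x.2.2 ≤ k
      then ((if x.2.1 k = l then (∑ l, μ l) - ε else 0) - μ l) else 0 := by
    intro k
    split_ifs
    · rw [Finset.sum_sub_distrib, Finset.sum_ite_eq]; simp
    · simpa using h.eps_pos.le
  have h1 := Finset.sum_le_sum fun k (_ : k ∈ Finset.univ) => this k
  simp only [Finset.sum_const, Finset.card_univ, Fintype.card_fin, nsmul_eq_mul] at h1
  linarith

/-- Where service is unused the queue is at most `M`, so `pred` is at most `2 * T * n * M` there.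
The subtracted average is at least `-T * M`, as the predicted total is at least `-T * ε`. Only an
upper bound holds and only that is needed, since unused services are nonnegative. -/
theorem bil_unused_le {θ : ℝ} (hθ0 : 0 ≤ θ) (hθ1 : θ ≤ 1) (x : State n T) (k : ℕ)
    {m : Fin n → ℕ} (hm : ∀ l, (m l : ℝ) ≤ M) :
    bil θ γ (pred ((∑ l, μ l) - ε) μ x) (unused x k m) ≤ 3 * T * n ^ 2 * M ^ 3 := by
  have hM := h.weights.one_le
  have hn := h.weights.one_le_n
  have hT := h.one_le_T'
  have hTn : 1 ≤ (T : ℝ) * n := one_le_mul_of_one_le_of_one_le hT hn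
  have hsum : -(T * M) ≤ (∑ l, pred ((∑ l, μ l) - ε) μ x l) / ∑ i, γ i := by
    have h1 := h.sum_pred_ge x
    have h2 : 0 ≤ ∑ l, (x.1 l : ℝ) := Finset.sum_nonneg fun l _ => Nat.cast_nonneg _
    have h3 : (T : ℝ) * ε ≤ T * 1 := by gcongr; exact h.eps_le_one
    rw [le_div_iff₀ h.weights.sum_γ_pos]
    have h4 : 1 ≤ M * ∑ i, γ i := by
      have := h.weights.inv_sum_γ_le
      rwa [inv_le_iff_one_le_mul₀ h.weights.sum_γ_pos] at this
    nlinarith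
  have hpt : ∀ l, tilt θ γ (pred ((∑ l, μ l) - ε) μ x) l * unused x k m l
      ≤ 3 * T * n * M ^ 3 := by
    intro l
    have hpos : 0 ≤ 3 * T * n * M ^ 3 := by positivity
    rcases unused_eq_zero_or x k m l with h0 | ⟨-, h0⟩
    · rw [h0, mul_zero]; exact hpos
    · have hq : (x.1 l : ℝ) ≤ M := le_trans (by exact_mod_cast h0) (hm l)
      have h1 : pred ((∑ l, μ l) - ε) μ x l ≤ 2 * T * n * M := by
        have := h.pred_le x l
        nlinarith
      have h2 : pred ((∑ l, μ l) - ε) μ x l / γ l ≤ 2 * T * n * M * M := by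
        rw [div_eq_mul_inv]
        have hi := h.weights.inv_γ_le l
        have hi0 := (inv_pos.mpr (h.weights.γ_pos l)).le
        calc _ ≤ 2 * T * n * M * (γ l)⁻¹ := mul_le_mul_of_nonneg_right h1 hi0
          _ ≤ _ := mul_le_mul_of_nonneg_left hi (by positivity)
      have h3 : -(θ * ((∑ l, pred ((∑ l, μ l) - ε) μ x l) / ∑ i, γ i)) ≤ T * M := by
        have h4 : θ * (-(T * M)) ≤ θ * ((∑ l, pred ((∑ l, μ l) - ε) μ x l) / ∑ i, γ i) :=
          mul_le_mul_of_nonneg_left hsum hθ0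
        have h5 : θ * (T * M) ≤ 1 * (T * M) := by gcongr
        linarith
      have h4 : tilt θ γ (pred ((∑ l, μ l) - ε) μ x) l ≤ 3 * T * n * M ^ 2 := by
        have h5 : (T : ℝ) * M ≤ T * n * M ^ 2 := by
          have : (T : ℝ) * M * 1 ≤ T * M * (n * M) :=
            mul_le_mul_of_nonneg_left (one_le_mul_of_one_le_of_one_le hn hM) (by positivity)
          linarith
        rw [tilt]; linarith
      calc _ ≤ 3 * T * n * M ^ 2 * unused x k m l :=
            mul_le_mul_of_nonneg_right h4 (unused_nonneg x k m l)
        _ ≤ 3 * T * n * M ^ 2 * M := mul_le_mul_of_nonneg_left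
            ((unused_le x k m l).trans (hm l)) (by positivity)
        _ = _ := by ring
  calc _ ≤ ∑ _l : Fin n, 3 * T * n * M ^ 3 := Finset.sum_le_sum fun l _ => hpt l
    _ = _ := by simp; ring

end Controlled

end Drift

/-! ### Drift of the quadratic forms and of the squared orthogonal component -/

section QuadraticDrift

variable {n T : ℕ} {γ : Fin n → ℝ}

theorem Policy.step_pos_of_lt (P : Policy n T γ) (μ : Fin n → ℝ) (x : State n T) (ξ : Noise n)
    (h : (x.2.2 : ℕ) + 1 < T) : ((P.step μ x ξ).2.2 : ℕ) = x.2.2 + 1 := by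
  simp [Policy.step, h]

theorem Policy.step_pos_of_not_lt (P : Policy n T γ) (μ : Fin n → ℝ) (x : State n T)
    (ξ : Noise n) (h : ¬ (x.2.2 : ℕ) + 1 < T) : ((P.step μ x ξ).2.2 : ℕ) = 0 := by
  simp [Policy.step, h]

theorem dev_le_dev_add {θ M : ℝ} (hw : WeightBounds γ M) (hθ0 : 0 ≤ θ) (hθ1 : θ ≤ 1)
    (y v : Fin n → ℝ) : dev θ γ y ≤ dev θ γ (y + v) + 2 * M * n * l1 v := by
  have e : y = (y + v) + -v := by simp
  have h1 : dev θ γ y ≤ dev θ γ (y + v) + dev θ γ (-v) := by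
    conv_lhs => rw [e]
    exact dev_add_le _ _
  have h2 := hw.dev_le hθ0 hθ1 (-v)
  have h3 : l1 (-v) = l1 v := by simp [l1]
  rw [h3] at h2
  linarith

/-- Weight of the quadratic form in the Lyapunov function: decreasing along a cycle. -/
noncomputable def cycleWeight (K : ℝ) (x : State n T) : ℝ :=
  if (x.2.2 : ℕ) = 0 then 3 * K * T else 2 * K * (T - x.2.2)

namespace Controlled

variable {P : Policy n T γ} {μ : Fin n → ℝ} {a : Measure ℕ} {s : Measure (Fin n → ℕ)} {M ε : ℝ}
  (h : Controlled P μ a s M ε)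
include h

/-- The constant is `15 = 2 * 3 + 9`: twice the bound on the unused services, plus the square of the
increment bound `3 * n * M`. -/
theorem quad_add_noise_le {θ : ℝ} (hθ0 : 0 ≤ θ) (hθ1 : θ ≤ 1) (x : State n T) {k : ℕ}
    {m : Fin n → ℕ} (hk : (k : ℝ) ≤ n * M) (hm : ∀ l, (m l : ℝ) ≤ M) :
    quad θ γ (pred ((∑ l, μ l) - ε) μ x + (centred ((∑ l, μ l) - ε) μ x k m + unused x k m))
      ≤ quad θ γ (pred ((∑ l, μ l) - ε) μ x)
        + 2 * bil θ γ (pred ((∑ l, μ l) - ε) μ x) (centred ((∑ l, μ l) - ε) μ x k m)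
        + 15 * T * n ^ 2 * M ^ 3 := by
  have hM := h.weights.M_pos
  have h1 := h.bil_unused_le hθ0 hθ1 x k hm
  have h2 := h.weights.quad_le hθ0 (centred ((∑ l, μ l) - ε) μ x k m + unused x k m)
  have h3 := h.l1_centred_add_unused_le x hk hm
  have h4 : M * l1 (centred ((∑ l, μ l) - ε) μ x k m + unused x k m) ^ 2
      ≤ M * (3 * n * M) ^ 2 := by
    have := l1_nonneg (centred ((∑ l, μ l) - ε) μ x k m + unused x k m)
    gcongr
  have h5 : (n : ℝ) ^ 2 * M ^ 3 ≤ T * (n ^ 2 * M ^ 3) :=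
    le_mul_of_one_le_left (by positivity) h.one_le_T'
  rw [quad_add, bil_add_right]
  nlinarith

theorem integral_quad_of_lt {θ : ℝ} (hθ0 : 0 ≤ θ) (hθ1 : θ ≤ 1) (x : State n T)
    (hx : (x.2.2 : ℕ) + 1 < T) :
    ∫ z, quad θ γ (pred ((∑ l, μ l) - ε) μ z) ∂P.kernel μ a s x
      ≤ quad θ γ (pred ((∑ l, μ l) - ε) μ x) + 15 * T * n ^ 2 * M ^ 3 := by
  have := h.probNoise
  set L := (∑ l, μ l) - ε
  have i1 := h.integrable x fun _ _ z => quad θ γ (pred L μ z)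
  have i2 := h.integrable x fun k m _ => 2 * bil θ γ (pred L μ x) (centred L μ x k m)
  rw [P.integral_kernel]
  calc _ ≤ ∫ ξ, (quad θ γ (pred L μ x) + 2 * bil θ γ (pred L μ x) (centred L μ x ξ.1 ξ.2.1)
          + 15 * T * n ^ 2 * M ^ 3) ∂noise a s := by
        refine integral_mono_ae i1 (((integrable_const _).add i2).add (integrable_const _)) ?_
        filter_upwards [h.ae_noise] with ξ hξ
        rw [P.pred_step_of_lt L μ x ξ hx]
        exact h.quad_add_noise_le hθ0 hθ1 x hξ.1 hξ.2
    _ = _ := by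
        rw [integral_add (by exact (integrable_const _).add i2) (integrable_const _),
          integral_add (integrable_const _) i2, integral_const_mul, h.integral_bil_centred]
        simp

/-- The new decision sees the actual queue, which differs from the old `pred` by one slot of bounded
noise; `dev` is transferred from one to the other. In `31 = 15 + 4 + 12` the terms come from the
noise, from the square of the cycle shift, and from this transfer, whose cost is absorbed by `κ ≤ T
/ n`. -/
theorem integral_quad_of_not_lt {θ κ : ℝ} (hθ0 : 0 ≤ θ) (hθ1 : θ ≤ 1) (hκ0 : 0 ≤ κ)
    (hκ1 : κ ≤ T / n)
    (hκ : ∀ (q : Fin n → ℕ) (η : Equiv.Perm (Fin n)),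
      Antitone (fun i => (q (η i) : ℝ) / γ (η i)) →
      ∫ w, bil θ γ (fun l => (q l : ℝ)) (cycleShift ((∑ l, μ l) - ε) μ (P.decide η μ w))
        ≤ -κ * dev θ γ (fun l => (q l : ℝ)))
    (x : State n T) (hx : ¬ (x.2.2 : ℕ) + 1 < T) :
    ∫ z, quad θ γ (pred ((∑ l, μ l) - ε) μ z) ∂P.kernel μ a s x
      ≤ quad θ γ (pred ((∑ l, μ l) - ε) μ x)
        - 2 * κ * dev θ γ (pred ((∑ l, μ l) - ε) μ x) + 31 * T ^ 2 * n ^ 2 * M ^ 3 := by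
  have := h.probNoise
  have := h.probArrival
  have := h.probService
  have hn := h.weights.one_le_n
  have hT := h.one_le_T'
  have hM := h.weights.one_le
  set L := (∑ l, μ l) - ε with hL
  let r : State n T → Fin n → ℝ := fun z l => (z.1 l : ℝ)
  have i1 := h.integrable x fun _ _ z => quad θ γ (pred L μ z)
  have i2 := h.integrable x fun k m _ => 2 * bil θ γ (pred L μ x) (centred L μ x k m)
  have i3 := h.integrable x fun _ _ z => 2 * bil θ γ (r z) (cycleShift L μ z.2.1)
  have i4 := h.integrable x fun _ _ z => -κ * dev θ γ (r z)
  set A := quad θ γ (pred L μ x) + 15 * T * n ^ 2 * M ^ 3 + 4 * T ^ 2 * n ^ 2 * M ^ 3 with hA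
  have hdrift : ∫ ξ, bil θ γ (r (P.step μ x ξ)) (cycleShift L μ (P.step μ x ξ).2.1) ∂noise a s
      ≤ -κ * (dev θ γ (pred L μ x) - 6 * n ^ 2 * M ^ 2) := by
    calc _ ≤ ∫ ξ, -κ * dev θ γ (r (P.step μ x ξ)) ∂noise a s :=
          h.laws.integral_decide_le P h.weights.γ_pos μ x hx
            (fun q d => bil θ γ (fun l => (q l : ℝ)) (cycleShift L μ d))
            (fun q => -κ * dev θ γ fun l => (q l : ℝ)) hκ
      _ ≤ ∫ _ξ : Noise n, -κ * (dev θ γ (pred L μ x) - 6 * n ^ 2 * M ^ 2) ∂noise a s := by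
          refine integral_mono_ae i4 (integrable_const _) ?_
          filter_upwards [h.ae_noise] with ξ hξ
          have e : r (P.step μ x ξ) = _ := P.queue_step_of_not_lt L μ x ξ hx
          have h1 := dev_le_dev_add h.weights hθ0 hθ1 (pred L μ x)
            (centred L μ x ξ.1 ξ.2.1 + unused x ξ.1 ξ.2.1)
          have h2 := h.l1_centred_add_unused_le x hξ.1 hξ.2
          have h3 : 2 * M * n * l1 (centred L μ x ξ.1 ξ.2.1 + unused x ξ.1 ξ.2.1)
              ≤ 2 * M * n * (3 * n * M) := by gcongr
          simp only [e]
          rw [neg_mul, neg_mul, neg_le_neg_iff]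
          refine mul_le_mul_of_nonneg_left ?_ hκ0
          nlinarith
      _ = _ := by simp
  rw [P.integral_kernel]
  calc _ ≤ ∫ ξ, (A + 2 * bil θ γ (pred L μ x) (centred L μ x ξ.1 ξ.2.1)
          + 2 * bil θ γ (r (P.step μ x ξ)) (cycleShift L μ (P.step μ x ξ).2.1)) ∂noise a s := by
        refine integral_mono_ae i1 (((integrable_const _).add i2).add i3) ?_
        filter_upwards [h.ae_noise] with ξ hξ
        have e : r (P.step μ x ξ) = _ := P.queue_step_of_not_lt L μ x ξ hx
        have h1 := h.quad_add_noise_le hθ0 hθ1 x hξ.1 hξ.2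
        rw [← hL, ← e] at h1
        have h2 := h.weights.quad_le hθ0 (cycleShift L μ (P.step μ x ξ).2.1)
        have h3 : M * l1 (cycleShift L μ (P.step μ x ξ).2.1) ^ 2 ≤ M * (2 * T * n * M) ^ 2 := by
          have := l1_nonneg (cycleShift L μ (P.step μ x ξ).2.1)
          have := h.l1_cycleShift_le (P.step μ x ξ).2.1
          gcongr
        rw [P.pred_step_of_not_lt L μ x ξ hx, show (fun l => ((P.step μ x ξ).1 l : ℝ))
          = r (P.step μ x ξ) from rfl, quad_add]
        linarith
    _ = A + 2 * ∫ ξ, bil θ γ (r (P.step μ x ξ)) (cycleShift L μ (P.step μ x ξ).2.1) ∂noise a s := by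
        rw [integral_add (by exact (integrable_const _).add i2) i3,
          integral_add (integrable_const _) i2, integral_const_mul, integral_const_mul,
          h.integral_bil_centred]
        simp
    _ ≤ A + 2 * (-κ * (dev θ γ (pred L μ x) - 6 * n ^ 2 * M ^ 2)) := by gcongr
    _ ≤ _ := by
        have h1 : κ * (n ^ 2 * M ^ 2) ≤ T * n * M ^ 2 := by
          calc κ * (n ^ 2 * M ^ 2) ≤ T / n * (n ^ 2 * M ^ 2) := by gcongr
            _ = _ := by field_simp
        have h2 : (T : ℝ) * n * M ^ 2 ≤ T ^ 2 * n ^ 2 * M ^ 3 := by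
          have : (1 : ℝ) ≤ T * n * M := one_le_mul_of_one_le_of_one_le
            (one_le_mul_of_one_le_of_one_le hT hn) hM
          calc (T : ℝ) * n * M ^ 2 ≤ T * n * M ^ 2 * (T * n * M) :=
                le_mul_of_one_le_right (by positivity) this
            _ = _ := by ring
        have h3 : (T : ℝ) * (n ^ 2 * M ^ 3) ≤ T ^ 2 * (n ^ 2 * M ^ 3) := by
          gcongr; nlinarith
        rw [hA]
        linarith

/-- Second-order expansion of the squared quadratic form for increments bounded by `R`. -/
theorem integral_quad_sq_le (x : State n T) {R : ℝ}
    (hR : ∀ᵐ ξ ∂noise a s, l1 (pred ((∑ l, μ l) - ε) μ (P.step μ x ξ)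
      - pred ((∑ l, μ l) - ε) μ x) ≤ R) :
    ∫ z, quad 1 γ (pred ((∑ l, μ l) - ε) μ z) ^ 2 ∂P.kernel μ a s x
      ≤ quad 1 γ (pred ((∑ l, μ l) - ε) μ x) ^ 2
        + 2 * quad 1 γ (pred ((∑ l, μ l) - ε) μ x)
          * (∫ z, quad 1 γ (pred ((∑ l, μ l) - ε) μ z) ∂P.kernel μ a s x
            - quad 1 γ (pred ((∑ l, μ l) - ε) μ x))
        + (8 * M * R ^ 2 * quad 1 γ (pred ((∑ l, μ l) - ε) μ x) + 2 * M ^ 2 * R ^ 4) := by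
  have := h.probNoise
  have hM := h.weights.M_pos
  set L := (∑ l, μ l) - ε
  set H := quad 1 γ (pred L μ x) with hH
  have hH0 : 0 ≤ H := h.weights.quad_one_nonneg _
  set C := 8 * M * R ^ 2 * H + 2 * M ^ 2 * R ^ 4
  have i1 := h.integrable x fun _ _ z => quad 1 γ (pred L μ z) ^ 2
  have i2 := h.integrable x fun _ _ z => 2 * H * quad 1 γ (pred L μ z)
  rw [P.integral_kernel, P.integral_kernel]
  calc _ ≤ ∫ ξ, ((C - H ^ 2) + 2 * H * quad 1 γ (pred L μ (P.step μ x ξ))) ∂noise a s := by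
        refine integral_mono_ae i1 ((integrable_const _).add i2) ?_
        filter_upwards [hR] with ξ hξ
        set v := pred L μ (P.step μ x ξ) - pred L μ x with hv
        have e : pred L μ (P.step μ x ξ) = pred L μ x + v := by rw [hv]; abel
        have hl := l1_nonneg v
        have h1 := h.weights.bil_one_sq_le (pred L μ x) v
        have h2 := h.weights.quad_le zero_le_one v
        have h3 := h.weights.quad_one_nonneg v
        have h4 : M * H * l1 v ^ 2 ≤ M * H * R ^ 2 := by gcongr
        have h5 : quad 1 γ v ^ 2 ≤ (M * R ^ 2) ^ 2 := by
          have : M * l1 v ^ 2 ≤ M * R ^ 2 := by gcongr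
          exact pow_le_pow_left₀ h3 (h2.trans this) 2
        rw [e, quad_add, ← hH]
        rw [← hH] at h1
        -- With increment `2 * b + q` of the form, `(2 * b + q) ^ 2 ≤ 8 * b ^ 2 + 2 * q ^ 2`; the
        -- first-order term is kept exactly.
        nlinarith [sq_nonneg (2 * bil 1 γ (pred L μ x) v - quad 1 γ v)]
    _ = _ := by
        rw [integral_add (integrable_const _) i2, integral_const_mul]
        simp
        ring

theorem l1_pred_step_sub_le_of_lt (x : State n T) (hx : (x.2.2 : ℕ) + 1 < T) :
    ∀ᵐ ξ ∂noise a s, l1 (pred ((∑ l, μ l) - ε) μ (P.step μ x ξ)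
      - pred ((∑ l, μ l) - ε) μ x) ≤ 3 * n * M := by
  filter_upwards [h.ae_noise] with ξ hξ
  rw [P.pred_step_of_lt _ μ x ξ hx, add_sub_cancel_left]
  exact h.l1_centred_add_unused_le x hξ.1 hξ.2

theorem l1_pred_step_sub_le_of_not_lt (x : State n T) (hx : ¬ (x.2.2 : ℕ) + 1 < T) :
    ∀ᵐ ξ ∂noise a s, l1 (pred ((∑ l, μ l) - ε) μ (P.step μ x ξ)
      - pred ((∑ l, μ l) - ε) μ x) ≤ 5 * T * n * M := by
  filter_upwards [h.ae_noise] with ξ hξ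
  rw [P.pred_step_of_not_lt _ μ x ξ hx, P.queue_step_of_not_lt _ μ x ξ hx, add_assoc,
    add_sub_cancel_left]
  have h1 := l1_add_le (centred ((∑ l, μ l) - ε) μ x ξ.1 ξ.2.1 + unused x ξ.1 ξ.2.1)
    (cycleShift ((∑ l, μ l) - ε) μ (P.step μ x ξ).2.1)
  have h2 := h.l1_centred_add_unused_le x hξ.1 hξ.2
  have h3 := h.l1_cycleShift_le (P.step μ x ξ).2.1
  have hM := h.weights.M_pos
  have h4 : (n : ℝ) * M ≤ T * (n * M) := le_mul_of_one_le_left (by positivity) h.one_le_T'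
  linarith

/-- Inside a cycle `H ^ 2` may grow by about `K * H`, where `102 = 30 + 72` collects the first-order
term and the square of the increment. The decrease of `cycleWeight` pays for this growth and for the
term `K * H` on the left (`K * T * H` at position `0`). -/
theorem perp_drift_of_lt (x : State n T) (hx : (x.2.2 : ℕ) + 1 < T) {K : ℝ}
    (hK : K = 102 * T * n ^ 2 * M ^ 3) :
    ∫ z, (quad 1 γ (pred ((∑ l, μ l) - ε) μ z) ^ 2
        + cycleWeight K z * quad 1 γ (pred ((∑ l, μ l) - ε) μ z)) ∂P.kernel μ a s x
      + K * (if (x.2.2 : ℕ) = 0 then (T : ℝ) else 1) * quad 1 γ (pred ((∑ l, μ l) - ε) μ x)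
      ≤ (quad 1 γ (pred ((∑ l, μ l) - ε) μ x) ^ 2
        + cycleWeight K x * quad 1 γ (pred ((∑ l, μ l) - ε) μ x))
        + 3222 * T ^ 3 * n ^ 4 * M ^ 6 := by
  have hn := h.weights.one_le_n
  have hT := h.one_le_T'
  have hM := h.weights.one_le
  have hsq := h.integral_quad_sq_le x (h.l1_pred_step_sub_le_of_lt x hx)
  have hlin := h.integral_quad_of_lt zero_le_one le_rfl x hx
  set L := (∑ l, μ l) - ε
  set H := quad 1 γ (pred L μ x) with hH
  have hH0 : 0 ≤ H := h.weights.quad_one_nonneg _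
  set E := ∫ z, quad 1 γ (pred L μ z) ∂P.kernel μ a s x with hE
  have hK0 : 0 < K := by rw [hK]; positivity
  set c := 2 * K * (T - (x.2.2 + 1 : ℝ)) with hc
  have hxT : (x.2.2 : ℝ) + 1 ≤ T := by exact_mod_cast hx.le
  have hc0 : 0 ≤ c := by
    rw [hc]; exact mul_nonneg (by linarith) (by linarith)
  have hcT : c ≤ 2 * K * T := by
    rw [hc]
    have : (0 : ℝ) ≤ (x.2.2 : ℕ) := Nat.cast_nonneg _
    have : K * ((x.2.2 : ℝ) + 1) ≥ 0 := by positivity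
    linarith
  have e1 : ∫ z, (quad 1 γ (pred L μ z) ^ 2 + cycleWeight K z * quad 1 γ (pred L μ z))
        ∂P.kernel μ a s x
      = ∫ z, quad 1 γ (pred L μ z) ^ 2 ∂P.kernel μ a s x + c * E := by
    rw [hE, P.integral_kernel, P.integral_kernel, P.integral_kernel, ← integral_const_mul,
      ← integral_add (h.integrable x fun _ _ z => quad 1 γ (pred L μ z) ^ 2)
        (h.integrable x fun _ _ z => c * quad 1 γ (pred L μ z))]
    refine integral_congr_ae (ae_of_all _ fun ξ => ?_)
    have hp := P.step_pos_of_lt μ x ξ hx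
    simp only [cycleWeight, hp]
    rw [if_neg (by omega)]
    push_cast
    rw [hc]
  -- From position `0` the weight falls by `3 * K * T - 2 * K * (T - 1)`, at least `K + K * T`; from
  -- later positions it falls by `2 * K`.
  have hw : c + (K + K * (if (x.2.2 : ℕ) = 0 then (T : ℝ) else 1)) ≤ cycleWeight K x := by
    rw [cycleWeight, hc]
    split_ifs with h0
    · rw [h0]; push_cast; nlinarith
    · nlinarith
  have h1 : 2 * H * (E - H) ≤ 2 * H * (15 * T * n ^ 2 * M ^ 3) := by
    gcongr; linarith
  have h2 : c * E ≤ c * (H + 15 * T * n ^ 2 * M ^ 3) := by gcongr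
  have h3 : c * (15 * T * n ^ 2 * M ^ 3) ≤ 2 * K * T * (15 * T * n ^ 2 * M ^ 3) := by gcongr
  have h4 : (c + (K + K * (if (x.2.2 : ℕ) = 0 then (T : ℝ) else 1))) * H ≤ cycleWeight K x * H := by
    gcongr
  have h5 : (n : ℝ) ^ 2 * M ^ 3 * H ≤ T * (n ^ 2 * M ^ 3 * H) :=
    le_mul_of_one_le_left (by positivity) hT
  have h6 : (n : ℝ) ^ 4 * M ^ 6 ≤ T ^ 3 * (n ^ 4 * M ^ 6) :=
    le_mul_of_one_le_left (by positivity) (one_le_pow₀ hT)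
  have h7 : K * H = 102 * (T * (n ^ 2 * M ^ 3 * H)) := by rw [hK]; ring
  have h8 : 2 * K * T * (15 * T * n ^ 2 * M ^ 3) = 3060 * (T ^ 3 * (n ^ 4 * M ^ 6)) := by
    rw [hK]; ring
  rw [e1]
  ring_nf at *
  linarith

theorem kappa_one (q : Fin n → ℕ) (η : Equiv.Perm (Fin n))
    (hη : Antitone fun i => (q (η i) : ℝ) / γ (η i)) :
    ∫ w, bil 1 γ (fun l => (q l : ℝ)) (cycleShift ((∑ l, μ l) - ε) μ (P.decide η μ w))
        ≤ -(T / (2 * M * n)) * dev 1 γ (fun l => (q l : ℝ)) := by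
  have hn := h.weights.one_le_n
  have hM := h.weights.M_pos
  have e : 1 / M = 2 * (1 / (2 * M)) := by field_simp
  have h0 : 0 < 1 / (2 * M) := by positivity
  have h1 := P.integral_bil_one_le h.weights h.one_le_T h.eps_pos.le
    (by linarith [h.eps_le] : ε ≤ 1 / M) h.gap (fun l => (q l : ℝ)) η hη
  refine h1.trans (mul_le_mul_of_nonneg_right (neg_le_neg ?_) (dev_nonneg _))
  calc (T : ℝ) / (2 * M * n) = T * (1 / (2 * M)) / n := by field_simp
    _ ≤ T * (1 / M - ε) / n := by
        gcongr
        linarith [h.eps_le]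

/-- At the end of a cycle the weight jumps back to `3 * K * T`. All terms linear in `H` are
compensated by the drift `-4 * κ * G * H` of `H ^ 2`, which is of order `H ^ (3/2)` because `H ≤ M *
G ^ 2`. -/
theorem perp_drift_of_not_lt (x : State n T) (hx : ¬ (x.2.2 : ℕ) + 1 < T) {K : ℝ}
    (hK : K = 102 * T * n ^ 2 * M ^ 3) :
    ∫ z, (quad 1 γ (pred ((∑ l, μ l) - ε) μ z) ^ 2
        + cycleWeight K z * quad 1 γ (pred ((∑ l, μ l) - ε) μ z)) ∂P.kernel μ a s x
      + K * (if (x.2.2 : ℕ) = 0 then (T : ℝ) else 1) * quad 1 γ (pred ((∑ l, μ l) - ε) μ x)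
      ≤ (quad 1 γ (pred ((∑ l, μ l) - ε) μ x) ^ 2
        + cycleWeight K x * quad 1 γ (pred ((∑ l, μ l) - ε) μ x))
        + 76000000 * T ^ 4 * n ^ 8 * M ^ 12 := by
  have hn := h.weights.one_le_n
  have hT := h.one_le_T'
  have hM := h.weights.one_le
  have hM0 := h.weights.M_pos
  have hsq := h.integral_quad_sq_le x (h.l1_pred_step_sub_le_of_not_lt x hx)
  have hκ1 : (T : ℝ) / (2 * M * n) ≤ T / n := by
    gcongr
    nlinarith
  have hlin := h.integral_quad_of_not_lt zero_le_one le_rfl (by positivity) hκ1 h.kappa_one x hx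
  set L := (∑ l, μ l) - ε
  set H := quad 1 γ (pred L μ x) with hH
  have hH0 : 0 ≤ H := h.weights.quad_one_nonneg _
  set G := dev 1 γ (pred L μ x) with hG
  have hG0 : 0 ≤ G := dev_nonneg _
  have hHG : H ≤ M * G ^ 2 := h.weights.quad_one_le_dev _
  set E := ∫ z, quad 1 γ (pred L μ z) ∂P.kernel μ a s x with hE
  set κ : ℝ := T / (2 * M * n) with hκ
  have hκ0 : 0 < κ := by positivity
  have hK0 : 0 < K := by rw [hK]; positivity
  set X : ℝ := T ^ 2 * n ^ 2 * M ^ 3 with hX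
  have hX0 : 0 < X := by positivity
  have hKX : K * T = 102 * X := by rw [hK, hX]; ring
  have e1 : ∫ z, (quad 1 γ (pred L μ z) ^ 2 + cycleWeight K z * quad 1 γ (pred L μ z))
        ∂P.kernel μ a s x
      = ∫ z, quad 1 γ (pred L μ z) ^ 2 ∂P.kernel μ a s x + 306 * X * E := by
    rw [hE, P.integral_kernel, P.integral_kernel, P.integral_kernel, ← integral_const_mul,
      ← integral_add (h.integrable x fun _ _ z => quad 1 γ (pred L μ z) ^ 2)
        (h.integrable x fun _ _ z => 306 * X * quad 1 γ (pred L μ z))]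
    refine integral_congr_ae (ae_of_all _ fun ξ => ?_)
    have hp := P.step_pos_of_not_lt μ x ξ hx
    simp only [cycleWeight, hp, if_true]
    rw [show 3 * K * T = 306 * X by linarith]
  have hf : K * (if (x.2.2 : ℕ) = 0 then (T : ℝ) else 1) ≤ 102 * X := by
    rw [← hKX]
    gcongr
    split_ifs <;> linarith
  have hw : 0 ≤ cycleWeight K x * H := by
    refine mul_nonneg ?_ hH0
    have : ((x.2.2 : ℕ) : ℝ) ≤ T := by exact_mod_cast x.2.2.isLt.le
    rw [cycleWeight]
    split_ifs
    · positivity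
    · exact mul_nonneg (by linarith) (by linarith)
  have hE' : E ≤ H - 2 * κ * G + 31 * X := by rw [hX]; linarith
  have h1 : 2 * H * (E - H) ≤ 2 * H * (31 * X - 2 * κ * G) :=
    mul_le_mul_of_nonneg_left (by linarith) (by linarith)
  have h2 : 306 * X * E ≤ 306 * X * (H + 31 * X) := by
    have : 0 ≤ 2 * κ * G := by positivity
    exact mul_le_mul_of_nonneg_left (by linarith) (by positivity)
  have h3 : K * (if (x.2.2 : ℕ) = 0 then (T : ℝ) else 1) * H ≤ 102 * X * H := by gcongr
  have e2 : 8 * M * (5 * T * n * M) ^ 2 * H = 200 * X * H := by rw [hX]; ring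
  have e3 : 2 * M ^ 2 * (5 * T * n * M) ^ 4 = 1250 * X ^ 2 := by rw [hX]; ring
  have hXκ : X ^ 3 * M = 4 * (T ^ 4 * n ^ 8 * M ^ 12) * κ ^ 2 := by
    rw [hX, hκ]; field_simp; ring
  have hX2 : X ^ 2 ≤ T ^ 4 * n ^ 8 * M ^ 12 := by
    have : (n : ℝ) ^ 4 * M ^ 6 ≤ n ^ 8 * M ^ 12 := by
      gcongr <;> first | assumption | norm_num
    calc X ^ 2 = T ^ 4 * (n ^ 4 * M ^ 6) := by rw [hX]; ring
      _ ≤ T ^ 4 * (n ^ 8 * M ^ 12) := by gcongr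
      _ = _ := by ring
  set W : ℝ := T ^ 4 * n ^ 8 * M ^ 12 with hW
  -- Here `670 = 62 + 200 + 306 + 102`: first-order term, squared increment, restored weight, and
  -- the term on the left. Either the drift dominates, or `κ * G` is at most `335 / 2 * X`, whence
  -- `H` is bounded and `X * H` is at most a multiple of `X ^ 3 * M / κ ^ 2 = 4 * W`.
  have key : 670 * X * H - 4 * κ * G * H ≤ 75190750 * W := by
    by_cases hc : 670 * X ≤ 4 * κ * G
    · have : 670 * X * H ≤ 4 * κ * G * H := by gcongr
      have : 0 ≤ W := by positivity
      linarith
    · push Not at hc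
      have hκG : κ ^ 2 * H ≤ M * (335 / 2 * X) ^ 2 := by
        calc κ ^ 2 * H ≤ κ ^ 2 * (M * G ^ 2) := by gcongr
          _ = M * (κ * G) ^ 2 := by ring
          _ ≤ _ := by
              have : κ * G ≤ 335 / 2 * X := by linarith
              gcongr
      have h4 : κ ^ 2 * (670 * X * H) ≤ κ ^ 2 * (75190750 * W) := by
        calc κ ^ 2 * (670 * X * H) = 670 * X * (κ ^ 2 * H) := by ring
          _ ≤ 670 * X * (M * (335 / 2 * X) ^ 2) := by gcongr
          _ = 670 * (335 / 2) ^ 2 * (X ^ 3 * M) := by ring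
          _ = κ ^ 2 * (75190750 * W) := by rw [hXκ]; ring
      have h5 := le_of_mul_le_mul_left h4 (by positivity)
      have : 0 ≤ 4 * κ * G * H := by positivity
      linarith
  rw [e1]
  have hfin : 76000000 * T ^ 4 * n ^ 8 * M ^ 12 = 76000000 * W := by rw [hW]; ring
  rw [hfin]
  rw [e2, e3] at hsq
  have hW0 : 0 ≤ W := by positivity
  linarith

end Controlled

end QuadraticDrift

/-! ### Existence of a steady state, integrability, and state space collapse -/

section SteadyState

variable {n T : ℕ} {γ : Fin n → ℝ}

/-- Total queue length. -/
noncomputable def total (x : State n T) : ℝ := ∑ l, (x.1 l : ℝ)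

theorem total_nonneg (x : State n T) : 0 ≤ total x := Finset.sum_nonneg fun _ _ => Nat.cast_nonneg _

theorem Policy.total_step (P : Policy n T γ) (μ : Fin n → ℝ) (x : State n T) (ξ : Noise n) :
    total (P.step μ x ξ)
      = total x + (ξ.1 - ∑ l, (ξ.2.1 l : ℝ)) + ∑ l, unused x ξ.1 ξ.2.1 l := by
  unfold total
  rw [Finset.sum_congr rfl fun l _ => P.step_queue_eq μ x ξ l, Finset.sum_add_distrib,
    Finset.sum_sub_distrib, Finset.sum_add_distrib, Finset.sum_ite_eq']
  simp
  ring

theorem Policy.total_step_le (P : Policy n T γ) (μ : Fin n → ℝ) (x : State n T) (ξ : Noise n) :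
    total (P.step μ x ξ) ≤ total x + ξ.1 := by
  rw [P.total_step]
  have : ∑ l, unused x ξ.1 ξ.2.1 l ≤ ∑ l, (ξ.2.1 l : ℝ) :=
    Finset.sum_le_sum fun l _ => unused_le _ _ _ _
  linarith

theorem finite_total_lt (r : ℝ) : {x : State n T | total x < r}.Finite := by
  have hB : ((Set.Iic fun _ : Fin n => ⌈r⌉₊) ×ˢ
      (Set.univ : Set ((Fin T → Fin n) × Fin T))).Finite := (Set.finite_Iic _).prod Set.finite_univ
  refine hB.subset fun x hx => ⟨fun l => ?_, trivial⟩
  have h1 : (x.1 l : ℝ) ≤ total x :=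
    Finset.single_le_sum (f := fun l => (x.1 l : ℝ)) (fun _ _ => Nat.cast_nonneg _)
      (Finset.mem_univ l)
  have h2 : (x.1 l : ℝ) ≤ ⌈r⌉₊ := (h1.trans (le_of_lt hx)).trans (Nat.le_ceil r)
  exact_mod_cast h2

theorem integrable_position {π : Measure (State n T)} [IsFiniteMeasure π] (F : ℕ → ℝ) :
    Integrable (fun x : State n T => F x.2.2) π := by
  obtain ⟨C, hC⟩ := (Set.finite_range fun j : Fin T => ‖F j‖).bddAbove
  exact Integrable.of_bound (Measurable.of_discrete).aestronglyMeasurable C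
    (ae_of_all _ fun x => hC ⟨x.2.2, rfl⟩)

namespace Controlled

variable {P : Policy n T γ} {μ : Fin n → ℝ} {a : Measure ℕ} {s : Measure (Fin n → ℕ)} {M ε : ℝ}
  (h : Controlled P μ a s M ε)
include h

theorem integral_total_le (x : State n T) :
    ∫ z, total z ∂P.kernel μ a s x ≤ total x + n * M := by
  have := h.probNoise
  rw [P.integral_kernel]
  calc _ ≤ ∫ _ξ : Noise n, (total x + n * M) ∂noise a s := by
        refine integral_mono_ae (h.integrable x fun _ _ z => total z) (integrable_const _) ?_
        filter_upwards [h.ae_noise] with ξ hξ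
        linarith [P.total_step_le μ x ξ, hξ.1]
    _ = _ := by simp

theorem kappa_zero (q : Fin n → ℕ) (η : Equiv.Perm (Fin n))
    (hη : Antitone fun i => (q (η i) : ℝ) / γ (η i)) :
    ∫ w, bil 0 γ (fun l => (q l : ℝ)) (cycleShift ((∑ l, μ l) - ε) μ (P.decide η μ w))
        ≤ -(T * ε / n) * dev 0 γ (fun l => (q l : ℝ)) := by
  have hM := h.weights.M_pos
  have e : 1 / M = 2 * (1 / (2 * M)) := by field_simp
  have h0 : 0 < 1 / (2 * M) := by positivity
  exact P.integral_bil_zero_le h.weights h.one_le_T h.eps_pos.le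
    (by linarith [h.eps_le] : ε ≤ 1 / M) h.gap (fun l => (q l : ℝ))
    (fun l => Nat.cast_nonneg _) η hη

theorem total_le_dev (x : State n T) :
    total x - T ≤ M * dev 0 γ (pred ((∑ l, μ l) - ε) μ x) := by
  have h1 := h.sum_pred_ge x
  have h2 : (T : ℝ) * ε ≤ T * 1 := by gcongr; exact h.eps_le_one
  have h3 : ∑ l, pred ((∑ l, μ l) - ε) μ x l ≤ M * dev 0 γ (pred ((∑ l, μ l) - ε) μ x) := by
    rw [dev, Finset.mul_sum]
    refine Finset.sum_le_sum fun l _ => ?_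
    have h4 := h.weights.γ_pos l
    simp only [tilt, zero_mul, sub_zero, abs_div, abs_of_pos h4]
    rw [← mul_div_assoc, le_div_iff₀ h4]
    calc _ ≤ |pred ((∑ l, μ l) - ε) μ x l| * γ l := by gcongr; exact le_abs_self _
      _ ≤ |pred ((∑ l, μ l) - ε) μ x l| * M := by gcongr; exact h.weights.upper l
      _ = _ := mul_comm _ _
  unfold total
  linarith

/-- The form with `θ = 0` gains only at the end of a cycle, by a multiple of `T * c * total`. The
extra term `c * (T - j) * total` spreads this gain over the slots: its weight drops by `c` in each
slot of the cycle and is restored to `c * T` at the end. -/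
theorem total_drift (x : State n T) {c : ℝ} (hc : c = ε / (n * M)) :
    ∫ z, (quad 0 γ (pred ((∑ l, μ l) - ε) μ z) + c * (T - z.2.2) * total z) ∂P.kernel μ a s x
      + c * total x
      ≤ (quad 0 γ (pred ((∑ l, μ l) - ε) μ x) + c * (T - x.2.2) * total x)
        + 34 * T ^ 2 * n ^ 2 * M ^ 3 := by
  have hn := h.weights.one_le_n
  have hT := h.one_le_T'
  have hM := h.weights.one_le
  have hε := h.eps_pos
  have hnM : (1 : ℝ) ≤ n * M := one_le_mul_of_one_le_of_one_le hn hM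
  have hc0 : 0 < c := by rw [hc]; positivity
  have hc1 : c ≤ 1 := by
    rw [hc, div_le_one (by positivity)]; linarith [h.eps_le_one]
  have htot := h.integral_total_le x
  have htx := total_nonneg x
  have hlt := h.integral_quad_of_lt le_rfl zero_le_one x
  have hκ1 : (T : ℝ) * ε / n ≤ T / n := by
    gcongr; nlinarith [h.eps_le_one]
  have hnlt := h.integral_quad_of_not_lt le_rfl zero_le_one (by positivity) hκ1 h.kappa_zero x
  have hdev := h.total_le_dev x
  set L := (∑ l, μ l) - ε
  set H := quad 0 γ (pred L μ x) with hH
  set E := ∫ z, quad 0 γ (pred L μ z) ∂P.kernel μ a s x with hE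
  set t := ∫ z, total z ∂P.kernel μ a s x with ht
  have e1 : ∀ b : ℝ, (∀ ξ, c * (T - ((P.step μ x ξ).2.2 : ℕ)) = b) →
      ∫ z, (quad 0 γ (pred L μ z) + c * (T - z.2.2) * total z) ∂P.kernel μ a s x
        = E + b * t := by
    intro b hb
    rw [hE, ht, P.integral_kernel, P.integral_kernel, P.integral_kernel, ← integral_const_mul,
      ← integral_add (h.integrable x fun _ _ z => quad 0 γ (pred L μ z))
        (h.integrable x fun _ _ z => b * total z)]
    refine integral_congr_ae (ae_of_all _ fun ξ => ?_)
    simp only [hb ξ]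
  have hA : (T : ℝ) * (n * M) ≤ T ^ 2 * n ^ 2 * M ^ 3 := by
    have h1 : (1 : ℝ) ≤ (T * n) * M ^ 2 :=
      one_le_mul_of_one_le_of_one_le (one_le_mul_of_one_le_of_one_le hT hn) (one_le_pow₀ hM)
    calc (T : ℝ) * (n * M) ≤ T * (n * M) * ((T * n) * M ^ 2) :=
          le_mul_of_one_le_right (by positivity) h1
      _ = _ := by ring
  have hA2 : (T : ℝ) ^ 2 ≤ T ^ 2 * n ^ 2 * M ^ 3 := by
    have h1 : (1 : ℝ) ≤ n ^ 2 * M ^ 3 :=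
      one_le_mul_of_one_le_of_one_le (one_le_pow₀ hn) (one_le_pow₀ hM)
    calc (T : ℝ) ^ 2 ≤ T ^ 2 * (n ^ 2 * M ^ 3) := le_mul_of_one_le_right (by positivity) h1
      _ = _ := by ring
  have hA3 : c * T * (n * M) ≤ T * (n * M) := by
    calc c * T * (n * M) = c * (T * (n * M)) := by ring
      _ ≤ 1 * (T * (n * M)) := by gcongr
      _ = _ := one_mul _
  have hY0 : (0 : ℝ) ≤ T ^ 2 * n ^ 2 * M ^ 3 := by positivity
  have hct : 0 ≤ c * total x := mul_nonneg hc0.le htx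
  by_cases hx : (x.2.2 : ℕ) + 1 < T
  · have hxT : (x.2.2 : ℝ) + 1 ≤ T := by exact_mod_cast hx.le
    have hj : (0 : ℝ) ≤ (x.2.2 : ℕ) := Nat.cast_nonneg _
    rw [e1 (c * (T - ((x.2.2 : ℕ) + 1))) fun ξ => by rw [P.step_pos_of_lt μ x ξ hx]; push_cast; rfl]
    have h1 := hlt hx
    have h2 : c * (T - ((x.2.2 : ℕ) + 1)) * t ≤ c * (T - ((x.2.2 : ℕ) + 1)) * (total x + n * M) := by
      have : 0 ≤ c * ((T : ℝ) - ((x.2.2 : ℕ) + 1)) := mul_nonneg hc0.le (by linarith)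
      exact mul_le_mul_of_nonneg_left htot this
    have h3 : c * (T - ((x.2.2 : ℕ) + 1)) * (n * M) ≤ c * T * (n * M) := by
      have : c * ((T : ℝ) - ((x.2.2 : ℕ) + 1)) ≤ c * T :=
        mul_le_mul_of_nonneg_left (by linarith) hc0.le
      exact mul_le_mul_of_nonneg_right this (by positivity)
    have h4 : (T : ℝ) * (n ^ 2 * M ^ 3) ≤ T ^ 2 * (n ^ 2 * M ^ 3) := by
      gcongr; nlinarith
    linarith
  · have hj : (x.2.2 : ℝ) + 1 = T := by
      have : (x.2.2 : ℕ) + 1 = T := by have := x.2.2.isLt; omega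
      exact_mod_cast this
    rw [e1 (c * T) fun ξ => by rw [P.step_pos_of_not_lt μ x ξ hx]; simp]
    have h1 := hnlt hx
    have h2 : c * T * t ≤ c * T * (total x + n * M) := by gcongr
    have h3 : (T : ℝ) * c * (total x - T) ≤ T * ε / n * dev 0 γ (pred L μ x) := by
      calc (T : ℝ) * c * (total x - T) ≤ T * c * (M * dev 0 γ (pred L μ x)) := by gcongr
        _ = _ := by rw [hc]; field_simp
    have h4 : c * (T : ℝ) ^ 2 ≤ T ^ 2 := mul_le_of_le_one_left (by positivity) hc1
    have h5 : c * total x ≤ c * T * total x := by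
      have : c ≤ c * T := le_mul_of_one_le_right hc0.le hT
      gcongr
    have h6 : c * (T - (x.2.2 : ℕ)) * total x = c * total x := by
      rw [← hj]; ring
    rw [h6]
    linarith

theorem lyapunov_nonneg {c : ℝ} (hc : 0 ≤ c) (x : State n T) :
    0 ≤ quad 0 γ (pred ((∑ l, μ l) - ε) μ x) + c * (T - x.2.2) * total x := by
  have h1 := h.weights.quad_nonneg zero_le_one (pred ((∑ l, μ l) - ε) μ x)
  have h2 : (x.2.2 : ℝ) ≤ T := by exact_mod_cast x.2.2.isLt.le
  have h3 := total_nonneg x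
  have : 0 ≤ c * (T - x.2.2) * total x := mul_nonneg (mul_nonneg hc (by linarith)) h3
  linarith

theorem exists_steadyState : ∃ π, P.IsSteadyState μ a s π := by
  have := h.markov
  have := h.state_nonempty
  have hn := h.weights.one_le_n
  have hM := h.weights.M_pos
  have hε := h.eps_pos
  have hc0 : 0 < ε / (n * M) := by positivity
  have hV := h.lyapunov_nonneg hc0.le
  refine exists_invariant_of_drift (P.kernel μ a s)
    (V := fun x => ENNReal.ofReal (quad 0 γ (pred ((∑ l, μ l) - ε) μ x)
      + ε / (n * M) * (T - x.2.2) * total x))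
    (f := fun x => ENNReal.ofReal (ε / (n * M) * total x))
    (c := ENNReal.ofReal (34 * T ^ 2 * n ^ 2 * M ^ 3)) ENNReal.ofReal_ne_top
    (fun x => ENNReal.ofReal_ne_top) (fun x => ?_) fun r => ?_
  · rw [← ofReal_integral_eq_lintegral_ofReal (h.integrable_kernel x _) (ae_of_all _ hV),
      ← ENNReal.ofReal_add (integral_nonneg hV) (mul_nonneg hc0.le (total_nonneg x)),
      ← ENNReal.ofReal_add (hV x) (by positivity)]
    exact ENNReal.ofReal_le_ofReal (h.total_drift x rfl)
  · refine (finite_total_lt (r / (ε / (n * M)))).subset fun x hx => ?_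
    have hx' : ENNReal.ofReal (ε / (n * M) * total x) < r := hx
    rw [← ENNReal.ofReal_natCast, ENNReal.ofReal_lt_ofReal_iff_of_nonneg
      (mul_nonneg hc0.le (total_nonneg x))] at hx'
    show total x < _
    rw [lt_div_iff₀ hc0]; linarith

/-- The queue differs from `pred` by at most one cycle of mean arrivals and services, so a bound at
`pred` passes to `‖O_⊥‖²`. -/
theorem perpSq_le (x : State n T) :
    perpSq γ x.1 ≤ 2 * quad 1 γ (pred ((∑ l, μ l) - ε) μ x) + 8 * T ^ 2 * n ^ 2 * M ^ 3 := by
  have hM := h.weights.M_pos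
  set L := (∑ l, μ l) - ε with hL
  set v : Fin n → ℝ := (fun l => (x.1 l : ℝ)) - pred L μ x with hv
  have e : (fun l => (x.1 l : ℝ)) = pred L μ x + v := by rw [hv]; abel
  have hl : l1 v ≤ 2 * T * n * M := by
    have hpt : ∀ l, |v l| ≤ ∑ k : Fin T, ((if x.2.1 k = l then L else 0) + μ l) := by
      intro l
      rw [hv, Pi.sub_apply, pred, sub_add_cancel_left, abs_neg]
      refine (Finset.abs_sum_le_sum_abs _ _).trans (Finset.sum_le_sum fun k _ => ?_)
      have h1 := h.lam_nonneg
      have h2 := h.mu_nonneg l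
      rw [← hL] at h1
      split_ifs
      · rw [abs_le]; constructor <;> linarith
      · rw [abs_le]; constructor <;> linarith
      · simp; linarith
      · simp; linarith
    calc l1 v ≤ _ := Finset.sum_le_sum fun l _ => hpt l
      _ = ∑ _k : Fin T, (L + ∑ l, μ l) := by
          rw [Finset.sum_comm]
          refine Finset.sum_congr rfl fun k _ => ?_
          rw [Finset.sum_add_distrib, Finset.sum_ite_eq]; simp
      _ ≤ ∑ _k : Fin T, (n * M + n * M) := Finset.sum_le_sum fun k _ =>
          add_le_add h.lam_le h.sum_mu_le
      _ = _ := by simp; ring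
  have h1 := h.weights.quad_one_add_le (pred L μ x) v
  have h2 := h.weights.quad_le zero_le_one v
  have h3 : M * l1 v ^ 2 ≤ M * (2 * T * n * M) ^ 2 := by
    have := l1_nonneg v
    gcongr
  rw [h.weights.perpSq_eq, e]
  nlinarith

variable {π : Measure (State n T)} (hπ : P.IsSteadyState μ a s π)
include hπ

theorem integrable_total : Integrable total π := by
  have := h.markov
  have := hπ.1
  have hn := h.weights.one_le_n
  have hM := h.weights.M_pos
  have hε := h.eps_pos
  have hc0 : 0 < ε / (n * M) := by positivity
  have h1 := (integral_le_of_drift hπ.2 (h.lyapunov_nonneg hc0.le)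
    (f := fun x => ε / (n * M) * total x) (g := fun _ => 34 * T ^ 2 * n ^ 2 * M ^ 3)
    (fun x => mul_nonneg hc0.le (total_nonneg x)) (fun x => by positivity)
    (fun x => h.integrable_kernel x _) (integrable_const _) fun x => h.total_drift x rfl).1
  have h2 := h1.const_mul (ε / (n * M))⁻¹
  refine h2.congr (ae_of_all _ fun x => ?_)
  simp only
  rw [← mul_assoc, inv_mul_cancel₀ hc0.ne', one_mul]

/-- The position increases by `1` except for a drop by `T - 1` in the last slot; by stationarity its
mean change is zero. -/
theorem integral_last : ∫ x, (if (x.2.2 : ℕ) + 1 < T then (0 : ℝ) else 1) ∂π = 1 / T := by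
  have := h.markov
  have := hπ.1
  have := h.probNoise
  have hT := h.one_le_T'
  have hF := integrable_position (π := π) (fun j => (j : ℝ))
  have hG := integrable_position (π := π) (fun j => if j + 1 < T then (0 : ℝ) else 1)
  have h1 := (integral_invariant hπ.2 hF).2
  have e : ∀ x : State n T, ∫ z, (z.2.2 : ℝ) ∂P.kernel μ a s x
      = (x.2.2 : ℝ) + (1 - T * (if (x.2.2 : ℕ) + 1 < T then (0 : ℝ) else 1)) := by
    intro x
    rw [P.integral_kernel]
    by_cases hx : (x.2.2 : ℕ) + 1 < T
    · simp only [P.step_pos_of_lt μ x _ hx, hx, if_true]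
      simp
    · have hj : (x.2.2 : ℝ) + 1 = T := by
        have : (x.2.2 : ℕ) + 1 = T := by have := x.2.2.isLt; omega
        exact_mod_cast this
      simp only [P.step_pos_of_not_lt μ x _ hx, hx, if_false, ← hj]
      simp
  simp_rw [e] at h1
  rw [integral_add hF (by exact (integrable_const _).sub (hG.const_mul _)),
    integral_sub (integrable_const _) (hG.const_mul _), integral_const_mul, integral_const,
    probReal_univ, one_smul] at h1
  rw [eq_div_iff (by positivity)]
  linarith

theorem integral_first : ∫ x, (if (x.2.2 : ℕ) = 0 then (1 : ℝ) else 0) ∂π = 1 / T := by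
  have := h.markov
  have := hπ.1
  have := h.probNoise
  rw [← h.integral_last hπ,
    ← (integral_invariant hπ.2 (integrable_position (π := π) (fun j => if j = 0 then (1 : ℝ) else 0))).2]
  refine integral_congr_ae (ae_of_all _ fun x => ?_)
  simp only
  rw [P.integral_kernel]
  by_cases hx : (x.2.2 : ℕ) + 1 < T
  · simp [P.step_pos_of_lt μ x _ hx, hx]
  · simp [P.step_pos_of_not_lt μ x _ hx, hx]

/-- The constant of order `T ^ 4 * n ^ 8` enters only in the last slot of a cycle, of stationary
probability `1 / T`. After division by `K`, of order `T * n ^ 2`, the order is `T ^ 2 * n ^ 6` for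
fixed `M`. The weight `T` at position `0` makes the same estimate serve both the overall mean and
the mean at sampling times. -/
theorem integral_weight_quad :
    Integrable (fun x => (if (x.2.2 : ℕ) = 0 then (T : ℝ) else 1)
      * quad 1 γ (pred ((∑ l, μ l) - ε) μ x)) π ∧
    ∫ x, (if (x.2.2 : ℕ) = 0 then (T : ℝ) else 1) * quad 1 γ (pred ((∑ l, μ l) - ε) μ x) ∂π
      ≤ 800000 * T ^ 2 * n ^ 6 * M ^ 9 := by
  have := h.markov
  have := hπ.1
  have hn := h.weights.one_le_n
  have hT := h.one_le_T'
  have hM := h.weights.one_le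
  have hM0 := h.weights.M_pos
  set K : ℝ := 102 * T * n ^ 2 * M ^ 3 with hK
  have hK0 : 0 < K := by positivity
  set g0 : ℝ := 3222 * T ^ 3 * n ^ 4 * M ^ 6 with hg0
  set g1 : ℝ := 76000000 * T ^ 4 * n ^ 8 * M ^ 12 with hg1
  have hg0' : 0 ≤ g0 := by positivity
  have hg1' : 0 ≤ g1 := by positivity
  have hw0 : ∀ x : State n T, 0 ≤ cycleWeight K x := by
    intro x
    have : ((x.2.2 : ℕ) : ℝ) ≤ T := by exact_mod_cast x.2.2.isLt.le
    rw [cycleWeight]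
    split_ifs
    · positivity
    · exact mul_nonneg (by linarith) (by linarith)
  have hQ : ∀ x : State n T, 0 ≤ quad 1 γ (pred ((∑ l, μ l) - ε) μ x) := fun x =>
    h.weights.quad_one_nonneg _
  have hif : ∀ x : State n T, (0 : ℝ) ≤ if (x.2.2 : ℕ) = 0 then (T : ℝ) else 1 := fun x => by
    split_ifs <;> positivity
  have hl := integrable_position (π := π) (fun j => if j + 1 < T then (0 : ℝ) else 1)
  have hlast0 : ∀ x : State n T, (0 : ℝ) ≤ if (x.2.2 : ℕ) + 1 < T then (0 : ℝ) else 1 := fun x => by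
    split_ifs <;> simp
  have main := integral_le_of_drift hπ.2
    (V := fun x => quad 1 γ (pred ((∑ l, μ l) - ε) μ x) ^ 2
      + cycleWeight K x * quad 1 γ (pred ((∑ l, μ l) - ε) μ x))
    (f := fun x => K * (if (x.2.2 : ℕ) = 0 then (T : ℝ) else 1)
      * quad 1 γ (pred ((∑ l, μ l) - ε) μ x))
    (g := fun x => g0 + g1 * (if (x.2.2 : ℕ) + 1 < T then (0 : ℝ) else 1))
    (fun x => add_nonneg (sq_nonneg _) (mul_nonneg (hw0 x) (hQ x)))
    (fun x => mul_nonneg (mul_nonneg hK0.le (hif x)) (hQ x))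
    (fun x => add_nonneg hg0' (mul_nonneg hg1' (hlast0 x)))
    (fun x => h.integrable_kernel x _) ((integrable_const _).add (hl.const_mul _)) fun x => by
      by_cases hx : (x.2.2 : ℕ) + 1 < T
      · have := h.perp_drift_of_lt x hx hK
        simp only [hx, if_true]
        linarith
      · have := h.perp_drift_of_not_lt x hx hK
        simp only [hx, if_false]
        linarith
  obtain ⟨hi, hle⟩ := main
  have e : ∀ x : State n T, (if (x.2.2 : ℕ) = 0 then (T : ℝ) else 1)
      * quad 1 γ (pred ((∑ l, μ l) - ε) μ x)
      = K⁻¹ * (K * (if (x.2.2 : ℕ) = 0 then (T : ℝ) else 1)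
        * quad 1 γ (pred ((∑ l, μ l) - ε) μ x)) := fun x => by
    field_simp
  simp_rw [e]
  refine ⟨hi.const_mul _, ?_⟩
  rw [integral_const_mul, inv_mul_le_iff₀ hK0]
  refine hle.trans ?_
  rw [integral_add (integrable_const _) (hl.const_mul _), integral_const_mul g1, h.integral_last hπ,
    integral_const, probReal_univ, one_smul]
  have e1 : g1 * (1 / T) = 76000000 * (T ^ 3 * n ^ 8 * M ^ 12) := by
    rw [hg1]; field_simp
  have e2 : K * (800000 * T ^ 2 * n ^ 6 * M ^ 9) = 81600000 * (T ^ 3 * n ^ 8 * M ^ 12) := by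
    rw [hK]; ring
  have h1 : (n : ℝ) ^ 4 * M ^ 6 ≤ n ^ 8 * M ^ 12 := by
    gcongr <;> first | assumption | norm_num
  have h2 : g0 ≤ 3222 * (T ^ 3 * n ^ 8 * M ^ 12) := by
    calc g0 = 3222 * (T ^ 3 * (n ^ 4 * M ^ 6)) := by rw [hg0]; ring
      _ ≤ 3222 * (T ^ 3 * (n ^ 8 * M ^ 12)) := by gcongr
      _ = _ := by ring
  have h3 : (0 : ℝ) ≤ T ^ 3 * n ^ 8 * M ^ 12 := by positivity
  rw [e1, e2]
  linarith

theorem integral_weight_perpSq :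
    Integrable (fun x => (if (x.2.2 : ℕ) = 0 then (T : ℝ) else 1) * perpSq γ x.1) π ∧
    ∫ x, (if (x.2.2 : ℕ) = 0 then (T : ℝ) else 1) * perpSq γ x.1 ∂π
      ≤ (2000 * (T * n ^ 4) * M ^ 5) ^ 2 := by
  have := hπ.1
  have hn := h.weights.one_le_n
  have hT := h.one_le_T'
  have hM := h.weights.one_le
  obtain ⟨hi, hle⟩ := h.integral_weight_quad hπ
  set C : ℝ := 8 * T ^ 2 * n ^ 2 * M ^ 3 with hC
  have hC0 : 0 ≤ C := by positivity
  have hw := integrable_position (π := π) (fun j => if j = 0 then (1 : ℝ) else 0)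
  have hdom := (hi.const_mul 2).add ((hw.const_mul (C * T)).add (integrable_const C))
  have hif : ∀ x : State n T, (0 : ℝ) ≤ if (x.2.2 : ℕ) = 0 then (T : ℝ) else 1 := fun x => by
    split_ifs <;> positivity
  have hpt : ∀ x : State n T, (if (x.2.2 : ℕ) = 0 then (T : ℝ) else 1) * perpSq γ x.1
      ≤ 2 * ((if (x.2.2 : ℕ) = 0 then (T : ℝ) else 1) * quad 1 γ (pred ((∑ l, μ l) - ε) μ x))
        + (C * T * (if (x.2.2 : ℕ) = 0 then (1 : ℝ) else 0) + C) := by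
    intro x
    have h1 := mul_le_mul_of_nonneg_left (h.perpSq_le x) (hif x)
    have h2 : (if (x.2.2 : ℕ) = 0 then (T : ℝ) else 1) * C
        ≤ C * T * (if (x.2.2 : ℕ) = 0 then (1 : ℝ) else 0) + C := by
      split_ifs <;> linarith
    rw [← hC] at h1
    linarith
  have hnn : ∀ x : State n T, 0 ≤ (if (x.2.2 : ℕ) = 0 then (T : ℝ) else 1) * perpSq γ x.1 :=
    fun x => mul_nonneg (hif x) (Finset.sum_nonneg fun _ _ => sq_nonneg _)
  have hint : Integrable (fun x : State n T =>
      (if (x.2.2 : ℕ) = 0 then (T : ℝ) else 1) * perpSq γ x.1) π := by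
    refine hdom.mono' (Measurable.of_discrete).aestronglyMeasurable (ae_of_all _ fun x => ?_)
    rw [Real.norm_of_nonneg (hnn x)]
    exact hpt x
  refine ⟨hint, ?_⟩
  refine (integral_mono hint hdom hpt).trans ?_
  rw [integral_add' (hi.const_mul 2) ((hw.const_mul (C * T)).add (integrable_const C)),
    integral_add' (hw.const_mul (C * T)) (integrable_const C), integral_const_mul,
    integral_const_mul, h.integral_first hπ, integral_const, probReal_univ, one_smul]
  have e1 : C * T * (1 / T) = C := by field_simp
  rw [e1]
  have h1 : (T : ℝ) ^ 2 * n ^ 6 * M ^ 9 ≤ T ^ 2 * n ^ 8 * M ^ 10 := by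
    gcongr <;> first | assumption | norm_num
  have h2 : (T : ℝ) ^ 2 * n ^ 2 * M ^ 3 ≤ T ^ 2 * n ^ 8 * M ^ 10 := by
    gcongr <;> first | assumption | norm_num
  have h3 : (0 : ℝ) ≤ T ^ 2 * n ^ 8 * M ^ 10 := by positivity
  have e2 : (2000 * ((T : ℝ) * n ^ 4) * M ^ 5) ^ 2 = 4000000 * (T ^ 2 * n ^ 8 * M ^ 10) := by ring
  rw [e2]
  linarith

end Controlled

end SteadyState

/-! ### Unused service, the drift of the squared total, and sampling times -/

section Delay

variable {n T : ℕ} {γ : Fin n → ℝ}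

/-- Mean total unused service in a slot started from `x`. -/
noncomputable def meanUnused (a : Measure ℕ) (s : Measure (Fin n → ℕ)) (x : State n T) : ℝ :=
  ∫ ξ : Noise n, ∑ l, unused x ξ.1 ξ.2.1 l ∂noise a s

theorem meanUnused_nonneg (a : Measure ℕ) (s : Measure (Fin n → ℕ)) (x : State n T) :
    0 ≤ meanUnused a s x :=
  integral_nonneg fun _ => Finset.sum_nonneg fun _ _ => unused_nonneg _ _ _ _

/-- Second moment of the net arrivals of a slot. -/
noncomputable def netSecondMoment (a : Measure ℕ) (s : Measure (Fin n → ℕ)) : ℝ :=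
  ∫ ξ : Noise n, ((ξ.1 : ℝ) - ∑ l, (ξ.2.1 l : ℝ)) ^ 2 ∂noise a s

/-- A server with unused service ends the slot with an empty queue, so its coordinate of `O_⊥` is
minus the total times `√(γ l) / ∑ γ`. The total times its unused service is then a product of that
coordinate and `u / √(γ l)`, split by the arithmetic–geometric inequality with weight `τ`. As `u ≤
Smax`, one power of `u` suffices, and its mean will be of order `ε`. -/
theorem unused_mul_total_le {M : ℝ} (hw : WeightBounds γ M) (P : Policy n T γ) (μ : Fin n → ℝ)
    {Smax γmin τ : ℝ} (hγmin : 0 < γmin) (hγ : ∀ l, γmin ≤ γ l) (hτ : 0 < τ) (x : State n T)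
    {ξ : Noise n} (hS : ∀ l, (ξ.2.1 l : ℝ) ≤ Smax) :
    2 * (total (P.step μ x ξ) * ∑ l, unused x ξ.1 ξ.2.1 l)
      ≤ (∑ l, γ l) * (τ * (Smax / γmin) * (∑ l, unused x ξ.1 ξ.2.1 l)
        + τ⁻¹ * perpSq γ (P.step μ x ξ).1) := by
  have hG := hw.sum_γ_pos
  set t := total (P.step μ x ξ) with ht
  have hpt : ∀ l, 2 * (t * unused x ξ.1 ξ.2.1 l)
      ≤ (∑ l, γ l) * (τ * (Smax / γmin) * unused x ξ.1 ξ.2.1 l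
        + τ⁻¹ * (((P.step μ x ξ).1 l : ℝ) / √(γ l)
          - (∑ i, ((P.step μ x ξ).1 i : ℝ)) / (∑ i, γ i) * √(γ l)) ^ 2) := by
    intro l
    have hu0 := unused_nonneg x ξ.1 ξ.2.1 l
    have hu1 := (unused_le x ξ.1 ξ.2.1 l).trans (hS l)
    set u := unused x ξ.1 ξ.2.1 l with hu
    rcases unused_eq_zero_or x ξ.1 ξ.2.1 l with h0 | ⟨h0, -⟩
    · rw [hu, h0]
      simp only [mul_zero, zero_add]
      exact mul_nonneg hG.le (mul_nonneg (inv_nonneg.mpr hτ.le) (sq_nonneg _))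
    · rw [← P.step_queue μ] at h0
      rw [h0, Nat.cast_zero, zero_div, zero_sub, neg_sq]
      change _ ≤ (∑ l, γ l) * (τ * (Smax / γmin) * u + τ⁻¹ * (t / (∑ i, γ i) * √(γ l)) ^ 2)
      have hsq := Real.sq_sqrt (hw.γ_pos l).le
      have hs0 := Real.sqrt_pos.mpr (hw.γ_pos l)
      have h1 : u ^ 2 / γ l ≤ Smax / γmin * u := by
        calc u ^ 2 / γ l = u * u / γ l := by ring
          _ ≤ Smax * u / γmin := by
              have := hγ l
              have : 0 ≤ Smax * u := mul_nonneg (hu0.trans hu1) hu0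
              gcongr
          _ = _ := by ring
      set p := t / (∑ i, γ i) * √(γ l) with hp
      set r := u / √(γ l) with hr
      have hr2 : r ^ 2 = u ^ 2 / γ l := by rw [hr, div_pow, hsq]
      have e : t * u = (∑ l, γ l) * (p * r) := by
        rw [hp, hr]; field_simp
      have h2 : 2 * (p * r) ≤ τ * r ^ 2 + τ⁻¹ * p ^ 2 := by
        have e2 : τ * r ^ 2 + τ⁻¹ * p ^ 2 - 2 * (p * r) = τ * (r - τ⁻¹ * p) ^ 2 := by
          field_simp; ring
        have : 0 ≤ τ * (r - τ⁻¹ * p) ^ 2 := by positivity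
        linarith
      have h3 : τ * r ^ 2 ≤ τ * (Smax / γmin) * u := by
        rw [hr2, mul_assoc]; gcongr
      rw [e]
      calc 2 * ((∑ l, γ l) * (p * r)) = (∑ l, γ l) * (2 * (p * r)) := by ring
        _ ≤ _ := by gcongr; linarith
  have := Finset.sum_le_sum fun l (_ : l ∈ Finset.univ) => hpt l
  simp only [← Finset.mul_sum, Finset.sum_add_distrib] at this
  exact this

namespace Controlled

variable {P : Policy n T γ} {μ : Fin n → ℝ} {a : Measure ℕ} {s : Measure (Fin n → ℕ)} {M ε : ℝ}
  (h : Controlled P μ a s M ε)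
include h

theorem integral_net (x : State n T) :
    ∫ ξ : Noise n, ((ξ.1 : ℝ) - ∑ l, (ξ.2.1 l : ℝ)) ∂noise a s = -ε := by
  rw [integral_sub (h.integrable x fun k _ _ => (k : ℝ))
    (h.integrable x fun _ m _ => ∑ l, (m l : ℝ)), h.integral_arrival',
    integral_finsetSum _ fun l _ => h.integrable x fun _ m _ => (m l : ℝ)]
  simp only [h.integral_service']
  ring

theorem integral_total (x : State n T) :
    ∫ z, total z ∂P.kernel μ a s x = total x - ε + meanUnused a s x := by
  have := h.probNoise
  have i1 := h.integrable x fun k m _ => (k : ℝ) - ∑ l, (m l : ℝ)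
  have i2 := h.integrable x fun k m _ => ∑ l, unused x k m l
  rw [P.integral_kernel]
  simp_rw [P.total_step]
  rw [integral_add (by exact (integrable_const _).add i1) i2, integral_add (integrable_const _) i1,
    h.integral_net x, meanUnused]
  simp
  ring

theorem integral_total_sq_le {Smax γmin τ : ℝ} (hγmin : 0 < γmin) (hγ : ∀ l, γmin ≤ γ l)
    (hτ : 0 < τ) (hS : ∀ l, ∀ᵐ k ∂s, (k l : ℝ) ≤ Smax) (x : State n T) :
    ∫ z, total z ^ 2 ∂P.kernel μ a s x + 2 * ε * total x
      ≤ total x ^ 2 + (netSecondMoment a s + (∑ l, γ l) * (τ * (Smax / γmin) * meanUnused a s x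
        + τ⁻¹ * ∫ z, perpSq γ z.1 ∂P.kernel μ a s x)) := by
  have := h.probNoise
  have := h.probArrival
  have := h.probService
  have hbd := (BoundedLaws.mk h.laws.arrival hS).ae_noise
  have i0 := h.integrable x fun k m _ => 2 * total x * ((k : ℝ) - ∑ l, (m l : ℝ))
  have i1 := h.integrable x fun k m _ => ((k : ℝ) - ∑ l, (m l : ℝ)) ^ 2
  have i2 := h.integrable x fun k m _ => τ * (Smax / γmin) * ∑ l, unused x k m l
  have i3 := h.integrable x fun _ _ z => τ⁻¹ * perpSq γ z.1
  have i4 : Integrable (fun ξ : Noise n => (∑ l, γ l) * (τ * (Smax / γmin)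
      * (∑ l, unused x ξ.1 ξ.2.1 l) + τ⁻¹ * perpSq γ (P.step μ x ξ).1)) (noise a s) :=
    (i2.add i3).const_mul (∑ l, γ l)
  have key : ∫ z, total z ^ 2 ∂P.kernel μ a s x
      ≤ ∫ ξ : Noise n, (total x ^ 2 + 2 * total x * ((ξ.1 : ℝ) - ∑ l, (ξ.2.1 l : ℝ))
        + ((ξ.1 : ℝ) - ∑ l, (ξ.2.1 l : ℝ)) ^ 2
        + (∑ l, γ l) * (τ * (Smax / γmin) * (∑ l, unused x ξ.1 ξ.2.1 l)
          + τ⁻¹ * perpSq γ (P.step μ x ξ).1)) ∂noise a s := by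
    rw [P.integral_kernel]
    refine integral_mono_ae (h.integrable x fun _ _ z => total z ^ 2)
      ((((integrable_const _).add i0).add i1).add i4) ?_
    filter_upwards [hbd] with ξ hξ
    have h1 := unused_mul_total_le h.weights P μ hγmin hγ hτ x hξ.2
    refine le_trans ?_ (add_le_add_right h1 _)
    rw [P.total_step]
    -- With `t` the total, `d` the net arrivals and `u` the unused service, `(t + d + u) ^ 2 = (t +
    -- d) ^ 2 + 2 * (t + d + u) * u - u ^ 2`. The cross term thus involves the total after the slot,
    -- and the last square is dropped.
    nlinarith [sq_nonneg (∑ l, unused x ξ.1 ξ.2.1 l)]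
  rw [integral_add (by exact ((integrable_const _).add i0).add i1) i4,
    integral_add (by exact (integrable_const _).add i0) i1, integral_add (integrable_const _) i0,
    integral_const_mul, integral_const_mul, integral_add i2 i3, integral_const_mul,
    integral_const_mul, h.integral_net x, integral_const, probReal_univ, one_smul] at key
  rw [netSecondMoment, meanUnused, P.integral_kernel μ a s x fun z => perpSq γ z.1]
  linarith

variable {π : Measure (State n T)} (hπ : P.IsSteadyState μ a s π)
include hπ

/-- The total has a finite stationary mean, so its mean change `-ε + meanUnused` integrates to zero.
-/
theorem integral_meanUnused :
    Integrable (meanUnused a s) π ∧ ∫ x, meanUnused a s x ∂π = ε := by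
  have := h.markov
  have := hπ.1
  have hi := h.integrable_total hπ
  have hK := integral_invariant hπ.2 hi
  have e : meanUnused a s = fun x : State n T => ∫ z, total z ∂P.kernel μ a s x - total x + ε := by
    ext x; rw [h.integral_total x]; ring
  rw [e]
  refine ⟨(hK.1.sub hi).add (integrable_const _), ?_⟩
  rw [integral_add (by exact hK.1.sub hi) (integrable_const _), integral_sub hK.1 hi, hK.2]
  simp

theorem integral_perpSq :
    Integrable (fun x => perpSq γ x.1) π ∧
    ∫ x, perpSq γ x.1 ∂π ≤ (2000 * (T * n ^ 4) * M ^ 5) ^ 2 := by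
  obtain ⟨hi, hle⟩ := h.integral_weight_perpSq hπ
  have hT := h.one_le_T'
  have hnn : ∀ x : State n T, 0 ≤ perpSq γ x.1 := fun x => Finset.sum_nonneg fun _ _ => sq_nonneg _
  have hpt : ∀ x : State n T, perpSq γ x.1
      ≤ (if (x.2.2 : ℕ) = 0 then (T : ℝ) else 1) * perpSq γ x.1 := fun x => by
    refine le_mul_of_one_le_left (hnn x) ?_
    split_ifs <;> linarith
  have hint : Integrable (fun x : State n T => perpSq γ x.1) π := by
    refine hi.mono' (Measurable.of_discrete).aestronglyMeasurable (ae_of_all _ fun x => ?_)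
    rw [Real.norm_of_nonneg (hnn x)]
    exact hpt x
  exact ⟨hint, (integral_mono hint hi hpt).trans hle⟩

theorem integral_total_le_tau {Smax γmin τ : ℝ} (hγmin : 0 < γmin) (hγ : ∀ l, γmin ≤ γ l)
    (hτ : 0 < τ) (hS0 : 0 ≤ Smax) (hS : ∀ l, ∀ᵐ k ∂s, (k l : ℝ) ≤ Smax) :
    2 * ε * ∫ x, total x ∂π
      ≤ netSecondMoment a s + (∑ l, γ l) * (τ * (Smax / γmin) * ε
        + τ⁻¹ * (2000 * (T * n ^ 4) * M ^ 5) ^ 2) := by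
  have := h.markov
  have := hπ.1
  have hε := h.eps_pos
  have hG := h.weights.sum_γ_pos
  obtain ⟨hu, hue⟩ := h.integral_meanUnused hπ
  obtain ⟨hp, hpe⟩ := h.integral_perpSq hπ
  obtain ⟨hKp, hKpe⟩ := integral_invariant hπ.2 hp
  have hnn : ∀ x : State n T, 0 ≤ perpSq γ x.1 := fun x => Finset.sum_nonneg fun _ _ => sq_nonneg _
  have hv0 : 0 ≤ netSecondMoment a s := integral_nonneg fun _ => sq_nonneg _
  have hi : Integrable (fun x => (∑ l, γ l) * (τ * (Smax / γmin) * meanUnused a s x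
      + τ⁻¹ * ∫ z, perpSq γ z.1 ∂P.kernel μ a s x)) π :=
    ((hu.const_mul (τ * (Smax / γmin))).add (hKp.const_mul τ⁻¹)).const_mul (∑ l, γ l)
  have main := (integral_le_of_drift hπ.2 (V := fun x => total x ^ 2)
    (f := fun x => 2 * ε * total x)
    (g := fun x => netSecondMoment a s + (∑ l, γ l) * (τ * (Smax / γmin) * meanUnused a s x
        + τ⁻¹ * ∫ z, perpSq γ z.1 ∂P.kernel μ a s x))
    (fun x => sq_nonneg _) (fun x => mul_nonneg (by positivity) (total_nonneg x))
    (fun x => by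
      have h1 := meanUnused_nonneg a s x
      have h2 : 0 ≤ ∫ z, perpSq γ z.1 ∂P.kernel μ a s x := integral_nonneg hnn
      positivity)
    (fun x => h.integrable_kernel x _) ((integrable_const _).add hi)
    fun x => h.integral_total_sq_le hγmin hγ hτ hS x).2
  rw [integral_const_mul] at main
  refine main.trans ?_
  rw [integral_add (integrable_const _) hi, integral_const_mul,
    integral_add (hu.const_mul _) (hKp.const_mul _), integral_const_mul, integral_const_mul,
    hue, hKpe, integral_const, probReal_univ, one_smul]
  gcongr

/-- The mean total queue length at the beginning of a cycle exceeds the overall mean by at most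
`(T - 1) ε`. -/
theorem integral_first_total_le :
    ∫ x, T * ((if (x.2.2 : ℕ) = 0 then (1 : ℝ) else 0) * total x) ∂π
      ≤ ∫ x, total x ∂π + (T - 1) * ε := by
  have := h.markov
  have := hπ.1
  have := h.probNoise
  have hT := h.one_le_T'
  have hε := h.eps_pos
  have hi := h.integrable_total hπ
  have hbound : ∀ (F : ℕ → ℝ), Integrable (fun x : State n T => F x.2.2 * total x) π := by
    intro F
    obtain ⟨C, hC⟩ := (Set.finite_range fun j : Fin T => ‖F j‖).bddAbove
    exact hi.bdd_mul (Measurable.of_discrete).aestronglyMeasurable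
      (ae_of_all _ fun x => hC ⟨x.2.2, rfl⟩)
  -- In one slot the mean total falls by at most `ε`. Weighting it by `T - j` after position `0`
  -- makes comparisons of successive positions telescope, so that `T` copies of the total at
  -- position `0` are compared with the sum over the cycle.
  have hF := hbound fun j => if j = 0 then 0 else (T : ℝ) - j
  obtain ⟨hK, hKe⟩ := integral_invariant hπ.2 hF
  have hI := hbound fun j => if j = 0 then (1 : ℝ) else 0
  have hpt : ∀ x : State n T, T * ((if (x.2.2 : ℕ) = 0 then (1 : ℝ) else 0) * total x)
        + (if (x.2.2 : ℕ) = 0 then 0 else (T : ℝ) - (x.2.2 : ℕ)) * total x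
      ≤ ∫ z, (if (z.2.2 : ℕ) = 0 then 0 else (T : ℝ) - (z.2.2 : ℕ)) * total z ∂P.kernel μ a s x
        + (total x + (T - 1) * ε) := by
    intro x
    have ht := h.integral_total x
    have hu := meanUnused_nonneg a s x
    have hx0 := total_nonneg x
    rw [P.integral_kernel] at ht ⊢
    by_cases hx : (x.2.2 : ℕ) + 1 < T
    · have hxT : (x.2.2 : ℝ) + 1 ≤ T := by exact_mod_cast hx.le
      have hj : (0 : ℝ) ≤ (x.2.2 : ℕ) := Nat.cast_nonneg _
      simp only [P.step_pos_of_lt μ x _ hx, Nat.succ_ne_zero, if_false]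
      rw [integral_const_mul, ht]
      push_cast
      have h1 : ((T : ℝ) - ((x.2.2 : ℕ) + 1)) * (total x - ε)
          ≤ (T - ((x.2.2 : ℕ) + 1)) * (total x - ε + meanUnused a s x) := by
        refine mul_le_mul_of_nonneg_left (by linarith) (by linarith)
      split_ifs with h0
      · rw [h0] at h1 ⊢
        push_cast at h1 ⊢
        linarith
      · have : 0 ≤ ((x.2.2 : ℕ) : ℝ) * ε := by positivity
        linarith
    · have hj : (x.2.2 : ℝ) + 1 = T := by
        have : (x.2.2 : ℕ) + 1 = T := by have := x.2.2.isLt; omega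
        exact_mod_cast this
      have hTε : 0 ≤ ((T : ℝ) - 1) * ε := mul_nonneg (by linarith) hε.le
      simp only [P.step_pos_of_not_lt μ x _ hx, if_true, zero_mul, integral_zero]
      split_ifs with h0
      · rw [h0] at hj
        push_cast at hj
        rw [← hj] at hTε ⊢
        linarith
      · have e : (T : ℝ) - (x.2.2 : ℕ) = 1 := by linarith
        rw [e]; linarith
  have := integral_mono ((hI.const_mul T).add hF) (hK.add (hi.add (integrable_const _))) hpt
  rw [integral_add' (hI.const_mul T) hF, integral_add' hK (hi.add (integrable_const _)), hKe,
    integral_add' hi (integrable_const _), integral_const, probReal_univ, one_smul] at this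
  linarith

/-- Expectations at the sampling times. -/
theorem integral_sampled (F : State n T → ℝ) (hF : Integrable F π) :
    Integrable F (sampled π) ∧
    ∫ x, F x ∂sampled π = ∫ x, T * ((if (x.2.2 : ℕ) = 0 then (1 : ℝ) else 0) * F x) ∂π := by
  have := hπ.1
  have hT := h.one_le_T'
  have hA : MeasurableSet {x : State n T | (x.2.2 : ℕ) = 0} := .of_discrete
  have hreal : π.real {x : State n T | (x.2.2 : ℕ) = 0} = 1 / T := by
    rw [← h.integral_first hπ, ← integral_indicator_one hA]
    refine integral_congr_ae (ae_of_all _ fun x => ?_)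
    simp [Set.indicator_apply]
  have hne : π {x : State n T | (x.2.2 : ℕ) = 0} ≠ 0 := by
    intro h0
    rw [measureReal_def, h0] at hreal
    have : (0 : ℝ) < 1 / T := by positivity
    simp at hreal
    linarith
  refine ⟨?_, ?_⟩
  · unfold sampled ProbabilityTheory.cond
    exact hF.restrict.smul_measure (ENNReal.inv_ne_top.mpr hne)
  · unfold sampled ProbabilityTheory.cond
    rw [integral_smul_measure, ENNReal.toReal_inv, ← measureReal_def, hreal, ← integral_indicator hA,
      integral_const_mul, one_div, inv_inv, smul_eq_mul]
    congr 1
    refine integral_congr_ae (ae_of_all _ fun x => ?_)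
    simp [Set.indicator_apply]

theorem integral_sampled_perpSq :
    Integrable (fun x => perpSq γ x.1) (sampled π) ∧
    ∫ x, perpSq γ x.1 ∂sampled π ≤ (2000 * (T * n ^ 4) * M ^ 5) ^ 2 := by
  obtain ⟨hi, hle⟩ := h.integral_weight_perpSq hπ
  obtain ⟨h1, h2⟩ := h.integral_sampled hπ _ (h.integral_perpSq hπ).1
  refine ⟨h1, ?_⟩
  rw [h2]
  refine le_trans (integral_mono_of_nonneg (ae_of_all _ fun x => ?_) hi (ae_of_all _ fun x => ?_)) hle
  · have : 0 ≤ perpSq γ x.1 := Finset.sum_nonneg fun _ _ => sq_nonneg _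
    show 0 ≤ T * ((if (x.2.2 : ℕ) = 0 then (1 : ℝ) else 0) * perpSq γ x.1)
    split_ifs <;> positivity
  · have : 0 ≤ perpSq γ x.1 := Finset.sum_nonneg fun _ _ => sq_nonneg _
    show T * ((if (x.2.2 : ℕ) = 0 then (1 : ℝ) else 0) * perpSq γ x.1)
      ≤ (if (x.2.2 : ℕ) = 0 then (T : ℝ) else 1) * perpSq γ x.1
    split_ifs <;> linarith

end Controlled

end Delay

/-! ### Variance of the net arrivals and the explicit delay bound -/

section Bounds

variable {n T : ℕ} {γ : Fin n → ℝ}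

namespace Controlled

variable {P : Policy n T γ} {μ : Fin n → ℝ} {a : Measure ℕ} {s : Measure (Fin n → ℕ)} {M ε : ℝ}
  (h : Controlled P μ a s M ε)
include h

theorem integrable_service (F : (Fin n → ℕ) → ℝ) : Integrable F s := by
  have := h.probArrival
  have := h.probService
  obtain ⟨x⟩ := h.state_nonempty
  exact ((measurePreserving_service (a := a) (s := s)).integrable_comp
    (Measurable.of_discrete).aestronglyMeasurable).mp (h.integrable x fun _ m _ => F m)

/-- The net arrivals have mean `-ε`, and the cross term of centred arrivals and centred services
vanishes by independence. Correlations among the servers remain in the middle term. -/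
theorem netSecondMoment_eq :
    netSecondMoment a s = variance (fun k : ℕ => (k : ℝ)) a
      + ∫ m, (∑ l, ((m l : ℝ) - μ l)) ^ 2 ∂s + ε ^ 2 := by
  have := h.probArrival
  have := h.probService
  have := h.probNoise
  obtain ⟨x⟩ := h.state_nonempty
  set L := (∑ l, μ l) - ε with hL
  have eA : ∫ ξ : Noise n, ((ξ.1 : ℝ) - L) ∂noise a s = 0 := by
    rw [integral_sub (h.integrable x fun k _ _ => (k : ℝ)) (integrable_const _),
      h.integral_arrival']
    simp [hL]
  have eS : ∫ m, (∑ l, ((m l : ℝ) - μ l)) ∂s = 0 := by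
    rw [← integral_service (a := a) fun m => ∑ l, ((m l : ℝ) - μ l),
      integral_finsetSum _ fun l _ => h.integrable x fun _ m _ => ((m l : ℝ) - μ l)]
    refine Finset.sum_eq_zero fun l _ => ?_
    rw [integral_sub (h.integrable x fun _ m _ => (m l : ℝ)) (integrable_const _),
      h.integral_service']
    simp
  have eS' : ∫ ξ : Noise n, (∑ l, ((ξ.2.1 l : ℝ) - μ l)) ∂noise a s = 0 := by
    rw [integral_service fun m => ∑ l, ((m l : ℝ) - μ l), eS]
  have eAS : ∫ ξ : Noise n, ((ξ.1 : ℝ) - L) * (∑ l, ((ξ.2.1 l : ℝ) - μ l)) ∂noise a s = 0 := by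
    have h1 := integral_prod_mul (μ := a)
      (ν := s.prod ((volume : Measure unitInterval).prod (volume : Measure unitInterval)))
      (fun k : ℕ => (k : ℝ) - L)
      (fun r : (Fin n → ℕ) × unitInterval × unitInterval => ∑ l, ((r.1 l : ℝ) - μ l))
    have h2 : ∫ k : ℕ, ((k : ℝ) - L) ∂a = 0 := by
      rw [← eA]; exact (integral_arrival fun k => (k : ℝ) - L).symm
    rw [h2, zero_mul] at h1
    exact h1
  have eV : variance (fun k : ℕ => (k : ℝ)) a
      = ∫ ξ : Noise n, ((ξ.1 : ℝ) - L) ^ 2 ∂noise a s := by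
    rw [variance_eq_integral (Measurable.of_discrete).aemeasurable, h.mean_arrival]
    exact (integral_arrival fun k => ((k : ℝ) - L) ^ 2).symm
  rw [eV, ← integral_service (a := a) fun m => (∑ l, ((m l : ℝ) - μ l)) ^ 2, netSecondMoment]
  have j1 := h.integrable x fun k _ _ => ((k : ℝ) - L) ^ 2
  have j2 := h.integrable x fun _ m _ => (∑ l, ((m l : ℝ) - μ l)) ^ 2
  have j3 := h.integrable x fun k m _ => 2 * (((k : ℝ) - L) * ∑ l, ((m l : ℝ) - μ l))
  have j4 := h.integrable x fun k _ _ => 2 * ε * ((k : ℝ) - L)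
  have j5 := h.integrable x fun _ m _ => 2 * ε * ∑ l, ((m l : ℝ) - μ l)
  have e : ∀ ξ : Noise n, ((ξ.1 : ℝ) - ∑ l, (ξ.2.1 l : ℝ)) ^ 2
      = ((ξ.1 : ℝ) - L) ^ 2 + (∑ l, ((ξ.2.1 l : ℝ) - μ l)) ^ 2
        - 2 * (((ξ.1 : ℝ) - L) * ∑ l, ((ξ.2.1 l : ℝ) - μ l))
        - 2 * ε * ((ξ.1 : ℝ) - L) + 2 * ε * ∑ l, ((ξ.2.1 l : ℝ) - μ l) + ε ^ 2 := by
    intro ξ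
    rw [Finset.sum_sub_distrib, hL]; ring
  simp_rw [e]
  rw [integral_add (by exact (((j1.add j2).sub j3).sub j4).add j5) (integrable_const _),
    integral_add (by exact ((j1.add j2).sub j3).sub j4) j5,
    integral_sub (by exact (j1.add j2).sub j3) j4, integral_sub (by exact j1.add j2) j3,
    integral_add j1 j2, integral_const_mul, integral_const_mul, integral_const_mul, eAS, eA, eS']
  simp

theorem variance_service (l : Fin n) :
    variance (fun m : Fin n → ℕ => (m l : ℝ)) s = ∫ m, ((m l : ℝ) - μ l) ^ 2 ∂s := by
  rw [variance_eq_integral (Measurable.of_discrete).aemeasurable, h.mean_service]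

/-- Cauchy–Schwarz, for services that may be correlated. The factor `n` lost here is recovered by
averaging the queue lengths over the servers. -/
theorem integral_sum_sq_le :
    ∫ m, (∑ l, ((m l : ℝ) - μ l)) ^ 2 ∂s
      ≤ n * ∑ l, variance (fun m : Fin n → ℕ => (m l : ℝ)) s := by
  simp_rw [h.variance_service]
  rw [← integral_finsetSum _ fun l _ => h.integrable_service _, ← integral_const_mul]
  refine integral_mono (h.integrable_service _) (h.integrable_service _) fun m => ?_
  simpa using sq_sum_le_card_mul_sum_sq (s := Finset.univ) (f := fun l => (m l : ℝ) - μ l)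

theorem integral_sum_sq_of_uncorrelated (hu : UncorrelatedServices s) :
    ∫ m, (∑ l, ((m l : ℝ) - μ l)) ^ 2 ∂s
      = ∑ l, variance (fun m : Fin n → ℕ => (m l : ℝ)) s := by
  have e : ∀ m : Fin n → ℕ, (∑ l, ((m l : ℝ) - μ l)) ^ 2
      = ∑ l, ∑ l', ((m l : ℝ) - μ l) * ((m l' : ℝ) - μ l') := fun m => by
    rw [sq, Finset.sum_mul_sum]
  simp_rw [e]
  rw [integral_finsetSum _ fun l _ => h.integrable_service _]
  refine Finset.sum_congr rfl fun l _ => ?_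
  rw [integral_finsetSum _ fun l _ => h.integrable_service _, h.variance_service,
    Finset.sum_eq_single l]
  · simp_rw [sq]
  · intro l' _ hl
    have := hu l l' (Ne.symm hl)
    rw [covariance, h.mean_service, h.mean_service] at this
    exact this
  · simp

theorem mu_le_of_service_le {Smax : ℝ} (hS : ∀ l, ∀ᵐ k ∂s, (k l : ℝ) ≤ Smax) (l : Fin n) :
    μ l ≤ Smax := by
  have := h.probService
  rw [← h.mean_service l]
  calc _ ≤ ∫ _k, Smax ∂s := integral_mono_ae (h.integrable_service _) (integrable_const _) (hS l)
    _ = Smax := by simp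

theorem integral_total_le_explicit {π : Measure (State n T)} (hπ : P.IsSteadyState μ a s π)
    {Smax γmin : ℝ} (hγmin : 0 < γmin) (hγ : ∀ l, γmin ≤ γ l) (hS0 : 0 < Smax)
    (hS : ∀ l, ∀ᵐ k ∂s, (k l : ℝ) ≤ Smax) :
    ε * ∫ x, total x ∂π ≤ netSecondMoment a s / 2
      + √ε * ((∑ l, γ l) * (2000 * (T * n ^ 4) * M ^ 5) * √Smax / √γmin) := by
  have hε := h.eps_pos
  have hn := h.weights.one_le_n
  have hT := h.one_le_T'
  have hM := h.weights.M_pos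
  set N : ℝ := 2000 * (T * n ^ 4) * M ^ 5 with hN
  have hN0 : 0 < N := by positivity
  have ha := Real.sqrt_pos.mpr hS0
  have hb := Real.sqrt_pos.mpr hγmin
  have he := Real.sqrt_pos.mpr hε
  -- This `τ` equalizes `τ * (Smax / γmin) * ε` and `τ⁻¹ * N ^ 2`, which minimizes their sum.
  have h1 := h.integral_total_le_tau hπ hγmin hγ (τ := N * √γmin / (√Smax * √ε)) (by positivity)
    hS0.le hS
  have e : N * √γmin / (√Smax * √ε) * (Smax / γmin) * ε + (N * √γmin / (√Smax * √ε))⁻¹ * N ^ 2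
      = 2 * (√ε * (N * √Smax / √γmin)) := by
    have e1 : Smax = √Smax ^ 2 := (Real.sq_sqrt hS0.le).symm
    have e2 : γmin = √γmin ^ 2 := (Real.sq_sqrt hγmin.le).symm
    have e3 : ε = √ε ^ 2 := (Real.sq_sqrt hε.le).symm
    set A := √Smax
    set B := √γmin
    set D := √ε
    rw [e1, e2, e3]
    field_simp
    ring
  rw [e] at h1
  have e2 : √ε * ((∑ l, γ l) * N * √Smax / √γmin)
      = (∑ l, γ l) * (√ε * (N * √Smax / √γmin)) := by ring
  rw [e2]
  linarith

end Controlled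

/-- The terms `ε ^ 2 / 2` from the mean of the net arrivals and `(T - 1) * ε ^ 2` from the sampling
times fit into `ε ^ 2 * (T / 2)` and the `Smax` part of the middle term, as `ε ≤ n * Smax`. The
`Amax` part and the factor `√n` in the last term are slack. -/
theorem le_delayBound {t v R N Amax Smax σlam ε : ℝ} {σ : Fin n → ℝ} (hn : 1 ≤ n)
    (hT : 1 ≤ T) (hγ : ∀ l, 0 < γ l) (hγmin : 0 < ⨅ l, γ l) (hA : 0 ≤ Amax)
    (hS : 0 ≤ Smax) (hε : 0 < ε) (hεS : ε ≤ n * Smax) (hN : 0 ≤ N)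
    (hR : R = √ε * ((∑ l, γ l) * N * √Smax / √(⨅ l, γ l)))
    (ht : ε * t ≤ v / 2 + R + (T - 1) * ε ^ 2) :
    (v = n * σlam ^ 2 + ∑ l, σ l ^ 2 + ε ^ 2 → ε * t ≤ delayBound T γ Amax Smax σlam σ N ε) ∧
    (v ≤ n * σlam ^ 2 + n * ∑ l, σ l ^ 2 + ε ^ 2 →
      ε * (1 / n * t) ≤ delayBound T γ Amax Smax σlam σ N ε) := by
  have hn' : (1 : ℝ) ≤ n := by exact_mod_cast hn
  have hT' : (1 : ℝ) ≤ T := by exact_mod_cast hT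
  have hG : 0 ≤ ∑ l, γ l := Finset.sum_nonneg fun l _ => (hγ l).le
  have hσ : 0 ≤ ∑ l, σ l ^ 2 := Finset.sum_nonneg fun l _ => sq_nonneg _
  set m := ⨅ l, γ l with hm
  have hR0 : 0 ≤ R := by rw [hR]; positivity
  have hRR : R ≤ √ε * ((∑ l, γ l) * N * √(n * Smax) / √m) := by
    rw [hR]
    have : √Smax ≤ √(n * Smax) := Real.sqrt_le_sqrt (le_mul_of_one_le_left hS hn')
    gcongr
  have hmid : ε * (T * n * Smax / 2)
      ≤ ε * ((T * n * Smax * m + 2 * T * n * (∑ l, γ l) * Amax) / (2 * m)) := by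
    have e : (T * n * Smax * m + 2 * T * n * (∑ l, γ l) * Amax) / (2 * m)
        = T * n * Smax / 2 + T * n * (∑ l, γ l) * Amax / m := by field_simp
    rw [e]
    have : 0 ≤ T * n * (∑ l, γ l) * Amax / m := by positivity
    gcongr
    linarith
  have hquad : ε ^ 2 / 2 + (T - 1) * ε ^ 2 ≤ ε ^ 2 * (T / 2) + ε * (T * n * Smax / 2) := by
    have h1 : ε * ε ≤ ε * (n * Smax) := by gcongr
    have h2 : (T : ℝ) * (ε * ε) ≤ T * (ε * (n * Smax)) := by gcongr
    have h3 : 0 ≤ ε * ε := by positivity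
    nlinarith
  unfold delayBound
  refine ⟨fun hv => ?_, fun hv => ?_⟩
  · rw [hv] at ht
    linarith
  · have hn0 : (0 : ℝ) < n := by linarith
    have e : ε * (1 / n * t) = ε * t / n := by ring
    rw [e, div_le_iff₀ hn0]
    set B := ε ^ 2 * ((T : ℝ) / 2)
      + ε * ((T * n * Smax * m + 2 * T * n * (∑ l, γ l) * Amax) / (2 * m))
      + √ε * ((∑ l, γ l) * N * √(n * Smax) / √m) with hB
    have hB1 : ε ^ 2 / 2 + R + (T - 1) * ε ^ 2 ≤ B := by linarith
    have hB0 : 0 ≤ B := by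
      have : 0 ≤ (T - 1) * ε ^ 2 := mul_nonneg (by linarith) (sq_nonneg _)
      have : 0 ≤ ε ^ 2 := sq_nonneg ε
      linarith
    have h1 : B ≤ B * n := le_mul_of_one_le_right hB0 hn'
    have h2 : n * σlam ^ 2 ≤ n * σlam ^ 2 * n := le_mul_of_one_le_right (by positivity) hn'
    have e2 : ((n * σlam ^ 2 + ∑ l, σ l ^ 2) / 2 + ε ^ 2 * ((T : ℝ) / 2)
      + ε * ((T * n * Smax * m + 2 * T * n * (∑ l, γ l) * Amax) / (2 * m))
      + √ε * ((∑ l, γ l) * N * √(n * Smax) / √m)) * n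
      = (n * σlam ^ 2 * n + n * ∑ l, σ l ^ 2) / 2 + B * n := by rw [hB]; ring
    rw [e2]
    linarith

end Bounds

/-! ### A controlling constant that depends only on the parameters -/

section Params

theorem Params.ControlledBy.mono {p : Params} {M M' : ℝ} (h : p.ControlledBy M) (hM : 0 < M)
    (hMM' : M ≤ M') : p.ControlledBy M' := by
  have h1 : 1 / M' ≤ 1 / M := one_div_le_one_div_of_le hM hMM'
  exact ⟨fun l => ⟨h1.trans (h.1 l).1, (h.1 l).2.trans hMM'⟩, h.2.1.trans hMM',
    h.2.2.1.trans hMM', fun η m h2 h3 => h1.trans (h.2.2.2 η m h2 h3)⟩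

/-- A constant controlling the parameters, close to the least one. -/
noncomputable def Params.bound (p : Params) : ℝ := sInf {M | 0 < M ∧ p.ControlledBy M} + 1

theorem Params.one_le_bound (p : Params) : 1 ≤ p.bound := by
  have : 0 ≤ sInf {M | 0 < M ∧ p.ControlledBy M} := Real.sInf_nonneg fun M hM => hM.1.le
  unfold Params.bound
  linarith

theorem Params.bound_le {p : Params} {M : ℝ} (hM : 0 < M) (h : p.ControlledBy M) :
    p.bound ≤ M + 1 := by
  have : sInf {M | 0 < M ∧ p.ControlledBy M} ≤ M := csInf_le ⟨0, fun M hM => hM.1.le⟩ ⟨hM, h⟩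
  unfold Params.bound
  linarith

theorem Params.controlledBy_bound {p : Params} (h : ∃ M, 0 < M ∧ p.ControlledBy M) :
    p.ControlledBy p.bound := by
  obtain ⟨M, hM, hlt⟩ := exists_lt_of_csInf_lt (s := {M | 0 < M ∧ p.ControlledBy M}) h
    (lt_add_one _)
  exact hM.2.mono hM.1 hlt.le

theorem exists_controlledBy {n T : ℕ} {γ μ : Fin n → ℝ} (hn : 1 ≤ n) (hγ : ∀ l, 0 < γ l)
    (hμ : ∀ l, 0 < μ l) {f : Equiv.Perm (Fin n) → Fin n → ℝ} (hf : StrictMajorization μ f)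
    (τsq : Equiv.Perm (Fin n) → Fin n → ℝ) (Amax Smax : ℝ) :
    ∃ M, 0 < M ∧ (⟨n, T, γ, μ, f, τsq, Amax, Smax⟩ : Params).ControlledBy M := by
  obtain ⟨gap, hgapdef⟩ : ∃ gap : Equiv.Perm (Fin n) → ℕ → ℝ, ∀ η m, gap η m
      = partialSum (fun l => μ (η l)) m - (∑ l, μ l) * partialSum (f η) m := ⟨_, fun _ _ => rfl⟩
  have hgap : ∀ η m, 1 ≤ m → m < n → 0 < gap η m := by
    intro η m h1 h2
    have h3 := hf η m h1 h2
    have e : ∑ l, μ (η l) = ∑ l, μ l := Equiv.sum_comp η μ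
    have hpos : 0 < ∑ l, μ l :=
      Finset.sum_pos (fun l _ => hμ l) ⟨⟨0, hn⟩, Finset.mem_univ _⟩
    rw [e, lt_div_iff₀ hpos] at h3
    rw [hgapdef]
    linarith
  obtain ⟨D, hD, hDle⟩ : ∃ D : ℝ, 0 ≤ D ∧ ∀ η m, m < n → |(gap η m)⁻¹| ≤ D := by
    -- Finitely many strict inequalities leave a uniform gap. The sum includes `m = 0`, where the
    -- gap is `0` and so is its inverse, at no cost.
    refine ⟨∑ z ∈ (Finset.univ : Finset (Equiv.Perm (Fin n))) ×ˢ Finset.range n,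
      |(gap z.1 z.2)⁻¹|, Finset.sum_nonneg fun _ _ => abs_nonneg _, fun η m hm => ?_⟩
    have hmem : (η, m) ∈ (Finset.univ : Finset (Equiv.Perm (Fin n))) ×ˢ Finset.range n :=
      Finset.mem_product.mpr ⟨Finset.mem_univ _, Finset.mem_range.mpr hm⟩
    exact Finset.single_le_sum (f := fun z : Equiv.Perm (Fin n) × ℕ => |(gap z.1 z.2)⁻¹|)
      (fun _ _ => abs_nonneg _) hmem
  have hG : ∀ l, γ l ≤ ∑ i, γ i := fun l =>
    Finset.single_le_sum (f := γ) (fun i _ => (hγ i).le) (Finset.mem_univ l)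
  have hI : ∀ l, (γ l)⁻¹ ≤ ∑ i, (γ i)⁻¹ := fun l =>
    Finset.single_le_sum (f := fun i => (γ i)⁻¹) (fun i _ => (inv_pos.mpr (hγ i)).le)
      (Finset.mem_univ l)
  have hG0 : 0 ≤ ∑ i, γ i := Finset.sum_nonneg fun i _ => (hγ i).le
  have hI0 : 0 ≤ ∑ i, (γ i)⁻¹ := Finset.sum_nonneg fun i _ => (inv_pos.mpr (hγ i)).le
  have hA := abs_nonneg Amax
  have hS := abs_nonneg Smax
  obtain ⟨M, hM⟩ : ∃ M : ℝ, M = 1 + ∑ i, γ i + ∑ i, (γ i)⁻¹ + |Amax| + |Smax| + D := ⟨_, rfl⟩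
  have hM0 : 0 < M := by linarith
  refine ⟨M, hM0, fun l => ⟨?_, ?_⟩, ?_, ?_, fun η m h1 h2 => ?_⟩
  · show 1 / M ≤ γ l
    rw [one_div, inv_le_comm₀ hM0 (hγ l)]
    linarith [hI l]
  · show γ l ≤ M
    linarith [hG l]
  · show Amax ≤ M
    linarith [le_abs_self Amax]
  · show Smax ≤ M
    linarith [le_abs_self Smax]
  · have h3 := hgap η m h1 h2
    show 1 / M ≤ partialSum (fun l => μ (η l)) m - (∑ l, μ l) * partialSum (f η) m
    rw [← hgapdef, one_div, inv_le_comm₀ hM0 h3]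
    have h4 := hDle η m h2
    linarith [le_abs_self (gap η m)⁻¹]

/-- The lower bound uses `1 ≤ p.bound`, the upper one that the near-optimal constant exceeds any
admissible `M` by at most `1`. -/
theorem isThetaTn4_bound : IsThetaTn4 fun p => 2000 * (p.T * p.n ^ 4) * p.bound ^ 5 := by
  intro M hM
  refine ⟨2000, 2000 * (M + 1) ^ 5, by norm_num, fun p _ _ hp => ⟨?_, ?_⟩⟩
  · exact le_mul_of_one_le_right (by positivity) (one_le_pow₀ p.one_le_bound)
  · have h1 := p.one_le_bound
    have h2 := p.bound_le hM hp
    calc 2000 * ((p.T : ℝ) * p.n ^ 4) * p.bound ^ 5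
        ≤ 2000 * ((p.T : ℝ) * p.n ^ 4) * (M + 1) ^ 5 := by gcongr
      _ = _ := by ring

theorem Params.controlled_of_laws {n T : ℕ} {γ μ : Fin n → ℝ} (hn : 1 ≤ n) (hT : 1 ≤ T)
    {Amax Smax M ε σlam : ℝ} {σ : Fin n → ℝ} {P : Policy n T γ}
    {τsq : Equiv.Perm (Fin n) → Fin n → ℝ} (hM : 1 ≤ M)
    (hp : (⟨n, T, γ, μ, P.frac μ, τsq, Amax, Smax⟩ : Params).ControlledBy M) (hε : 0 < ε)
    (hεM : ε ≤ 1 / (2 * M)) {a : Measure ℕ} {s : Measure (Fin n → ℕ)}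
    (ha : IsArrivalLaw n ((∑ l, μ l) - ε) σlam Amax a) (hs : IsServiceLaw μ σ Smax s) :
    Controlled P μ a s M ε where
  weights := ⟨hn, hM, fun l => (hp.1 l).1, fun l => (hp.1 l).2⟩
  one_le_T := hT
  eps_pos := hε
  eps_le := hεM
  gap := hp.2.2.2
  laws := by
    refine ⟨?_, fun l => ?_⟩
    · filter_upwards [ha.le_max] with k hk
      exact hk.trans (mul_le_mul_of_nonneg_left hp.2.1 (Nat.cast_nonneg n))
    · filter_upwards [hs.le_max l] with k hk using hk.trans hp.2.2.1
  probArrival := ha.isProbabilityMeasure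
  probService := hs.isProbabilityMeasure
  mean_arrival := ha.mean
  mean_service := hs.mean

end Params

end LoadBalancing

/-! ### Assembly of the theorem -/

theorem theorem4 :
    ∃ N ε₀ : LoadBalancing.Params → ℝ,
      LoadBalancing.IsThetaTn4 N ∧
      ∀ (n T : ℕ) (_ : 1 ≤ n) (_ : 1 ≤ T) (γ μ : Fin n → ℝ) (_ : ∀ l, 0 < γ l)
        (_ : ∀ l, 0 < μ l) (Amax Smax : ℝ) (P : LoadBalancing.Policy n T γ)
        (_ : LoadBalancing.StrictMajorization μ (P.frac μ)) (p : LoadBalancing.Params)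
        (_ : p = ⟨n, T, γ, μ, P.frac μ, P.fracVar μ, Amax, Smax⟩),
        0 < ε₀ p ∧
        ∀ (ε : ℝ) (_ : 0 < ε) (_ : ε < ε₀ p) (σlam : ℝ) (σ : Fin n → ℝ)
          (a : MeasureTheory.Measure ℕ) (s : MeasureTheory.Measure (Fin n → ℕ))
          (_ : LoadBalancing.IsArrivalLaw n ((∑ l, μ l) - ε) σlam Amax a)
          (_ : LoadBalancing.IsServiceLaw μ σ Smax s),
          (∃ π, P.IsSteadyState μ a s π) ∧
          ∀ π, P.IsSteadyState μ a s π →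
            (MeasureTheory.Integrable (fun x => LoadBalancing.perpSq γ x.1)
                (LoadBalancing.sampled π) ∧
              ∫ x, LoadBalancing.perpSq γ x.1 ∂(LoadBalancing.sampled π) ≤ N p ^ 2) ∧
            ∀ ν, (ν = π ∨ ν = LoadBalancing.sampled π) →
              (∀ l, MeasureTheory.Integrable (fun x => (x.1 l : ℝ)) ν) ∧
              ε * ∫ x, (1 / (n : ℝ)) * ∑ l, (x.1 l : ℝ) ∂ν
                ≤ LoadBalancing.delayBound T γ Amax Smax σlam σ (N p) ε ∧
              (LoadBalancing.UncorrelatedServices s →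
                ε * ∫ x, ∑ l, (x.1 l : ℝ) ∂ν
                  ≤ LoadBalancing.delayBound T γ Amax Smax σlam σ (N p) ε) := by
  -- The threshold keeps `ε` below half of the majorization gap `1 / p.bound`, so the collapse drift
  -- keeps at least half its strength uniformly in `ε`.
  refine ⟨fun p => 2000 * (p.T * p.n ^ 4) * p.bound ^ 5, fun p => 1 / (2 * p.bound),
    LoadBalancing.isThetaTn4_bound, ?_⟩
  intro n T hn hT γ μ hγ hμ Amax Smax P hP p hp
  have hM := p.one_le_bound
  refine ⟨by positivity, fun ε hε hε0 σlam σ a s ha hs => ?_⟩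
  have hpc : p.ControlledBy p.bound := by
    refine LoadBalancing.Params.controlledBy_bound ?_
    rw [hp]
    exact LoadBalancing.exists_controlledBy hn hγ hμ hP _ Amax Smax
  have hpT : p.T = T := by rw [hp]
  have hpn : p.n = n := by rw [hp]
  simp only [hpT, hpn]
  replace hε0 : ε < 1 / (2 * p.bound) := hε0
  obtain ⟨M, hMe⟩ : ∃ M, M = p.bound := ⟨_, rfl⟩
  rw [← hMe] at hM hpc hε0 ⊢
  rw [hp] at hpc
  clear hMe
  have h := LoadBalancing.Params.controlled_of_laws hn hT hM hpc hε hε0.le ha hs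
  have := ha.isProbabilityMeasure
  have hn' : (1 : ℝ) ≤ n := by exact_mod_cast hn
  have : Nonempty (Fin n) := ⟨⟨0, hn⟩⟩
  have hγmin : 0 < ⨅ l, γ l := by
    obtain ⟨l, hl⟩ := exists_eq_ciInf_of_finite (f := γ)
    rw [← hl]; exact hγ l
  have hγle : ∀ l, ⨅ l, γ l ≤ γ l := fun l => ciInf_le (Set.finite_range γ).bddBelow l
  have hS : 0 < Smax := (hμ ⟨0, hn⟩).trans_le (h.mu_le_of_service_le hs.le_max _)
  -- The mean number of arrivals is nonnegative, so `ε` is at most the total service rate.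
  have hεS : ε ≤ n * Smax := by
    have h1 : ∑ l, μ l ≤ ∑ _l : Fin n, Smax :=
      Finset.sum_le_sum fun l _ => h.mu_le_of_service_le hs.le_max l
    simp only [Finset.sum_const, Finset.card_univ, Fintype.card_fin, nsmul_eq_mul] at h1
    linarith [h.lam_nonneg]
  have hA : 0 ≤ Amax := by
    obtain ⟨k, hk⟩ := ha.le_max.exists
    have h1 : 0 ≤ n * Amax := (Nat.cast_nonneg k).trans hk
    exact nonneg_of_mul_nonneg_right h1 (by linarith)
  refine ⟨h.exists_steadyState, fun π hπ => ⟨h.integral_sampled_perpSq hπ, fun ν hν => ?_⟩⟩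
  have htot := h.integrable_total hπ
  have hsam := h.integral_sampled hπ _ htot
  have hint : MeasureTheory.Integrable LoadBalancing.total ν := by
    rcases hν with rfl | rfl
    · exact htot
    · exact hsam.1
  have hdrift := h.integral_total_le_explicit hπ hγmin hγle hS hs.le_max
  have hT' : (1 : ℝ) ≤ T := by exact_mod_cast hT
  -- One estimate for both laws: the term `(T - 1) * ε ^ 2` is needed only at the sampling times and
  -- is merely nonnegative slack for `π`.
  have hmain : ε * ∫ x, LoadBalancing.total x ∂ν ≤ LoadBalancing.netSecondMoment a s / 2
      + √ε * ((∑ l, γ l) * (2000 * (T * n ^ 4) * M ^ 5) * √Smax / √(⨅ l, γ l))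
      + (T - 1) * ε ^ 2 := by
    have h0 : 0 ≤ ((T : ℝ) - 1) * ε ^ 2 := mul_nonneg (by linarith) (sq_nonneg _)
    rcases hν with rfl | rfl
    · linarith
    · have h1 := h.integral_first_total_le hπ
      rw [hsam.2]
      have h2 := mul_le_mul_of_nonneg_left h1 hε.le
      linarith
  have hv := h.netSecondMoment_eq
  rw [ha.var] at hv
  have hsum : ∑ l, ProbabilityTheory.variance (fun m : Fin n → ℕ => (m l : ℝ)) s
      = ∑ l, σ l ^ 2 := Finset.sum_congr rfl fun l _ => hs.var l
  obtain ⟨b1, b2⟩ := LoadBalancing.le_delayBound (σlam := σlam) (σ := σ) hn hT hγ hγmin hA hS.le hε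
    hεS (by positivity) rfl hmain
  refine ⟨fun l => ?_, ?_, fun hu => ?_⟩
  · refine hint.mono' (Measurable.of_discrete).aestronglyMeasurable
      (MeasureTheory.ae_of_all _ fun x => ?_)
    rw [Real.norm_of_nonneg (Nat.cast_nonneg _)]
    exact Finset.single_le_sum (f := fun l => (x.1 l : ℝ)) (fun _ _ => Nat.cast_nonneg _)
      (Finset.mem_univ l)
  · rw [MeasureTheory.integral_const_mul]
    refine b2 ?_
    rw [hv, ← hsum]
    linarith [h.integral_sum_sq_le]
  · refine b1 ?_
    rw [hv, ← hsum, h.integral_sum_sq_of_uncorrelated hu]
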